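/- Fix a horizon $N$, $a\in\mathbb R\setminus\{0\}$, $\lambda>0$ and $\bar x_0\in\mathbb R$. Let $x_{k+1}=ax_k+w_k$, where $e_0:=x_0-\bar x_0,\ w_0,w_1,\dots$ are independent real random variables with finite variance; $e_0$ has density $\phi_0$ and all $w_k$ have the density $\phi_w$. Put $w_{-1}:=e_0$. Assume that $\phi_0$ and $\phi_w$ are symmetric, $\phi(-x)=\phi(x)$, and unimodal, in the sense that they are strictly decreasing on $(0,\infty)$ (hence strictly increasing on $(-\infty,0)$). An event-trigger chooses $\delta_k\in\{0,1\}$ at each time $k=0,\dots,N-1$; $\delta_k=1$ means that $x_k$ is transmitted. Let $\tau_k$ be the last transmission time before $k$ ($\tau_k=-1$ if there is none), and let the error state evolve by $e_{k+1}=(1-\delta_k)ae_k+w_k$. *Algorithm.* The state of the algorithm is a vector $\alpha=(\alpha_{k,\tau})_{0\le k<N,\,-1\le\tau<k}\in\mathbb R^{N(N+1)/2}$. One pass maps $\alpha$ to $\alpha'$ as follows. (i) Set $J_N\equiv0$ and, for $k=N-1,\dots,0$, $$J_k(e,\tau)=\min_{\delta\in\{0,1\}}\Big\{(1-\delta)|e-\alpha_{k,\tau}|^2+\lambda\delta+\mathbb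 E\big[J_{k+1}(e_{k+1},\tau_{k+1})\mid e_k=e,\tau_k=\tau,\delta_k=\delta\big]\Big\},$$ and let $f_k(e,\tau)$ be any measurable selection of minimizers. (ii) Under the event-trigger $\delta_k=f_k(e_k,\tau_k)$, put $$\alpha'_{k,\tau}=\mathbb E_f\Big[\sum_{l=\tau}^{k-1}a^{k-l-1}w_l\ \Big|\ \tau_k=\tau,\ \delta_k=0\Big],$$ with the value $0$ if the conditioning event has probability zero. (The event says that after the update at time $\tau$, if $\tau\geq 0$, nothing is transmitted at $\tau+1,\dots,k$.) Then: 1. $\alpha^*=0$ is a globally asymptotically stable fixpoint of the algorithm: a pass is possible from every $\alpha$; every pass from $0$ leads to $0$; for every $\varepsilon>0$ there is $\delta>0$ such that every run $(\alpha^i)_{i\ge0}$ with $|\alpha^0|_\infty<\delta$ satisfies $|\alpha^i|_\infty<\varepsilon$ for all $i$; and every run, from any $\alpha^0$ and with any choice of the minimizers, converges to $0$. Moreover $V(\alpha)=|\beta|_\infty$ with $\beta_{k,\tau}=\alpha_{k,\tau}/a^k$ satisfies $V(\alpha')<V(\alpha)$ for every pass from $\alpha\ne0$ to $\alpha'$.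 2. Consider the problem of minimizing $$\mathbb E\Big[\sum_{k=0}^{N-1}|x_k-\hat x_k|^2+\lambda\delta_k\Big]$$ over all measurable event-triggers $\delta_k=f_k(x_0,\dots,x_k)$ and all measurable estimators $\hat x_k=g_k(z_0,\dots,z_k)$, where $z_k=x_k$ if $\delta_k=1$ and $z_k=\emptyset$ otherwise. There are $r_0,\dots,r_{N-1}\ge0$ such that "$\delta_k=1$ if and only if $|e_k|>r_k$" is a minimizing event-trigger in step (i) for $\alpha=0$, and such that this symmetric threshold trigger, with $e_k=x_k-a\hat x^{LP}_{k-1}$, together with the linear predictor $\hat x_k=\hat x^{LP}_k$ ($\hat x^{LP}_k=x_k$ if $\delta_k=1$, $\hat x^{LP}_k=a\hat x^{LP}_{k-1}$ if $\delta_k=0$, where $a\hat x^{LP}_{-1}:=\bar x_0$), attains the minimum. -/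

import Mathlib

open MeasureTheory ProbabilityTheory Filter Topology

noncomputable section

namespace EventTrigger

/-! ## Densities -/

/-- `φ` is nonnegative, symmetric about `0`, and unimodal with mode `0`: it increases strictly up to
the mode and decreases strictly after it. The value at the mode itself is left free, so that
densities with an integrable pole at `0` are included. -/
structure IsSymmetricUnimodal (φ : ℝ → ℝ) : Prop where
  nonneg : ∀ x, 0 ≤ φ x
  even : ∀ x, φ (-x) = φ x
  strictAnti : StrictAntiOn φ (Set.Ioi 0)

/-- The measure on `ℝ` with Lebesgue density `φ`. -/
def densityLaw (φ : ℝ → ℝ) : Measure ℝ := volume.withDensity fun x => ENNReal.ofReal (φ x)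

/-! ## The process and the original joint design problem -/

/-- The plant `x (k+1) = a * x k + w k` with initial value `x₀`, along one realization. -/
def state (a x₀ : ℝ) (w : ℕ → ℝ) : ℕ → ℝ
  | 0 => x₀
  | k + 1 => a * state a x₀ w k + w k

/-- Event-triggers: `δ k = f k (x 0, …, x k)`, where `true` means that `x k` is transmitted. -/
abbrev Trigger : Type := (k : ℕ) → (Fin (k + 1) → ℝ) → Bool

/-- Channel outputs: the transmitted state, or the erasure symbol. -/
abbrev Output : Type := ℝ ⊕ Unit

/-- State estimators: `x̂ k = g k (z 0, …, z k)`. -/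
abbrev Estimator : Type := (k : ℕ) → (Fin (k + 1) → Output) → ℝ

/-- The decision `δ k` along the state trajectory `x`. -/
def decision (f : Trigger) (x : ℕ → ℝ) (k : ℕ) : Bool := f k fun i => x i

/-- The channel output `z k` along the state trajectory `x`. -/
def output (f : Trigger) (x : ℕ → ℝ) (k : ℕ) : Output :=
  if decision f x k then Sum.inl (x k) else Sum.inr ()

/-- The estimate `x̂ k` along the state trajectory `x`. -/
def estimate (f : Trigger) (g : Estimator) (x : ℕ → ℝ) (k : ℕ) : ℝ := g k fun i => output f x i

/-- The cost `E [∑_{k<N} (|x k - x̂ k|² + lam * δ k)]`, possibly infinite. -/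
def cost {Ω : Type*} [MeasurableSpace Ω] (μ : Measure Ω) (N : ℕ) (a lam : ℝ) (x₀ : Ω → ℝ)
    (w : ℕ → Ω → ℝ) (f : Trigger) (g : Estimator) : ENNReal :=
  ∫⁻ ω, ENNReal.ofReal (∑ k ∈ Finset.range N,
    (|state a (x₀ ω) (fun j => w j ω) k - estimate f g (state a (x₀ ω) fun j => w j ω) k| ^ 2 +
      if decision f (state a (x₀ ω) fun j => w j ω) k then lam else 0)) ∂μ

/-- The linear prediction of `x n` from the channel outputs before time `n`: it is the mean `xbar`
of the initial state for `n = 0`, and afterwards `a` times the previous linear estimate. -/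
def linearPrediction (a xbar : ℝ) : (n : ℕ) → (Fin n → Output) → ℝ
  | 0, _ => xbar
  | n + 1, z => a * Sum.elim id (fun _ => linearPrediction a xbar n (Fin.init z)) (z (Fin.last n))

/-- The linear predictor as an estimator: the received state if there is one, and otherwise the
linear prediction from the past. -/
def linearPredictor (a xbar : ℝ) : Estimator := fun k z =>
  Sum.elim id (fun _ => linearPrediction a xbar k (Fin.init z)) (z (Fin.last k))

/-- `f` is the symmetric threshold trigger with thresholds `r` on the error `e k` of the linear
prediction of `x k`: it transmits exactly when `|e k| > r k`. -/
def IsSymmetricThreshold (a xbar : ℝ) (r : ℕ → ℝ) (f : Trigger) : Prop :=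
  ∀ (x : ℕ → ℝ) (k : ℕ), decision f x k = true ↔
    r k < |x k - linearPrediction a xbar k fun i => output f x i|

/-! ## The iterative procedure -/

/-- The biases `α (k, τ)` for `0 ≤ k < N` and `-1 ≤ τ < k`, with the sup norm. The last update time
is stored as `s = τ + 1 ∈ {0, …, k}` here and below. -/
abbrev Bias (N : ℕ) : Type := (k : Fin N) → Fin ((k : ℕ) + 1) → ℝ

/-- Event-triggers that depend on the time `k`, on `s = τ k + 1` and on the error state `e k`. -/
abbrev MarkovTrigger : Type := ℕ → ℕ → ℝ → Bool

/-- The right-hand side of the Bellman equation at time `k` before minimization: the running cost of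
the decision `d` in the state `(e, s)` with bias `b`, plus the expectation of the next value `J`
(the value function at time `k + 1`) under the noise law `ν`. -/
def bellmanRHS (a lam : ℝ) (ν : Measure ℝ) (J : ℕ → ℝ → ℝ) (b : ℝ) (k s : ℕ) (e : ℝ)
    (d : Bool) : ℝ :=
  (if d then lam else |e - b| ^ 2) +
    ∫ v, J (if d then k + 1 else s) ((if d then 0 else a * e) + v) ∂ν

/-- `J` is the sequence of value functions for the fixed bias `α`. -/
def IsValueFunction (N : ℕ) (a lam : ℝ) (ν : Measure ℝ) (α : Bias N) (J : ℕ → ℕ → ℝ → ℝ) : Prop :=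
  (∀ s e, J N s e = 0) ∧
    ∀ (k : Fin N) (s : Fin ((k : ℕ) + 1)) (e : ℝ),
      J k s e = min (bellmanRHS a lam ν (J (k + 1)) (α k s) k s e false)
        (bellmanRHS a lam ν (J (k + 1)) (α k s) k s e true)

/-- `f` is a measurable event-trigger obtained from dynamic programming for the fixed bias `α`: in
every state it selects a minimizing decision. -/
def IsDPTrigger (N : ℕ) (a lam : ℝ) (ν : Measure ℝ) (α : Bias N) (f : MarkovTrigger) : Prop :=
  (∀ k s, Measurable (f k s)) ∧ ∃ J, IsValueFunction N a lam ν α J ∧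
    ∀ (k : Fin N) (s : Fin ((k : ℕ) + 1)) (e : ℝ) (d : Bool),
      bellmanRHS a lam ν (J (k + 1)) (α k s) k s e (f k s e) ≤
        bellmanRHS a lam ν (J (k + 1)) (α k s) k s e d

/-- The closed-loop pair `(e k, τ k + 1)`, where `ξ 0 = e 0` and `ξ (k+1) = w k`. -/
def closedLoop (a : ℝ) (f : MarkovTrigger) (ξ : ℕ → ℝ) : ℕ → ℝ × ℕ
  | 0 => (ξ 0, 0)
  | k + 1 =>
    if f k (closedLoop a f ξ k).2 (closedLoop a f ξ k).1 then (ξ (k + 1), k + 1)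
    else (a * (closedLoop a f ξ k).1 + ξ (k + 1), (closedLoop a f ξ k).2)

/-- The event that the last transmission before `k` took place at time `τ = s - 1` and that nothing
is transmitted at time `k`; that is, `δ (τ+1) = … = δ k = 0` after the update at `τ`. -/
def silentEvent {Ω : Type*} (a : ℝ) (f : MarkovTrigger) (ξ : ℕ → Ω → ℝ) (k s : ℕ) : Set Ω :=
  {ω | (closedLoop a f (fun j => ξ j ω) k).2 = s ∧
    f k s (closedLoop a f (fun j => ξ j ω) k).1 = false}

/-- The noise process that drives the error: `e 0 = x₀ - xbar` (formally `w (-1)`), then `w`. -/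
def drivingNoise {Ω : Type*} (x₀ : Ω → ℝ) (xbar : ℝ) (w : ℕ → Ω → ℝ) : ℕ → Ω → ℝ
  | 0 => fun ω => x₀ ω - xbar
  | k + 1 => w k

/-- The conditional expectation of `∑_{l=τ}^{k-1} a^(k-l-1) * w l` given the silent event, where
`τ = s - 1`. It is `0` if the event is a null event. -/
def conditionalBias {Ω : Type*} [MeasurableSpace Ω] (μ : Measure Ω) (a : ℝ) (f : MarkovTrigger)
    (ξ : ℕ → Ω → ℝ) (k s : ℕ) : ℝ :=
  ∫ ω, ∑ l ∈ Finset.Icc s k, a ^ (k - l) * ξ l ω ∂(cond μ (silentEvent a f ξ k s))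

/-- One pass of the iterative procedure can lead from `α` to `α'`: some event-trigger obtained from
dynamic programming for `α` has `α'` as its conditional means. -/
def IterStep {Ω : Type*} [MeasurableSpace Ω] (μ : Measure Ω) (N : ℕ) (a lam : ℝ) (ν : Measure ℝ)
    (ξ : ℕ → Ω → ℝ) (α α' : Bias N) : Prop :=
  ∃ f : MarkovTrigger, IsDPTrigger N a lam ν α f ∧
    ∀ (k : Fin N) (s : Fin ((k : ℕ) + 1)), α' k s = conditionalBias μ a f ξ k s

/-- The function `V = |β|_∞` of the rescaled biases `β (k, τ) = α (k, τ) / a ^ k`. -/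
def lyapunov {N : ℕ} (a : ℝ) (α : Bias N) : ℝ := ‖(fun k s => α k s / a ^ (k : ℕ) : Bias N)‖

/-- Global asymptotic stability of the fixpoint `p` of the set-valued discrete-time system whose
runs are the sequences with `R (u i) (u (i+1))`. -/
structure IsGloballyAsymptoticallyStable {X : Type*} [PseudoMetricSpace X] (R : X → X → Prop)
    (p : X) : Prop where
  /-- From every state a step is possible. -/
  total : ∀ x, ∃ y, R x y
  /-- `p` is a fixpoint: the steps from `p` lead to `p` only. -/
  fixpoint : ∀ y, R p y ↔ y = p
  /-- Stability in the sense of Lyapunov. -/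
  stable : ∀ ε > 0, ∃ δ > 0, ∀ u : ℕ → X, (∀ i, R (u i) (u (i + 1))) →
    dist (u 0) p < δ → ∀ i, dist (u i) p < ε
  /-- Attraction of every run, whatever its initial state. -/
  attractive : ∀ u : ℕ → X, (∀ i, R (u i) (u (i + 1))) → Tendsto u atTop (𝓝 p)

end EventTrigger

end

/-!
A *silent run* is a stretch of time without transmission. It starts at time `s` with a fresh noise
variable, and a transmission ends it and starts the next run. In the dynamic program the effect of
everything after a run is one number, the price `c k` of a transmission at time `k`. So the biases
split into blocks, one for each `s`, which are coupled through the prices only, and the prices at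
and after time `s` depend on the later blocks only. The function `blockValue` is the value function
of one run, for given prices and biases.

**Decrease of the biases.** Let all rescaled biases of a block be bounded by `M`. By a reflection
argument for symmetric unimodal noise (`lintegral_mul_dens_reflect`), the cost of staying silent is
strictly smaller in `s` than in `t` if `t` is the mirror image of `s` under a reflection about a
centre outside the bound and lies on its outer side (`IsBowl.integral`, `silentCost_lt`). Hence the
sets of states in which the trigger is silent are *trimmed* at the bound: they contain with every
outer point its mirror image. The same reflection shows that the conditional law of the error has a
strictly larger density inside than at the mirror images outside, so that its mean, the new bias,
lies strictly inside the rescaled bound (`abs_setAverage_forwardLaw_lt`). This is the strict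
decrease of the function `lyapunov`, which gives stability and the uniqueness of the fixpoint.

**Convergence.** Passes are neither single-valued nor continuous, so strict decrease alone does not
imply convergence. It does so with a margin that is uniform over all passes, and such a margin
exists if the silent sets contain balls of a fixed radius about the biases
(`exists_margin_forwardLaw`). They do if the prices decrease strictly in time, as the prices for
zero bias do (`idealPrice_succ_lt`). The blocks are therefore treated in the order of decreasing
`s`: if the later blocks converge to `0`, then the prices converge to those for zero bias, so that
eventually the margin is uniform, and the block converges as well (`tendsto_biasSeq`).

**Optimality.** A pass with fixed prices does not increase the expected value of a silent run,
because the conditional mean minimizes the squared error and the trigger stays available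
(`integral_blockValue_le_of_means`). Passes lead from any biases to `0`, so zero bias is optimal
for a silent run at the prices for zero bias (`integral_idealValue_le`). For an arbitrary trigger
and estimator, the estimates that the estimator would produce in silence are biases of the run in
progress, given the outputs so far. The value of the run in progress then bounds the remaining cost
from below, by induction along time: a transmission starts a run with new biases, and its value is
at least that for zero bias (`blockValue_le_stageCost_add`). With thresholds that are optimal for
zero bias and the linear predictor, all these estimates are equalities (`cost_threshold_le`).
-/

namespace EventTrigger

/-! ### Symmetric unimodal densities -/

/-- A density as an extended nonnegative function. -/
noncomputable def dens (φ : ℝ → ℝ) (x : ℝ) : ENNReal := ENNReal.ofReal (φ x)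

lemma densityLaw_eq (φ : ℝ → ℝ) : densityLaw φ = volume.withDensity (dens φ) := rfl

namespace IsSymmetricUnimodal

variable {φ : ℝ → ℝ}

lemma apply_abs (h : IsSymmetricUnimodal φ) (x : ℝ) : φ |x| = φ x := by
  rcases abs_choice x with h' | h' <;> rw [h']
  exact h.even x

lemma lt_of_abs_lt (h : IsSymmetricUnimodal φ) {x y : ℝ} (hx : x ≠ 0) (hxy : |x| < |y|) :
    φ y < φ x := by
  rw [← h.apply_abs x, ← h.apply_abs y]
  exact h.strictAnti (abs_pos.2 hx) ((abs_pos.2 hx).trans hxy) hxy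

lemma measurable (h : IsSymmetricUnimodal φ) : Measurable φ := by
  have hpos : ∀ c, MeasurableSet {x : ℝ | 0 < x ∧ c < φ x} := by
    intro c
    refine Set.OrdConnected.measurableSet ⟨?_⟩
    rintro x ⟨hx, -⟩ y ⟨hy, hcy⟩ z ⟨hxz, hzy⟩
    exact ⟨hx.trans_le hxz, hcy.trans_le
      (h.strictAnti.antitoneOn (hx.trans_le hxz) hy hzy)⟩
  refine measurable_of_Ioi fun c => ?_
  have : φ ⁻¹' Set.Ioi c = {x | 0 < x ∧ c < φ x} ∪ (fun x => -x) ⁻¹' {x | 0 < x ∧ c < φ x} ∪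
      ({0} ∩ {_x | c < φ 0}) := by
    ext x
    simp only [Set.mem_preimage, Set.mem_Ioi, Set.mem_union, Set.mem_ofPred_eq, Left.neg_pos_iff,
      h.even, Set.mem_inter_iff, Set.mem_singleton_iff]
    rcases lt_trichotomy x 0 with hx | rfl | hx
    · simp [hx, hx.not_gt, hx.ne]
    · simp
    · simp [hx, hx.not_gt, hx.ne']
  rw [this]
  exact ((hpos c).union (measurable_neg (hpos c))).union
    ((measurableSet_singleton 0).inter (MeasurableSet.const _))

lemma measurable_dens (h : IsSymmetricUnimodal φ) : Measurable (dens φ) :=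
  h.measurable.ennreal_ofReal

lemma dens_neg (h : IsSymmetricUnimodal φ) (x : ℝ) : dens φ (-x) = dens φ x := by
  simp [dens, h.even]

lemma dens_lt (h : IsSymmetricUnimodal φ) {x y : ℝ} (hx : x ≠ 0) (hxy : |x| < |y|) :
    dens φ y < dens φ x :=
  (ENNReal.ofReal_lt_ofReal_iff ((h.nonneg y).trans_lt (h.lt_of_abs_lt hx hxy))).2
    (h.lt_of_abs_lt hx hxy)

/-- On a bounded range, a strictly decreasing density drops by a fixed amount over every interval of
fixed length: such an interval contains a cell of a finite grid. -/
lemma exists_gap (h : IsSymmetricUnimodal φ) {d L : ℝ} (hd : 0 < d) :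
    ∃ η > 0, ∀ x y, 0 < x → x + d ≤ y → y ≤ L → φ y + η ≤ φ x := by
  obtain ⟨n, hn⟩ := exists_nat_gt (L / (d / 3))
  have hd3 : 0 < d / 3 := by positivity
  rw [div_lt_iff₀ hd3] at hn
  set g : ℕ → ℝ := fun i => φ ((i + 1 : ℕ) * (d / 3)) - φ ((i + 2 : ℕ) * (d / 3))
  have hg : ∀ i, 0 < g i := fun i => by
    have : φ ((i + 2 : ℕ) * (d / 3)) < φ ((i + 1 : ℕ) * (d / 3)) :=
      h.strictAnti (Set.mem_Ioi.2 (by positivity)) (Set.mem_Ioi.2 (by positivity))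
        (by push_cast; linarith)
    simpa [g] using this
  obtain ⟨i₀, -, hi₀⟩ := Finset.exists_min_image (Finset.range (n + 1)) g ⟨0, by simp⟩
  refine ⟨g i₀, hg i₀, fun x y hx hxy hy => ?_⟩
  set i := ⌊x / (d / 3)⌋₊
  have h1 : (i : ℝ) * (d / 3) ≤ x := by
    rw [← le_div_iff₀ hd3]; exact Nat.floor_le (by positivity)
  have h2 : x < (i + 1 : ℝ) * (d / 3) := by
    rw [← div_lt_iff₀ hd3]; exact Nat.lt_floor_add_one _
  have hin : i < n + 1 := by
    by_contra hcon
    push Not at hcon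
    have : ((n + 1 : ℕ) : ℝ) ≤ i := by exact_mod_cast hcon
    push_cast at this
    nlinarith
  have h3 : φ ((i + 1 : ℕ) * (d / 3)) ≤ φ x :=
    h.strictAnti.antitoneOn hx (Set.mem_Ioi.2 (by positivity)) (by push_cast; linarith)
  have h4 : φ y ≤ φ ((i + 2 : ℕ) * (d / 3)) :=
    h.strictAnti.antitoneOn (Set.mem_Ioi.2 (by positivity)) (Set.mem_Ioi.2 (by linarith))
      (by push_cast; linarith)
  have := hi₀ i (Finset.mem_range.2 hin)
  have h5 : g i = φ ((i + 1 : ℕ) * (d / 3)) - φ ((i + 2 : ℕ) * (d / 3)) := rfl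
  linarith

end IsSymmetricUnimodal

/-- Folding the real line about `0`. -/
lemma lintegral_eq_setLIntegral_Ioi_add_neg {g : ℝ → ENNReal} (hg : Measurable g) :
    ∫⁻ r, g r = ∫⁻ r in Set.Ioi 0, (g r + g (-r)) := by
  have h1 : ∫⁻ r in Set.Ioi 0, g (-r) = ∫⁻ r in Set.Iio 0, g r := by
    have := (Measure.measurePreserving_neg (volume : Measure ℝ)).setLIntegral_comp_preimage
      (s := Set.Iio 0) measurableSet_Iio hg
    simpa using this
  rw [lintegral_add_left hg, h1, ← lintegral_add_compl g (measurableSet_Ioi (a := (0 : ℝ))),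
    Set.compl_Ioi, setLIntegral_congr (Iio_ae_eq_Iic (a := (0 : ℝ)))]

/-- Two-point rearrangement with an exact remainder. Truncated subtraction and infinite values do no
harm here. -/
lemma add_mul_rearrange {A B p q : ENNReal} (hAB : A ≤ B) (hqp : q ≤ p) :
    A * q + B * p = A * p + B * q + (B - A) * (p - q) := by
  obtain ⟨d, rfl⟩ := exists_add_of_le hqp
  have hB : B = A + (B - A) := (add_tsub_cancel_of_le hAB).symm
  by_cases hq : q = ⊤
  · subst hq
    simp only [top_add, tsub_self, mul_zero, add_zero]
  · rw [ENNReal.add_sub_cancel_left hq]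
    generalize B - A = e at hB
    subst hB
    ring

/-- Reflection of a convolution. If `F` puts more mass on the left half-line than on its mirror
image, then so does the law of `a * r + noise`, and the difference is an explicit integral. -/
lemma lintegral_mul_dens_reflect {φ : ℝ → ℝ} (hφ : IsSymmetricUnimodal φ) {F : ℝ → ENNReal}
    (hF : Measurable F) {a τ : ℝ} (ha : 0 < a) (hτ : 0 < τ)
    (hle : ∀ᵐ r, 0 < r → F r ≤ F (-r)) :
    ∫⁻ r, F r * dens φ (-τ - a * r) = (∫⁻ r, F r * dens φ (τ - a * r)) +
      ∫⁻ r in Set.Ioi 0, (F (-r) - F r) * (dens φ (τ - a * r) - dens φ (τ + a * r)) := by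
  have hd := hφ.measurable_dens
  have hmeas : ∀ c : ℝ, Measurable fun r => F r * dens φ (c - a * r) := fun c => by fun_prop
  rw [lintegral_eq_setLIntegral_Ioi_add_neg (hmeas _), lintegral_eq_setLIntegral_Ioi_add_neg
    (hmeas _), ← lintegral_add_left (by fun_prop)]
  refine lintegral_congr_ae ?_
  have hne : ∀ᵐ r : ℝ, r ≠ τ / a := by simp [ae_iff]
  filter_upwards [ae_restrict_of_ae hle, ae_restrict_of_ae hne,
    ae_restrict_mem measurableSet_Ioi] with r hr hr2 hr0
  have hr0 : 0 < r := hr0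
  have e1 : dens φ (-τ - a * r) = dens φ (τ + a * r) := by rw [← hφ.dens_neg]; ring_nf
  have e2 : dens φ (-τ - a * -r) = dens φ (τ - a * r) := by rw [← hφ.dens_neg]; ring_nf
  have e3 : dens φ (τ - a * -r) = dens φ (τ + a * r) := by ring_nf
  rw [e1, e2, e3]
  have har : 0 < a * r := by positivity
  refine add_mul_rearrange (hr hr0) (hφ.dens_lt ?_ ?_).le
  · intro h0
    exact hr2 (by field_simp; linarith)
  · rw [abs_of_pos (by linarith : 0 < τ + a * r), abs_lt]
    constructor <;> linarith

/-! ### Value functions of a silent run -/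

/-- The value function of one silent run. The biases are `b k` and transmitting at time `k` ends the
run at the fixed price `c k`; `n` is the number of remaining stages and `e` the error at time `k`. -/
noncomputable def blockValue (a : ℝ) (ν : Measure ℝ) (c b : ℕ → ℝ) : ℕ → ℕ → ℝ → ℝ
  | 0, _, _ => 0
  | n + 1, k, e => min ((e - b k) ^ 2 + ∫ v, blockValue a ν c b n (k + 1) (a * e + v) ∂ν) (c k)

/-- The cost of staying silent at time `k` in the error state `e`, with `n` stages after `k`. -/
noncomputable def silentCost (a : ℝ) (ν : Measure ℝ) (c b : ℕ → ℝ) (n k : ℕ) (e : ℝ) : ℝ :=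
  (e - b k) ^ 2 + ∫ v, blockValue a ν c b n (k + 1) (a * e + v) ∂ν

section Value

variable {a : ℝ} {ν : Measure ℝ} {c b : ℕ → ℝ}

lemma blockValue_nonneg (hc : ∀ k, 0 ≤ c k) (n k : ℕ) (e : ℝ) : 0 ≤ blockValue a ν c b n k e := by
  induction n generalizing k e with
  | zero => exact le_rfl
  | succ n ih =>
    exact le_min (add_nonneg (sq_nonneg _) (integral_nonneg fun v => ih _ _)) (hc k)

lemma blockValue_le (hc : ∀ k, 0 ≤ c k) (n k : ℕ) (e : ℝ) : blockValue a ν c b n k e ≤ c k := by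
  cases n with
  | zero => exact hc k
  | succ n => exact min_le_right _ _

lemma norm_blockValue_le (hc : ∀ k, 0 ≤ c k) (n k : ℕ) (e : ℝ) :
    ‖blockValue a ν c b n k e‖ ≤ c k := by
  rw [Real.norm_of_nonneg (blockValue_nonneg hc n k e)]
  exact blockValue_le hc n k e

lemma continuous_blockValue [IsProbabilityMeasure ν] (hc : ∀ k, 0 ≤ c k) (n k : ℕ) :
    Continuous (blockValue a ν c b n k) := by
  induction n generalizing k with
  | zero => exact continuous_const
  | succ n ih =>
    refine Continuous.min (Continuous.add (by fun_prop) ?_) continuous_const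
    refine continuous_of_dominated (F := fun e v => blockValue a ν c b n (k + 1) (a * e + v))
      (bound := fun _ => c (k + 1)) (fun e => ?_)
      (fun e => ae_of_all _ fun v => norm_blockValue_le hc _ _ _) (integrable_const _)
      (ae_of_all _ fun v => (ih (k + 1)).comp (by fun_prop))
    exact ((ih (k + 1)).comp (by fun_prop)).aestronglyMeasurable

lemma integrable_blockValue {ρ : Measure ℝ} [IsFiniteMeasure ρ] [IsProbabilityMeasure ν]
    (hc : ∀ k, 0 ≤ c k) (n k : ℕ) (x y : ℝ) :
    Integrable (fun v => blockValue a ν c b n k (x * y + v)) ρ :=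
  Integrable.of_bound
    (((continuous_blockValue hc n k).comp (by fun_prop)).aestronglyMeasurable) (c k)
    (ae_of_all _ fun _ => norm_blockValue_le hc _ _ _)

lemma integrable_blockValue_self {ρ : Measure ℝ} [IsFiniteMeasure ρ] [IsProbabilityMeasure ν]
    (hc : ∀ k, 0 ≤ c k) (n k : ℕ) : Integrable (blockValue a ν c b n k) ρ :=
  Integrable.of_bound (continuous_blockValue hc n k).aestronglyMeasurable (c k)
    (ae_of_all _ fun _ => norm_blockValue_le hc _ _ _)

lemma continuous_silentCost [IsProbabilityMeasure ν] (hc : ∀ k, 0 ≤ c k) (n k : ℕ) :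
    Continuous (silentCost a ν c b n k) := by
  refine Continuous.add (by fun_prop) ?_
  refine continuous_of_dominated (F := fun e v => blockValue a ν c b n (k + 1) (a * e + v))
    (bound := fun _ => c (k + 1)) (fun e => ?_)
    (fun e => ae_of_all _ fun v => norm_blockValue_le hc _ _ _) (integrable_const _)
    (ae_of_all _ fun v => (continuous_blockValue hc n (k + 1)).comp (by fun_prop))
  exact ((continuous_blockValue hc n (k + 1)).comp (by fun_prop)).aestronglyMeasurable

lemma sq_le_silentCost (hc : ∀ k, 0 ≤ c k) (n k : ℕ) (e : ℝ) :
    (e - b k) ^ 2 ≤ silentCost a ν c b n k e :=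
  le_add_of_nonneg_right (integral_nonneg fun _ => blockValue_nonneg hc _ _ _)

lemma silentCost_le [IsProbabilityMeasure ν] (hc : ∀ k, 0 ≤ c k) (n k : ℕ) (e : ℝ) :
    silentCost a ν c b n k e ≤ (e - b k) ^ 2 + c (k + 1) := by
  refine add_le_add_right ?_ _
  calc ∫ v, blockValue a ν c b n (k + 1) (a * e + v) ∂ν ≤ ∫ _v, c (k + 1) ∂ν :=
        integral_mono (integrable_blockValue hc _ _ _ _) (integrable_const _)
          fun v => blockValue_le hc _ _ _
    _ = c (k + 1) := by simp

/-- Joint continuity of the value of a run in the prices, the biases and the error. -/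
lemma tendsto_blockValue [IsProbabilityMeasure ν] {ι : Type*} {l : Filter ι}
    [l.IsCountablyGenerated] {C B : ι → ℕ → ℝ} {E : ι → ℝ} {e : ℝ} (hC : ∀ i k, 0 ≤ C i k)
    (n k : ℕ) (hc : ∀ j, k ≤ j → j < k + n → Tendsto (fun i => C i j) l (𝓝 (c j)))
    (hb : ∀ j, k ≤ j → j < k + n → Tendsto (fun i => B i j) l (𝓝 (b j)))
    (he : Tendsto E l (𝓝 e)) :
    Tendsto (fun i => blockValue a ν (C i) (B i) n k (E i)) l (𝓝 (blockValue a ν c b n k e)) := by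
  induction n generalizing k E e with
  | zero => exact tendsto_const_nhds
  | succ n ih =>
    refine Tendsto.min (Tendsto.add ((he.sub (hb k le_rfl (by omega))).pow 2) ?_)
      (hc k le_rfl (by omega))
    cases n with
    | zero => simpa [blockValue] using tendsto_const_nhds
    | succ n =>
      have hck := hc (k + 1) (by omega) (by omega)
      refine tendsto_integral_filter_of_dominated_convergence (fun _ => c (k + 1) + 1)
        (Eventually.of_forall fun i => ?_) ?_ (integrable_const _) (ae_of_all _ fun v => ?_)
      · exact ((continuous_blockValue (hC i) _ _).comp (by fun_prop)).aestronglyMeasurable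
      · filter_upwards [hck.eventually_le_const (lt_add_one (c (k + 1)))] with i hi
        exact ae_of_all _ fun v => (norm_blockValue_le (hC i) _ _ _).trans hi
      · exact ih (k + 1) (fun j h1 h2 => hc j (by omega) (by omega))
          (fun j h1 h2 => hb j (by omega) (by omega)) ((he.const_mul a).add_const v)

lemma blockValue_congr {b' : ℕ → ℝ} (n k : ℕ) (h : ∀ j, k ≤ j → b j = b' j) (e : ℝ) :
    blockValue a ν c b n k e = blockValue a ν c b' n k e := by
  induction n generalizing k e with
  | zero => rfl
  | succ n ih =>
    simp only [blockValue, h k le_rfl, ih (k + 1) (fun j hj => h j (by omega))]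

end Value

/-! ### Value functions grow away from the biases -/

/-- `J s ≤ J t` whenever the reflection that exchanges `s` and `t` has its centre outside
`(-M, M)` and `t` is the outer one of the two points. -/
def IsBowl (M : ℝ) (J : ℝ → ℝ) : Prop := ∀ s t, 2 * M * |t - s| ≤ t ^ 2 - s ^ 2 → J s ≤ J t

lemma measurePreserving_sign {σ : ℝ} (hσ : σ = 1 ∨ σ = -1) (x : ℝ) :
    MeasurePreserving (fun r : ℝ => σ * (x + r)) volume volume := by
  rcases hσ with rfl | rfl
  · simpa using measurePreserving_add_left (volume : Measure ℝ) x
  · have := (Measure.measurePreserving_neg (volume : Measure ℝ)).comp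
      (measurePreserving_add_left (volume : Measure ℝ) x)
    convert this using 1
    ext r
    simp [add_comm]

lemma dens_sign_mul {φ : ℝ → ℝ} (hφ : IsSymmetricUnimodal φ) {σ : ℝ} (hσ : σ = 1 ∨ σ = -1)
    (x : ℝ) : dens φ (σ * x) = dens φ x := by
  rcases hσ with rfl | rfl
  · simp
  · simpa using hφ.dens_neg x

lemma ofReal_integral_densityLaw {φ : ℝ → ℝ} (hφ : IsSymmetricUnimodal φ) {J : ℝ → ℝ}
    [IsProbabilityMeasure (densityLaw φ)] (hJ : Continuous J) {C : ℝ} (h0 : ∀ x, 0 ≤ J x)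
    (hC : ∀ x, J x ≤ C) (x : ℝ) :
    ENNReal.ofReal (∫ v, J (x + v) ∂densityLaw φ) =
      ∫⁻ v, ENNReal.ofReal (J (x + v)) * dens φ v := by
  rw [ofReal_integral_eq_lintegral_ofReal _ (ae_of_all _ fun v => h0 _), densityLaw_eq,
    lintegral_withDensity_eq_lintegral_mul _ hφ.measurable_dens (by fun_prop)]
  · simp only [Pi.mul_apply, mul_comm]
  · exact Integrable.of_bound (by fun_prop) C (ae_of_all _ fun v => by
      rw [Real.norm_of_nonneg (h0 _)]; exact hC _)

/-- Averaging over symmetric unimodal noise keeps the bowl shape. -/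
lemma IsBowl.integral {φ : ℝ → ℝ} (hφ : IsSymmetricUnimodal φ)
    [IsProbabilityMeasure (densityLaw φ)] {J : ℝ → ℝ} (hJ : Continuous J) {C : ℝ}
    (h0 : ∀ x, 0 ≤ J x) (hC : ∀ x, J x ≤ C) {a M : ℝ} (ha : a ≠ 0) (hB : IsBowl (M * |a|) J) :
    IsBowl M fun e => ∫ v, J (a * e + v) ∂densityLaw φ := by
  intro s t hst
  rcases eq_or_ne s t with rfl | hne
  · exact le_rfl
  set c := a * (s + t) / 2 with hc
  set δ := a * (t - s) / 2 with hδ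
  have hδ0 : δ ≠ 0 := by
    simp only [hδ, ne_eq, div_eq_zero_iff, mul_eq_zero, sub_eq_zero, not_or]
    exact ⟨⟨ha, hne.symm⟩, by norm_num⟩
  obtain ⟨σ, hσ, hσδ⟩ : ∃ σ : ℝ, (σ = 1 ∨ σ = -1) ∧ δ = σ * |δ| := by
    rcases le_total 0 δ with h | h
    · exact ⟨1, Or.inl rfl, by rw [abs_of_nonneg h]; ring⟩
    · exact ⟨-1, Or.inr rfl, by rw [abs_of_nonpos h]; ring⟩
  have hσσ : σ * σ = 1 := by rcases hσ with rfl | rfl <;> norm_num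
  have hσabs : |σ| = 1 := by rcases hσ with rfl | rfl <;> norm_num
  have hτ : 0 < |δ| := abs_pos.2 hδ0
  have hcent : M * |a| ≤ σ * c := by
    have h1 : |δ| = |a| * |t - s| / 2 := by rw [hδ, abs_div, abs_mul]; norm_num
    have h2 : σ * c * |δ| = a ^ 2 * (t ^ 2 - s ^ 2) / 4 := by
      have : c * δ = a ^ 2 * (t ^ 2 - s ^ 2) / 4 := by rw [hc, hδ]; ring
      rw [← this, hσδ]; rw [abs_mul, hσabs, abs_abs]; ring
    have h3 : M * |a| * |δ| ≤ σ * c * |δ| := by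
      rw [h2, h1]
      have := mul_le_mul_of_nonneg_left hst (sq_nonneg a)
      rw [← sq_abs a] at this ⊢
      nlinarith
    exact le_of_mul_le_mul_right h3 hτ
  -- reflect about the centre `c`; the sign `σ` turns the side of `a * s` into the positive one
  have key := lintegral_mul_dens_reflect hφ (F := fun r => ENNReal.ofReal (J (c - σ * r)))
    (by fun_prop) one_pos hτ (ae_of_all _ fun r hr => by
      refine ENNReal.ofReal_le_ofReal (hB _ _ ?_)
      have e1 : c - σ * -r - (c - σ * r) = σ * (2 * r) := by ring
      have e2 : (c - σ * -r) ^ 2 - (c - σ * r) ^ 2 = 4 * (σ * c) * r := by ring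
      rw [e1, e2, abs_mul, hσabs, abs_of_pos (by positivity : 0 < 2 * r)]
      nlinarith)
  have hsub : ∀ (x y : ℝ), a * x = c - σ * y →
      ENNReal.ofReal (∫ v, J (a * x + v) ∂densityLaw φ) =
        ∫⁻ r, ENNReal.ofReal (J (c - σ * r)) * dens φ (y - 1 * r) := by
    intro x y hxy
    rw [ofReal_integral_densityLaw hφ hJ h0 hC]
    have hσ' : -σ = 1 ∨ -σ = -1 := by rcases hσ with rfl | rfl <;> norm_num
    have hm := hφ.measurable_dens
    rw [← (measurePreserving_sign hσ' (-y)).lintegral_comp (by fun_prop)]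
    refine lintegral_congr fun r => ?_
    have e1 : a * x + -σ * (-y + r) = c - σ * r := by rw [hxy]; ring
    have e2 : -σ * (-y + r) = σ * (y - 1 * r) := by ring
    rw [e1, e2, dens_sign_mul hφ hσ]
  have hs := hsub s |δ| (by rw [← hσδ, hc, hδ]; ring)
  have ht := hsub t (-|δ|) (by rw [mul_neg, ← hσδ, hc, hδ]; ring)
  have hle : ENNReal.ofReal (∫ v, J (a * s + v) ∂densityLaw φ) ≤
      ENNReal.ofReal (∫ v, J (a * t + v) ∂densityLaw φ) := by
    rw [hs, ht, key]
    exact le_self_add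
  exact (ENNReal.ofReal_le_ofReal_iff (integral_nonneg fun _ => h0 _)).1 hle

lemma mul_sub_le_mul_abs {M x : ℝ} (hx : |x| ≤ M) (s t : ℝ) : x * (t - s) ≤ M * |t - s| :=
  (le_abs_self _).trans (by rw [abs_mul]; exact mul_le_mul_of_nonneg_right hx (abs_nonneg _))

lemma isBowl_sq_sub {M x : ℝ} (hx : |x| ≤ M) : IsBowl M fun e => (e - x) ^ 2 := fun s t hst => by
  have := mul_sub_le_mul_abs hx s t
  nlinarith

section Bowl

variable {φ : ℝ → ℝ} {a : ℝ} {c b : ℕ → ℝ}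

lemma isBowl_blockValue (hφ : IsSymmetricUnimodal φ) [IsProbabilityMeasure (densityLaw φ)]
    (ha : a ≠ 0) (hc : ∀ k, 0 ≤ c k) {M : ℝ} (n k : ℕ)
    (hb : ∀ i < n, |b (k + i)| ≤ M * |a| ^ i) :
    IsBowl M (blockValue a (densityLaw φ) c b n k) := by
  induction n generalizing k M with
  | zero => exact fun _ _ _ => le_rfl
  | succ n ih =>
    have hi := IsBowl.integral hφ (continuous_blockValue (a := a) (b := b) hc n (k + 1))
      (fun _ => blockValue_nonneg hc _ _ _) (fun _ => blockValue_le hc _ _ _) ha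
      (ih (M := M * |a|) (k + 1) fun i hi => by
        have := hb (i + 1) (by omega)
        rwa [pow_succ', ← mul_assoc, show k + (i + 1) = k + 1 + i by ring] at this)
    intro s t hst
    exact min_le_min (add_le_add (isBowl_sq_sub (by simpa using hb 0 (by omega)) s t hst)
      (hi s t hst)) le_rfl

lemma isBowl_integral_blockValue (hφ : IsSymmetricUnimodal φ)
    [IsProbabilityMeasure (densityLaw φ)] (ha : a ≠ 0) (hc : ∀ k, 0 ≤ c k) {M : ℝ} (n k : ℕ)
    (hb : ∀ i < n + 1, |b (k + i)| ≤ M * |a| ^ i) :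
    IsBowl M fun e => ∫ v, blockValue a (densityLaw φ) c b n (k + 1) (a * e + v) ∂densityLaw φ :=
  IsBowl.integral hφ (continuous_blockValue hc n (k + 1))
    (fun _ => blockValue_nonneg hc _ _ _) (fun _ => blockValue_le hc _ _ _) ha
    (isBowl_blockValue hφ ha hc (M := M * |a|) n (k + 1) fun i hi => by
      have := hb (i + 1) (by omega)
      rwa [pow_succ', ← mul_assoc, show k + (i + 1) = k + 1 + i by ring] at this)

lemma isBowl_silentCost (hφ : IsSymmetricUnimodal φ) [IsProbabilityMeasure (densityLaw φ)]
    (ha : a ≠ 0) (hc : ∀ k, 0 ≤ c k) {M : ℝ} (n k : ℕ)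
    (hb : ∀ i < n + 1, |b (k + i)| ≤ M * |a| ^ i) :
    IsBowl M (silentCost a (densityLaw φ) c b n k) := fun s t hst =>
  add_le_add (isBowl_sq_sub (by simpa using hb 0 (by omega)) s t hst)
    (isBowl_integral_blockValue hφ ha hc n k hb s t hst)

/-- Strictness comes from the running cost `(e - b k) ^ 2`; the later values need to grow only
weakly. -/
lemma silentCost_lt (hφ : IsSymmetricUnimodal φ) [IsProbabilityMeasure (densityLaw φ)]
    (ha : a ≠ 0) (hc : ∀ k, 0 ≤ c k) {M : ℝ} (n k : ℕ)
    (hb : ∀ i < n + 1, |b (k + i)| ≤ M * |a| ^ i) {s t : ℝ}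
    (hst : 2 * M * |t - s| < t ^ 2 - s ^ 2) :
    silentCost a (densityLaw φ) c b n k s < silentCost a (densityLaw φ) c b n k t := by
  refine add_lt_add_of_lt_of_le ?_ (isBowl_integral_blockValue hφ ha hc n k hb s t hst.le)
  have h1 := mul_sub_le_mul_abs (M := M) (x := b k) (by simpa using hb 0 (by omega)) s t
  nlinarith

end Bowl

/-! ### Trimmed sets -/

/-- `S` contains `s` along with `t` whenever the reflection that exchanges the two points has its
centre outside `[-M, M]` and `t` is the outer one. -/
def IsTrimmed (M : ℝ) (S : Set ℝ) : Prop :=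
  ∀ s t, 2 * M * |t - s| < t ^ 2 - s ^ 2 → t ∈ S → s ∈ S

/-- The reflection about the boundary point `σ * M` itself maps the outer part of a trimmed set into
the set, except for at most one point: the end point of the outer part. -/
lemma IsTrimmed.ae_reflect {M : ℝ} {S : Set ℝ} (hS : IsTrimmed M S) {σ : ℝ}
    (hσ : σ = 1 ∨ σ = -1) :
    ∀ᵐ τ : ℝ, 0 < τ → σ * (M + τ) ∈ S → σ * (M - τ) ∈ S := by
  have hsub : {τ : ℝ | ¬ (0 < τ → σ * (M + τ) ∈ S → σ * (M - τ) ∈ S)}.Subsingleton := by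
    have key : ∀ x y : ℝ, 0 < x → x < y → σ * (M + y) ∈ S → σ * (M - x) ∈ S := by
      intro x y hx hxy hy
      refine hS _ _ ?_ hy
      have e1 : σ * (M + y) - σ * (M - x) = σ * (y + x) := by ring
      have hσσ : σ ^ 2 = 1 := by rcases hσ with rfl | rfl <;> norm_num
      have hσabs : |σ| = 1 := by rcases hσ with rfl | rfl <;> norm_num
      rw [e1, mul_pow, mul_pow, hσσ, abs_mul, hσabs, abs_of_pos (by linarith : 0 < y + x)]
      nlinarith
    intro x hx y hy
    simp only [Set.mem_ofPred_eq, Classical.not_imp] at hx hy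
    rcases lt_trichotomy x y with h | h | h
    · exact absurd (key x y hx.1 h hy.2.1) hx.2.2
    · exact h
    · exact absurd (key y x hy.1 h hx.2.1) hy.2.2
  exact hsub.measure_zero _

/-! ### Laws of the error along a silent run -/

/-- The law of the next error `a * e + v`, restricted to the event that nothing is transmitted in
the current state `e`: here `p` is the (sub-probability) law of `e`, `S` is the set of silent states
and `ν` is the law of the noise `v`. -/
noncomputable def nextLaw (a : ℝ) (ν : Measure ℝ) (S : Set ℝ) (p : Measure ℝ) : Measure ℝ :=
  Measure.map (fun q : ℝ × ℝ => a * q.1 + q.2) ((p.restrict S).prod ν)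

/-- The law of the error after `n` silent stages with initial law `π` and silent sets `S i`. -/
noncomputable def forwardLaw (a : ℝ) (π ν : Measure ℝ) (S : ℕ → Set ℝ) : ℕ → Measure ℝ
  | 0 => π
  | n + 1 => nextLaw a ν (S n) (forwardLaw a π ν S n)

instance isFiniteMeasure_nextLaw (a : ℝ) (ν : Measure ℝ) (S : Set ℝ) (p : Measure ℝ)
    [IsFiniteMeasure ν] [IsFiniteMeasure p] : IsFiniteMeasure (nextLaw a ν S p) := by
  unfold nextLaw; infer_instance

instance isFiniteMeasure_forwardLaw (a : ℝ) (π ν : Measure ℝ) (S : ℕ → Set ℝ)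
    [IsFiniteMeasure π] [IsFiniteMeasure ν] (n : ℕ) :
    IsFiniteMeasure (forwardLaw a π ν S n) := by
  induction n with
  | zero => simpa [forwardLaw]
  | succ n ih => simp only [forwardLaw]; infer_instance

lemma nextLaw_univ (a : ℝ) (ν : Measure ℝ) (S : Set ℝ) (p : Measure ℝ)
    [IsProbabilityMeasure ν] [IsFiniteMeasure p] : nextLaw a ν S p Set.univ = p S := by
  rw [nextLaw, Measure.map_apply (by fun_prop) MeasurableSet.univ, Set.preimage_univ,
    Measure.prod_apply MeasurableSet.univ]
  simp

lemma forwardLaw_univ_le (a : ℝ) (π ν : Measure ℝ) (S : ℕ → Set ℝ)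
    [IsProbabilityMeasure π] [IsProbabilityMeasure ν] (n : ℕ) :
    forwardLaw a π ν S n Set.univ ≤ 1 := by
  induction n with
  | zero => simp [forwardLaw]
  | succ n ih =>
    rw [forwardLaw, nextLaw_univ]
    exact (measure_mono (Set.subset_univ _)).trans ih

lemma restrict_eq_withDensity_indicator {h : ℝ → ENNReal} {S : Set ℝ} (hS : MeasurableSet S) :
    (volume.withDensity h).restrict S = volume.withDensity (S.indicator h) := by
  rw [restrict_withDensity hS, withDensity_indicator hS]

lemma nextLaw_withDensity {φ : ℝ → ℝ} (hφ : IsSymmetricUnimodal φ)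
    [IsProbabilityMeasure (densityLaw φ)] (a : ℝ) {h : ℝ → ENNReal} (hh : Measurable h)
    {S : Set ℝ} (hS : MeasurableSet S) :
    nextLaw a (densityLaw φ) S (volume.withDensity h) =
      volume.withDensity fun t => ∫⁻ u, S.indicator h u * dens φ (t - a * u) := by
  have hd := hφ.measurable_dens
  have hi : Measurable (S.indicator h) := hh.indicator hS
  ext A hA
  have hA' : MeasurableSet ((fun q : ℝ × ℝ => a * q.1 + q.2) ⁻¹' A) :=
    (by fun_prop : Measurable fun q : ℝ × ℝ => a * q.1 + q.2) hA
  rw [nextLaw, Measure.map_apply (by fun_prop) hA, Measure.prod_apply hA',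
    restrict_eq_withDensity_indicator hS,
    lintegral_withDensity_eq_lintegral_mul _ hi (measurable_measure_prodMk_left hA'),
    withDensity_apply _ hA, lintegral_lintegral_swap]
  · refine lintegral_congr fun u => ?_
    simp only [Pi.mul_apply]
    rw [lintegral_const_mul _ (by fun_prop)]
    congr 1
    rw [densityLaw_eq, withDensity_apply _ (measurable_prodMk_left hA'),
      ← lintegral_indicator (measurable_prodMk_left hA'), ← lintegral_indicator hA,
      ← lintegral_add_left_eq_self (A.indicator fun t => dens φ (t - a * u)) (a * u)]
    refine lintegral_congr fun v => ?_
    by_cases hv : a * u + v ∈ A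
    · rw [Set.indicator_of_mem (by simpa using hv), Set.indicator_of_mem hv]
      ring_nf
    · rw [Set.indicator_of_notMem (by simpa using hv), Set.indicator_of_notMem hv]
  · fun_prop

/-- The density of the next law, seen from the boundary point `σ' * (M * |a|)`. -/
lemma lintegral_dens_recenter {φ : ℝ → ℝ} (hφ : IsSymmetricUnimodal φ) {a σ σ' : ℝ}
    (hσ : σ = 1 ∨ σ = -1) (hσ' : σ' = 1 ∨ σ' = -1) (haσ : a * σ = |a| * σ')
    {g : ℝ → ENNReal} (hg : Measurable g) (M τ : ℝ) :
    ∫⁻ u, g u * dens φ (σ' * (M * |a| + τ) - a * u) =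
      ∫⁻ r, g (σ * (M + r)) * dens φ (τ - |a| * r) := by
  have hd := hφ.measurable_dens
  rw [← (measurePreserving_sign hσ M).lintegral_comp (by fun_prop)]
  refine lintegral_congr fun r => ?_
  have : σ' * (M * |a| + τ) - a * (σ * (M + r)) = σ' * (τ - |a| * r) := by
    linear_combination (-M - r) * haσ
  rw [this, dens_sign_mul hφ hσ']

lemma exists_sign (a : ℝ) {σ' : ℝ} (hσ' : σ' = 1 ∨ σ' = -1) :
    ∃ σ : ℝ, (σ = 1 ∨ σ = -1) ∧ a * σ = |a| * σ' := by
  rcases abs_choice a with h | h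
  · exact ⟨σ', hσ', by rw [h]⟩
  · exact ⟨-σ', by rcases hσ' with rfl | rfl <;> simp, by rw [h]; ring⟩

/-- The inner side of a trimmed density dominates the outer side, if this is true before. -/
lemma indicator_reflect_le {M : ℝ} {S : Set ℝ} (hS : IsTrimmed M S) {σ : ℝ}
    (hσ : σ = 1 ∨ σ = -1) {h : ℝ → ENNReal}
    (hh : ∀ᵐ τ : ℝ, 0 < τ → h (σ * (M + τ)) ≤ h (σ * (M - τ))) :
    ∀ᵐ τ : ℝ, 0 < τ →
      S.indicator h (σ * (M + τ)) ≤ S.indicator h (σ * (M + -τ)) := by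
  filter_upwards [hh, hS.ae_reflect hσ] with τ h1 h2 hτ
  by_cases hm : σ * (M + τ) ∈ S
  · rw [Set.indicator_of_mem hm, ← sub_eq_add_neg, Set.indicator_of_mem (h2 hτ hm)]
    exact h1 hτ
  · rw [Set.indicator_of_notMem hm]
    exact zero_le

/-- The next density on both sides of a boundary point, and their difference. -/
lemma nextDensity_reflect {φ : ℝ → ℝ} (hφ : IsSymmetricUnimodal φ) {a : ℝ} (ha : a ≠ 0)
    {M : ℝ} {S : Set ℝ} (hSm : MeasurableSet S) (hS : IsTrimmed M S) {σ σ' : ℝ}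
    (hσ : σ = 1 ∨ σ = -1) (hσ' : σ' = 1 ∨ σ' = -1) (haσ : a * σ = |a| * σ')
    {h : ℝ → ENNReal} (hm : Measurable h)
    (hh : ∀ᵐ τ : ℝ, 0 < τ → h (σ * (M + τ)) ≤ h (σ * (M - τ))) {τ : ℝ} (hτ : 0 < τ) :
    ∫⁻ u, S.indicator h u * dens φ (σ' * (M * |a| - τ) - a * u) =
      (∫⁻ u, S.indicator h u * dens φ (σ' * (M * |a| + τ) - a * u)) +
      ∫⁻ r in Set.Ioi 0, (S.indicator h (σ * (M + -r)) - S.indicator h (σ * (M + r))) *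
        (dens φ (τ - |a| * r) - dens φ (τ + |a| * r)) := by
  have hi : Measurable (S.indicator h) := hm.indicator hSm
  rw [sub_eq_add_neg, lintegral_dens_recenter hφ hσ hσ' haσ hi,
    lintegral_dens_recenter hφ hσ hσ' haσ hi]
  exact lintegral_mul_dens_reflect hφ (F := fun r => S.indicator h (σ * (M + r)))
    (by fun_prop) (abs_pos.2 ha) hτ (indicator_reflect_le hS hσ hh)

lemma dens_add_lt {φ : ℝ → ℝ} (hφ : IsSymmetricUnimodal φ) {x y : ℝ} (hx : 0 < x) (hy : 0 < y)
    (hne : x ≠ y) : dens φ (x + y) < dens φ (x - y) := by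
  refine hφ.dens_lt (sub_ne_zero.2 hne) ?_
  rw [abs_of_pos (by linarith : 0 < x + y), abs_lt]
  constructor <;> linarith

/-! ### Strict comparison of the two sides -/

/-- `p` has a density that is strictly larger at the mirror image, with respect to either of the
boundary points `M` and `-M`, of an outer point than at the point itself. -/
def IsTilted (M : ℝ) (p : Measure ℝ) : Prop :=
  ∃ h : ℝ → ENNReal, Measurable h ∧ p = volume.withDensity h ∧
    ∀ σ : ℝ, (σ = 1 ∨ σ = -1) → ∀ᵐ τ : ℝ, 0 < τ → h (σ * (M + τ)) < h (σ * (M - τ))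

lemma isTilted_densityLaw {φ : ℝ → ℝ} (hφ : IsSymmetricUnimodal φ) {M : ℝ} (hM : 0 < M) :
    IsTilted M (densityLaw φ) := by
  refine ⟨dens φ, hφ.measurable_dens, rfl, fun σ hσ => ?_⟩
  have hne : ∀ᵐ τ : ℝ, τ ≠ M := by simp [ae_iff]
  filter_upwards [hne] with τ h1 h2
  rw [dens_sign_mul hφ hσ, dens_sign_mul hφ hσ]
  exact dens_add_lt hφ hM h2 h1.symm

/-- If the outer and the inner part of the trimmed density coincide, then both vanish. -/
lemma lintegral_indicator_eq_zero {M : ℝ} {S : Set ℝ} (hSm : MeasurableSet S)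
    (hS : IsTrimmed M S) {σ : ℝ} (hσ : σ = 1 ∨ σ = -1) {h : ℝ → ENNReal} (hm : Measurable h)
    (hh : ∀ᵐ τ : ℝ, 0 < τ → h (σ * (M + τ)) < h (σ * (M - τ)))
    (heq : ∀ᵐ τ : ℝ, 0 < τ →
      S.indicator h (σ * (M + -τ)) ≤ S.indicator h (σ * (M + τ))) :
    ∫⁻ u, S.indicator h u = 0 := by
  have hi : Measurable (S.indicator h) := hm.indicator hSm
  rw [← (measurePreserving_sign hσ M).lintegral_comp hi,
    lintegral_eq_setLIntegral_Ioi_add_neg (by fun_prop), lintegral_eq_zero_iff (by fun_prop)]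
  filter_upwards [ae_restrict_of_ae hh, ae_restrict_of_ae heq, ae_restrict_of_ae
    (indicator_reflect_le hS hσ (hh.mono fun τ h1 h2 => (h1 h2).le)),
    ae_restrict_mem measurableSet_Ioi] with τ h1 h2 h3 hτ
  have hτ : 0 < τ := hτ
  have h4 : S.indicator h (σ * (M + -τ)) = 0 := by
    by_contra hne
    have hmem : σ * (M + -τ) ∈ S := by
      by_contra hn
      exact hne (Set.indicator_of_notMem hn _)
    have := h2 hτ
    rw [Set.indicator_of_mem hmem, ← sub_eq_add_neg] at this
    exact absurd ((h1 hτ).trans_le this) (Set.indicator_le_self S h _).not_gt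
  have h5 := h3 hτ
  rw [h4] at h5 ⊢
  simpa using h5

lemma withDensity_apply_eq_lintegral_indicator {S : Set ℝ} (hS : MeasurableSet S)
    (h : ℝ → ENNReal) : volume.withDensity h S = ∫⁻ u, S.indicator h u := by
  rw [withDensity_apply _ hS, lintegral_indicator hS]

/-- A silent stage keeps the strict comparison: the trimmed law still puts strictly more mass on the
inner side, unless it vanishes, and the noise carries this over to the next law. -/
lemma isTilted_nextLaw {φ : ℝ → ℝ} (hφ : IsSymmetricUnimodal φ)
    [IsProbabilityMeasure (densityLaw φ)] {a : ℝ} (ha : a ≠ 0) {M : ℝ} {S : Set ℝ}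
    (hSm : MeasurableSet S) (hS : IsTrimmed M S) {p : Measure ℝ} [IsFiniteMeasure p]
    (hp : IsTilted M p) (hpS : p S ≠ 0) :
    IsTilted (M * |a|) (nextLaw a (densityLaw φ) S p) := by
  have hfin : IsFiniteMeasure (nextLaw a (densityLaw φ) S p) := inferInstance
  obtain ⟨h, hm, rfl, hh⟩ := hp
  have hd := hφ.measurable_dens
  have hi : Measurable (S.indicator h) := hm.indicator hSm
  have hm' : Measurable fun t => ∫⁻ u, S.indicator h u * dens φ (t - a * u) := by
    apply Measurable.lintegral_prod_right
    fun_prop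
  rw [nextLaw_withDensity hφ a hm hSm] at hfin ⊢
  refine ⟨_, hm', rfl, fun σ' hσ' => ?_⟩
  obtain ⟨σ, hσ, haσ⟩ := exists_sign a hσ'
  have htop : ∀ᵐ t, (∫⁻ u, S.indicator h u * dens φ (t - a * u)) < ⊤ := by
    refine ae_lt_top hm' ?_
    rw [← setLIntegral_univ, ← withDensity_apply _ MeasurableSet.univ]
    exact measure_ne_top _ _
  filter_upwards [(measurePreserving_sign hσ' (M * |a|)).quasiMeasurePreserving.ae htop]
    with τ h1 hτ
  rw [nextDensity_reflect hφ ha hSm hS hσ hσ' haσ hm ((hh σ hσ).mono fun τ h1 h2 => (h1 h2).le) hτ]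
  refine ENNReal.lt_add_right h1.ne fun h0 => hpS ?_
  rw [withDensity_apply_eq_lintegral_indicator hSm]
  refine lintegral_indicator_eq_zero hSm hS hσ hm (hh σ hσ) ?_
  have hne : ∀ᵐ r : ℝ, r ≠ τ / |a| := by simp [ae_iff]
  rw [lintegral_eq_zero_iff (by fun_prop), EventuallyEq, ae_restrict_iff' measurableSet_Ioi] at h0
  filter_upwards [h0, hne] with r h2 h3 hr
  have ha' : 0 < |a| := abs_pos.2 ha
  have h4 := dens_add_lt hφ hτ (mul_pos ha' hr) fun h5 => h3 (by rw [h5]; field_simp)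
  rcases mul_eq_zero.1 (h2 hr) with h5 | h5
  · exact tsub_eq_zero_iff_le.1 h5
  · exact absurd (tsub_eq_zero_iff_le.1 h5) h4.not_ge

/-- First moments about the boundary point `σ * M` on both sides, and their difference. -/
lemma moment_reflect {M : ℝ} {S : Set ℝ} (hSm : MeasurableSet S) (hS : IsTrimmed M S) {σ : ℝ}
    (hσ : σ = 1 ∨ σ = -1) {h : ℝ → ENNReal} (hm : Measurable h)
    (hh : ∀ᵐ τ : ℝ, 0 < τ → h (σ * (M + τ)) ≤ h (σ * (M - τ))) :
    ∫⁻ e in S, ENNReal.ofReal (M - σ * e) ∂(volume.withDensity h) =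
      (∫⁻ e in S, ENNReal.ofReal (-(M - σ * e)) ∂(volume.withDensity h)) +
      ∫⁻ r in Set.Ioi 0, ENNReal.ofReal r *
        (S.indicator h (σ * (M + -r)) - S.indicator h (σ * (M + r))) := by
  have hi : Measurable (S.indicator h) := hm.indicator hSm
  have hσσ : σ * σ = 1 := by rcases hσ with rfl | rfl <;> norm_num
  have e1 : ∀ r, M - σ * (σ * (M + r)) = -r := fun r => by linear_combination (-M - r) * hσσ
  rw [restrict_eq_withDensity_indicator hSm,
    lintegral_withDensity_eq_lintegral_mul _ hi (by fun_prop),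
    lintegral_withDensity_eq_lintegral_mul _ hi (by fun_prop)]
  simp only [Pi.mul_apply]
  rw [← (measurePreserving_sign hσ M).lintegral_comp (by fun_prop),
    ← (measurePreserving_sign hσ M).lintegral_comp (f := fun e => S.indicator h e *
      ENNReal.ofReal (-(M - σ * e))) (by fun_prop)]
  simp only [e1, neg_neg]
  rw [lintegral_eq_setLIntegral_Ioi_add_neg (by fun_prop),
    lintegral_eq_setLIntegral_Ioi_add_neg (by fun_prop), ← lintegral_add_left (by fun_prop)]
  refine lintegral_congr_ae ?_
  filter_upwards [ae_restrict_of_ae (indicator_reflect_le hS hσ hh),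
    ae_restrict_mem measurableSet_Ioi] with r hr hr0
  have hr0 : 0 < r := hr0
  rw [neg_neg, ENNReal.ofReal_of_nonpos (by linarith : -r ≤ 0), mul_zero, mul_zero, zero_add,
    add_zero, mul_comm _ (ENNReal.ofReal r), mul_comm _ (ENNReal.ofReal r), ← mul_add,
    add_tsub_cancel_of_le (hr hr0)]

/-- The distance of the first moment from the boundary point, in real numbers. -/
lemma exists_moment_gap {M : ℝ} {S : Set ℝ} (hSm : MeasurableSet S)
    (hSb : Bornology.IsBounded S) (hS : IsTrimmed M S) {σ : ℝ} (hσ : σ = 1 ∨ σ = -1)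
    {h : ℝ → ENNReal} [IsFiniteMeasure (volume.withDensity h)] (hm : Measurable h)
    (hh : ∀ᵐ τ : ℝ, 0 < τ → h (σ * (M + τ)) ≤ h (σ * (M - τ))) :
    ∃ R : ℝ, 0 ≤ R ∧ (ENNReal.ofReal R = ∫⁻ r in Set.Ioi 0, ENNReal.ofReal r *
        (S.indicator h (σ * (M + -r)) - S.indicator h (σ * (M + r)))) ∧
      σ * ∫ e in S, e ∂(volume.withDensity h) = M * (volume.withDensity h).real S - R := by
  have hint : IntegrableOn (fun e : ℝ => e) S (volume.withDensity h) := by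
    obtain ⟨C, hC⟩ := hSb.exists_norm_le
    exact Integrable.of_bound (by fun_prop) C ((ae_restrict_mem hSm).mono fun x hx => hC x hx)
  have hint2 : IntegrableOn (fun e : ℝ => M - σ * e) S (volume.withDensity h) :=
    (integrable_const M).sub (hint.const_mul σ)
  have h1 := moment_reflect hSm hS hσ hm hh
  have h2 := integral_eq_lintegral_pos_part_sub_lintegral_neg_part hint2
  have ht1 := Integrable.lintegral_lt_top hint2
  have ht2 := Integrable.lintegral_lt_top (Integrable.neg hint2)
  simp only [Pi.neg_apply] at ht2
  have h3 : ∫ e in S, (M - σ * e) ∂(volume.withDensity h) =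
      M * (volume.withDensity h).real S - σ * ∫ e in S, e ∂(volume.withDensity h) := by
    rw [integral_sub (integrable_const M) (Integrable.const_mul hint σ), integral_const_mul,
      setIntegral_const, smul_eq_mul, mul_comm]
  set rem := ∫⁻ r in Set.Ioi 0, ENNReal.ofReal r *
        (S.indicator h (σ * (M + -r)) - S.indicator h (σ * (M + r)))
  have hrem : rem ≠ ⊤ := ((le_add_self.trans h1.ge).trans_lt ht1).ne
  refine ⟨rem.toReal, ENNReal.toReal_nonneg, ENNReal.ofReal_toReal hrem, ?_⟩
  rw [h1, ENNReal.toReal_add ht2.ne hrem] at h2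
  linarith

/-- The conditional mean of a tilted law on a trimmed set lies strictly between the boundary points.
On a null set the average is `0`. -/
lemma abs_setAverage_lt {M : ℝ} (hM : 0 < M) {S : Set ℝ} (hSm : MeasurableSet S)
    (hSb : Bornology.IsBounded S) (hS : IsTrimmed M S) {p : Measure ℝ} [IsFiniteMeasure p]
    (hp : IsTilted M p) : |⨍ e in S, e ∂p| < M := by
  rw [setAverage_eq, smul_eq_mul]
  by_cases hpS : p S = 0
  · simpa [Measure.real, hpS] using hM
  have hpos : 0 < p.real S := ENNReal.toReal_pos hpS (measure_ne_top _ _)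
  have key : ∀ σ : ℝ, (σ = 1 ∨ σ = -1) → σ * ∫ e in S, e ∂p < M * p.real S := by
    intro σ hσ
    have hfin : IsFiniteMeasure p := inferInstance
    obtain ⟨h, hm, rfl, hh⟩ := hp
    obtain ⟨R, hR0, hR, hmean⟩ := exists_moment_gap hSm hSb hS hσ hm
      ((hh σ hσ).mono fun τ h1 h2 => (h1 h2).le)
    rcases hR0.eq_or_lt with rfl | hR0
    · refine absurd ?_ hpS
      have hi : Measurable (S.indicator h) := hm.indicator hSm
      rw [withDensity_apply_eq_lintegral_indicator hSm]
      refine lintegral_indicator_eq_zero hSm hS hσ hm (hh σ hσ) ?_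
      rw [ENNReal.ofReal_zero, eq_comm, lintegral_eq_zero_iff (by fun_prop), EventuallyEq,
        ae_restrict_iff' measurableSet_Ioi] at hR
      filter_upwards [hR] with r h2 hr
      rcases mul_eq_zero.1 (h2 hr) with h5 | h5
      · exact absurd (ENNReal.ofReal_eq_zero.1 h5) (not_le.2 hr)
      · exact tsub_eq_zero_iff_le.1 h5
    · rw [hmean]; linarith
  have h1 := key 1 (Or.inl rfl)
  have h2 := key (-1) (Or.inr rfl)
  rw [abs_mul, abs_of_pos (inv_pos.2 hpos), inv_mul_lt_iff₀ hpos, abs_lt]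
  constructor <;> linarith

/-- The conditional mean of the error after a silent run stays strictly inside the rescaled bound
`M * |a| ^ n`, if all silent sets of the run are trimmed with respect to the rescaled bounds. -/
theorem abs_setAverage_forwardLaw_lt {φ₀ φ : ℝ → ℝ} (hφ₀ : IsSymmetricUnimodal φ₀)
    (hφ : IsSymmetricUnimodal φ) [IsProbabilityMeasure (densityLaw φ₀)]
    [IsProbabilityMeasure (densityLaw φ)] {a : ℝ} (ha : a ≠ 0) {M : ℝ} (hM : 0 < M)
    {S : ℕ → Set ℝ} (n : ℕ) (hSm : ∀ i ≤ n, MeasurableSet (S i))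
    (hSb : Bornology.IsBounded (S n)) (hS : ∀ i ≤ n, IsTrimmed (M * |a| ^ i) (S i)) :
    |⨍ e in S n, e ∂forwardLaw a (densityLaw φ₀) (densityLaw φ) S n| < M * |a| ^ n := by
  have ha' : 0 < |a| := abs_pos.2 ha
  have inv : ∀ i ≤ n, forwardLaw a (densityLaw φ₀) (densityLaw φ) S i = 0 ∨
      IsTilted (M * |a| ^ i) (forwardLaw a (densityLaw φ₀) (densityLaw φ) S i) := by
    intro i hi
    induction i with
    | zero => exact Or.inr (by simpa [forwardLaw] using isTilted_densityLaw hφ₀ hM)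
    | succ i ih =>
      by_cases h0 : forwardLaw a (densityLaw φ₀) (densityLaw φ) S i (S i) = 0
      · left
        rw [forwardLaw, ← Measure.measure_univ_eq_zero, nextLaw_univ, h0]
      · right
        rcases ih (by omega) with h1 | h1
        · exact absurd (by rw [h1]; rfl) h0
        · rw [pow_succ, ← mul_assoc]
          exact isTilted_nextLaw hφ ha (hSm i (by omega)) (hS i (by omega)) h1 h0
  rcases inv n le_rfl with h0 | h0
  · rw [h0]
    simpa using by positivity
  · exact abs_setAverage_lt (by positivity) (hSm n le_rfl) hSb (hS n le_rfl) h0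

/-! ### Quantitative comparison of the two sides -/

/-- A quantitative form of `IsTilted`: on the outer points at distance between `r` and
`2 * M + 2 * r` from the boundary points, the mirror image has an excess density of `η`. -/
def IsTiltedBy (M r η : ℝ) (p : Measure ℝ) : Prop :=
  ∃ h : ℝ → ENNReal, Measurable h ∧ p = volume.withDensity h ∧
    ∀ σ : ℝ, (σ = 1 ∨ σ = -1) → ∀ᵐ τ : ℝ, 0 < τ → h (σ * (M + τ)) ≤ h (σ * (M - τ)) ∧
      (r ≤ τ → τ ≤ 2 * M + 2 * r → h (σ * (M + τ)) + ENNReal.ofReal η ≤ h (σ * (M - τ)))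

/-- A uniform form of `dens_add_lt`. The case `x = y` is excluded because the value of the density at
`0` is arbitrary. -/
lemma exists_dens_gap {φ : ℝ → ℝ} (hφ : IsSymmetricUnimodal φ) {d L : ℝ} (hd : 0 < d) :
    ∃ η > 0, ∀ x y, d ≤ x → d ≤ y → x + y ≤ L → x ≠ y →
      dens φ (x + y) + ENNReal.ofReal η ≤ dens φ (x - y) := by
  obtain ⟨η, hη, h⟩ := hφ.exists_gap (d := 2 * d) (L := L) (by positivity)
  refine ⟨η, hη, fun x y hx hy hxy hne => ?_⟩
  rw [dens, dens, ← ENNReal.ofReal_add (hφ.nonneg _) hη.le]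
  refine ENNReal.ofReal_le_ofReal ?_
  rw [← hφ.apply_abs (x - y)]
  refine h _ _ (abs_pos.2 (sub_ne_zero.2 hne)) ?_ hxy
  rcases abs_cases (x - y) with h1 | h1 <;> linarith

lemma exists_isTiltedBy_densityLaw {φ : ℝ → ℝ} (hφ : IsSymmetricUnimodal φ) {M₁ r : ℝ}
    (hM₁ : 0 < M₁) (hr : 0 < r) (M₂ : ℝ) :
    ∃ η > 0, ∀ M, M₁ ≤ M → M ≤ M₂ → IsTiltedBy M r η (densityLaw φ) := by
  obtain ⟨η, hη, h⟩ := exists_dens_gap hφ (d := min M₁ r) (L := M₂ + (2 * M₂ + 2 * r))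
    (lt_min hM₁ hr)
  refine ⟨η, hη, fun M h1 h2 => ⟨dens φ, hφ.measurable_dens, rfl, fun σ hσ => ?_⟩⟩
  have hne : ∀ᵐ τ : ℝ, τ ≠ M := by simp [ae_iff]
  filter_upwards [hne] with τ h3 h4
  rw [dens_sign_mul hφ hσ, dens_sign_mul hφ hσ]
  exact ⟨(dens_add_lt hφ (hM₁.trans_le h1) h4 h3.symm).le, fun h5 h6 =>
    h _ _ ((min_le_left _ _).trans h1) ((min_le_right _ _).trans h5) (by linarith) h3.symm⟩

/-- The mirror images of the part of a ball in the silent set at distance between `r` and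
`2 * M + 2 * r` from the boundary point contribute a fixed excess. -/
lemma le_indicator_sub {M r η : ℝ} {S : Set ℝ} {σ : ℝ} (hσ : σ = 1 ∨ σ = -1) {b : ℝ}
    (hb : |b| ≤ M) (hball : Metric.ball b (2 * r) ⊆ S) {h : ℝ → ENNReal}
    [IsFiniteMeasure (volume.withDensity h)] (hm : Measurable h) (hr : 0 < r)
    (hh : ∀ᵐ τ : ℝ, 0 < τ → h (σ * (M + τ)) ≤ h (σ * (M - τ)) ∧
      (r ≤ τ → τ ≤ 2 * M + 2 * r → h (σ * (M + τ)) + ENNReal.ofReal η ≤ h (σ * (M - τ)))) :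
    ∀ᵐ τ : ℝ, τ ∈ Set.Ioo (M - σ * b + r) (M - σ * b + 2 * r) →
      (r ≤ τ ∧ τ ≤ 2 * M + 2 * r) ∧
      ENNReal.ofReal η ≤ S.indicator h (σ * (M + -τ)) - S.indicator h (σ * (M + τ)) := by
  have htop : ∀ᵐ t, h t < ⊤ := by
    refine ae_lt_top hm ?_
    rw [← setLIntegral_univ, ← withDensity_apply _ MeasurableSet.univ]
    exact measure_ne_top _ _
  have hσb : |σ * b| ≤ M := by
    rcases hσ with rfl | rfl <;> simpa using hb
  have hσσ : σ * σ = 1 := by rcases hσ with rfl | rfl <;> norm_num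
  have hσabs : |σ| = 1 := by rcases hσ with rfl | rfl <;> norm_num
  filter_upwards [hh, (measurePreserving_sign hσ M).quasiMeasurePreserving.ae htop]
    with τ h1 h2 ⟨h3, h4⟩
  rw [abs_le] at hσb
  have hτr : r ≤ τ := by linarith
  have hτ2 : τ ≤ 2 * M + 2 * r := by linarith
  refine ⟨⟨hτr, hτ2⟩, ?_⟩
  have hmem : σ * (M + -τ) ∈ S := by
    refine hball ?_
    have : σ * (M + -τ) - b = σ * (M - σ * b - τ) := by linear_combination b * hσσ
    rw [Metric.mem_ball, Real.dist_eq, this, abs_mul, hσabs, one_mul, abs_lt]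
    constructor <;> linarith
  rw [Set.indicator_of_mem hmem]
  have h5 := (h1 (hr.trans_le hτr)).2 hτr hτ2
  rw [← sub_eq_add_neg]
  refine ENNReal.le_sub_of_add_le_left
    ((Set.indicator_le_self S h _).trans_lt h2).ne ?_
  exact (add_le_add_left (Set.indicator_le_self S h _) _).trans h5

lemma le_setLIntegral_Ioi_of_Ioo {G : ℝ → ENNReal} {x r κ : ℝ} (hx : 0 ≤ x)
    (h : ∀ᵐ τ : ℝ, τ ∈ Set.Ioo (x + r) (x + 2 * r) → ENNReal.ofReal κ ≤ G τ) (hr : 0 < r)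
    (hκ : 0 ≤ κ) : ENNReal.ofReal (κ * r) ≤ ∫⁻ τ in Set.Ioi 0, G τ :=
  calc ENNReal.ofReal (κ * r) = ∫⁻ _τ in Set.Ioo (x + r) (x + 2 * r), ENNReal.ofReal κ := by
        rw [setLIntegral_const, Real.volume_Ioo, ← ENNReal.ofReal_mul hκ]
        congr 2; ring
    _ ≤ ∫⁻ τ in Set.Ioo (x + r) (x + 2 * r), G τ :=
        lintegral_mono_ae ((ae_restrict_iff' measurableSet_Ioo).2 h)
    _ ≤ ∫⁻ τ in Set.Ioi 0, G τ :=
        lintegral_mono_set fun τ hτ => (by linarith : (0 : ℝ) < x + r).trans hτ.1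

/-- One silent stage keeps a quantitative excess, uniformly in all data with `M ≤ M₂`. -/
lemma exists_isTiltedBy_nextLaw {φ : ℝ → ℝ} (hφ : IsSymmetricUnimodal φ)
    [IsProbabilityMeasure (densityLaw φ)] {a : ℝ} (ha : a ≠ 0) {r η : ℝ} (hr : 0 < r)
    (hη : 0 < η) (M₂ : ℝ) :
    ∃ η' > 0, ∀ (M : ℝ) (S : Set ℝ) (p : Measure ℝ) (b : ℝ), M ≤ M₂ → MeasurableSet S →
      IsTrimmed M S → IsFiniteMeasure p → |b| ≤ M → Metric.ball b (2 * r) ⊆ S →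
      IsTiltedBy M r η p → IsTiltedBy (M * |a|) r η' (nextLaw a (densityLaw φ) S p) := by
  have ha' : 0 < |a| := abs_pos.2 ha
  obtain ⟨κ, hκ, hgap⟩ := exists_dens_gap hφ (d := min r (|a| * r))
    (L := (2 * (M₂ * |a|) + 2 * r) + |a| * (2 * M₂ + 2 * r)) (lt_min hr (by positivity))
  refine ⟨η * κ * r, by positivity, ?_⟩
  rintro M S p b hMM hSm hS hfin hb hball ⟨h, hm, rfl, hh⟩
  have hd := hφ.measurable_dens
  have hi : Measurable (S.indicator h) := hm.indicator hSm
  have hm' : Measurable fun t => ∫⁻ u, S.indicator h u * dens φ (t - a * u) := by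
    apply Measurable.lintegral_prod_right
    fun_prop
  rw [nextLaw_withDensity hφ a hm hSm]
  refine ⟨_, hm', rfl, fun σ' hσ' => ?_⟩
  obtain ⟨σ, hσ, haσ⟩ := exists_sign a hσ'
  refine ae_of_all _ fun τ hτ => ?_
  rw [nextDensity_reflect hφ ha hSm hS hσ hσ' haσ hm ((hh σ hσ).mono fun τ h1 h2 => (h1 h2).1) hτ]
  refine ⟨le_self_add, fun h1 h2 => ?_⟩
  gcongr
  have hσb : σ * b ≤ M := by
    rcases hσ with rfl | rfl <;> rw [abs_le] at hb <;> linarith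
  refine le_setLIntegral_Ioi_of_Ioo (x := M - σ * b) (by linarith) ?_ hr (by positivity)
  have hne : ∀ᵐ r : ℝ, r ≠ τ / |a| := by simp [ae_iff]
  filter_upwards [le_indicator_sub hσ hb hball hm hr (hh σ hσ), hne] with u h3 h4 h5
  obtain ⟨⟨h6, h7⟩, h8⟩ := h3 h5
  rw [ENNReal.ofReal_mul hη.le]
  gcongr
  have h9 : |a| * u ≤ |a| * (2 * M₂ + 2 * r) := by gcongr; linarith
  have h10 : M * |a| ≤ M₂ * |a| := by gcongr
  have h11 := hgap τ (|a| * u) ((min_le_left _ _).trans h1)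
    ((min_le_right _ _).trans (by gcongr)) (by linarith)
    (fun h5 => h4 (by rw [h5]; field_simp))
  exact ENNReal.le_sub_of_add_le_left (by simp [dens]) h11

/-- The quantitative form of `abs_setAverage_lt`. The maximum with `0` accounts for null sets, on
which the average is `0`. -/
lemma abs_setAverage_le_of_isTiltedBy {M r η b : ℝ} (hr : 0 < r) (hη : 0 < η) {S : Set ℝ}
    (hSm : MeasurableSet S) (hSb : Bornology.IsBounded S) (hS : IsTrimmed M S) (hb : |b| ≤ M)
    (hball : Metric.ball b (2 * r) ⊆ S) {p : Measure ℝ} [IsFiniteMeasure p]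
    (hp1 : p Set.univ ≤ 1) (hp : IsTiltedBy M r η p) :
    |⨍ e in S, e ∂p| ≤ max 0 (M - r * η * r) := by
  rw [setAverage_eq, smul_eq_mul]
  by_cases hpS : p S = 0
  · simp [Measure.real, hpS]
  have hpos : 0 < p.real S := ENNReal.toReal_pos hpS (measure_ne_top _ _)
  have hle1 : p.real S ≤ 1 := ENNReal.toReal_le_of_le_ofReal zero_le_one
    (by simpa using (measure_mono (Set.subset_univ S)).trans hp1)
  have key : ∀ σ : ℝ, (σ = 1 ∨ σ = -1) → σ * ∫ e in S, e ∂p ≤ M * p.real S - r * η * r := by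
    intro σ hσ
    have hfin : IsFiniteMeasure p := inferInstance
    obtain ⟨h, hm, rfl, hh⟩ := hp
    obtain ⟨R, hR0, hR, hmean⟩ := exists_moment_gap hSm hSb hS hσ hm
      ((hh σ hσ).mono fun τ h1 h2 => (h1 h2).1)
    have hσb : σ * b ≤ M := by
      rcases hσ with rfl | rfl <;> rw [abs_le] at hb <;> linarith
    have : ENNReal.ofReal (r * η * r) ≤ ENNReal.ofReal R := by
      rw [hR]
      refine le_setLIntegral_Ioi_of_Ioo (x := M - σ * b) (by linarith) ?_ hr (by positivity)
      filter_upwards [le_indicator_sub hσ hb hball hm hr (hh σ hσ)] with u h3 h5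
      obtain ⟨⟨h6, h7⟩, h8⟩ := h3 h5
      rw [ENNReal.ofReal_mul hr.le]
      gcongr
    rw [ENNReal.ofReal_le_ofReal_iff hR0] at this
    linarith
  have h1 := key 1 (Or.inl rfl)
  have h2 := key (-1) (Or.inr rfl)
  refine le_max_of_le_right ?_
  have h3 : r * η * r * p.real S ≤ r * η * r := mul_le_of_le_one_right (by positivity) hle1
  rw [abs_mul, abs_of_pos (inv_pos.2 hpos), inv_mul_le_iff₀ hpos, abs_le]
  constructor <;> linarith

/-- If all silent sets of a run contain a ball of a fixed radius about a point within the rescaled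
bound, then the conditional means lie inside by a margin that is uniform in the silent sets. -/
theorem exists_margin_forwardLaw {φ₀ φ : ℝ → ℝ} (hφ₀ : IsSymmetricUnimodal φ₀)
    (hφ : IsSymmetricUnimodal φ) [IsProbabilityMeasure (densityLaw φ₀)]
    [IsProbabilityMeasure (densityLaw φ)] {a : ℝ} (ha : a ≠ 0) {M₁ r : ℝ} (hM₁ : 0 < M₁)
    (hr : 0 < r) (M₂ : ℝ) (n : ℕ) :
    ∃ η > 0, ∀ (M : ℝ) (S : ℕ → Set ℝ) (b : ℕ → ℝ), M₁ ≤ M → M ≤ M₂ →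
      (∀ i ≤ n, MeasurableSet (S i)) → Bornology.IsBounded (S n) →
      (∀ i ≤ n, IsTrimmed (M * |a| ^ i) (S i)) → (∀ i ≤ n, |b i| ≤ M * |a| ^ i) →
      (∀ i ≤ n, Metric.ball (b i) (2 * r) ⊆ S i) →
      |⨍ e in S n, e ∂forwardLaw a (densityLaw φ₀) (densityLaw φ) S n| ≤
        max 0 (M * |a| ^ n - η) := by
  have ha' : 0 < |a| := abs_pos.2 ha
  have key : ∀ m ≤ n, ∃ η > 0, ∀ (M : ℝ) (S : ℕ → Set ℝ) (b : ℕ → ℝ), M₁ ≤ M → M ≤ M₂ →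
      (∀ i ≤ n, MeasurableSet (S i)) →
      (∀ i ≤ n, IsTrimmed (M * |a| ^ i) (S i)) → (∀ i ≤ n, |b i| ≤ M * |a| ^ i) →
      (∀ i ≤ n, Metric.ball (b i) (2 * r) ⊆ S i) →
      IsTiltedBy (M * |a| ^ m) r η (forwardLaw a (densityLaw φ₀) (densityLaw φ) S m) := by
    intro m hmn
    induction m with
    | zero =>
      obtain ⟨η, hη, h⟩ := exists_isTiltedBy_densityLaw hφ₀ hM₁ hr M₂
      exact ⟨η, hη, fun M S b h1 h2 _ _ _ _ => by simpa [forwardLaw] using h M h1 h2⟩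
    | succ m ih =>
      obtain ⟨η, hη, h⟩ := ih (by omega)
      obtain ⟨η', hη', h'⟩ := exists_isTiltedBy_nextLaw hφ ha hr hη (M₂ * |a| ^ m)
      refine ⟨η', hη', fun M S b h1 h2 h3 h4 h5 h6 => ?_⟩
      rw [pow_succ, ← mul_assoc]
      exact h' _ _ _ (b m) (by gcongr) (h3 m (by omega)) (h4 m (by omega)) inferInstance
        (h5 m (by omega)) (h6 m (by omega)) (h M S b h1 h2 h3 h4 h5 h6)
  obtain ⟨η, hη, h⟩ := key n le_rfl
  refine ⟨r * η * r, by positivity, fun M S b h1 h2 h3 h3' h4 h5 h6 => ?_⟩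
  exact abs_setAverage_le_of_isTiltedBy hr hη (h3 n le_rfl) h3' (h4 n le_rfl) (h5 n le_rfl)
    (h6 n le_rfl) (forwardLaw_univ_le _ _ _ _ _) (h M S b h1 h2 h3 h4 h5 h6)

/-! ### Convergence of the biases of one block -/

/-- A nonnegative sequence converges to `0` if it decreases strictly and, near every possible
positive limit, drops below that limit in one step. -/
lemma tendsto_zero_of_drop {v : ℕ → ℝ} (h0 : ∀ i, 0 ≤ v i)
    (h1 : ∀ i, ∀ M > 0, v i ≤ M → v (i + 1) < M)
    (h2 : ∀ M > 0, ∃ M' > M, ∀ᶠ i in atTop, v i ≤ M' → v (i + 1) < M) :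
    Tendsto v atTop (𝓝 0) := by
  have hanti : Antitone v := antitone_nat_of_succ_le fun i => by
    refine le_of_forall_pos_le_add fun ε hε => ?_
    exact (h1 i (v i + ε) (by linarith [h0 i]) (by linarith)).le
  have hbdd : BddBelow (Set.range v) := ⟨0, by rintro _ ⟨i, rfl⟩; exact h0 i⟩
  have hlim := tendsto_atTop_ciInf hanti hbdd
  rcases (le_ciInf h0).eq_or_lt with hL | hL
  · rwa [← hL] at hlim
  · obtain ⟨M', hM', hev⟩ := h2 _ hL
    obtain ⟨i, hi1, hi2⟩ := ((hlim.eventually_le_const hM').and hev).exists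
    exact absurd (hi2 hi1) (ciInf_le hbdd (i + 1)).not_gt

/-- The sup norm of the rescaled biases `b n / |a| ^ n` of one block. -/
noncomputable def scaledNorm (a : ℝ) (m : ℕ) (b : ℕ → ℝ) : ℝ :=
  ‖(fun n : Fin m => b n / |a| ^ (n : ℕ))‖

lemma scaledNorm_le_iff {a : ℝ} (ha : a ≠ 0) {m : ℕ} {b : ℕ → ℝ} {M : ℝ} (hM : 0 ≤ M) :
    scaledNorm a m b ≤ M ↔ ∀ n < m, |b n| ≤ M * |a| ^ n := by
  have ha' : 0 < |a| := abs_pos.2 ha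
  rw [scaledNorm, pi_norm_le_iff_of_nonneg hM, Fin.forall_iff]
  refine forall₂_congr fun n _ => ?_
  rw [Real.norm_eq_abs, abs_div, abs_of_pos (pow_pos ha' n), div_le_iff₀ (pow_pos ha' n)]

lemma scaledNorm_lt_iff {a : ℝ} (ha : a ≠ 0) {m : ℕ} {b : ℕ → ℝ} {M : ℝ} (hM : 0 < M) :
    scaledNorm a m b < M ↔ ∀ n < m, |b n| < M * |a| ^ n := by
  have ha' : 0 < |a| := abs_pos.2 ha
  rw [scaledNorm, pi_norm_lt_iff hM, Fin.forall_iff]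
  refine forall₂_congr fun n _ => ?_
  rw [Real.norm_eq_abs, abs_div, abs_of_pos (pow_pos ha' n), div_lt_iff₀ (pow_pos ha' n)]

/-- Biases of one block converge to `0` under repeated passes, provided that eventually the silent
sets contain balls of a fixed radius about the biases. -/
theorem tendsto_block {φ₀ φ : ℝ → ℝ} (hφ₀ : IsSymmetricUnimodal φ₀)
    (hφ : IsSymmetricUnimodal φ) [IsProbabilityMeasure (densityLaw φ₀)]
    [IsProbabilityMeasure (densityLaw φ)] {a : ℝ} (ha : a ≠ 0) (m : ℕ) {b : ℕ → ℕ → ℝ}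
    {S : ℕ → ℕ → Set ℝ} (hSm : ∀ i, ∀ n < m, MeasurableSet (S i n))
    (hSb : ∀ i, ∀ n < m, Bornology.IsBounded (S i n))
    (hS : ∀ i M, (∀ n < m, |b i n| ≤ M * |a| ^ n) → ∀ n < m, IsTrimmed (M * |a| ^ n) (S i n))
    (hb : ∀ i, ∀ n < m, b (i + 1) n = 0 ∨
      b (i + 1) n = ⨍ e in S i n, e ∂forwardLaw a (densityLaw φ₀) (densityLaw φ) (S i) n)
    {r : ℝ} (hr : 0 < r)
    (hball : ∀ᶠ i in atTop, ∀ n < m, Metric.ball (b i n) (2 * r) ⊆ S i n) :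
    ∀ n < m, Tendsto (fun i => b i n) atTop (𝓝 0) := by
  have ha' : 0 < |a| := abs_pos.2 ha
  have hv : Tendsto (fun i => scaledNorm a m (b i)) atTop (𝓝 0) := by
    refine tendsto_zero_of_drop (fun i => norm_nonneg _) (fun i M hM h => ?_) fun M hM => ?_
    · rw [scaledNorm_le_iff ha hM.le] at h
      rw [scaledNorm_lt_iff ha hM]
      intro n hn
      rcases hb i n hn with h1 | h1 <;> rw [h1]
      · simpa using by positivity
      · exact abs_setAverage_forwardLaw_lt hφ₀ hφ ha hM n (fun j hj => hSm i j (by omega))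
          (hSb i n hn) fun j hj => hS i M h j (by omega)
    -- the uniform margin `η n` beats the distance of `M'` from `M` for `M'` close to `M`
    · choose η hη hmargin using fun n => exists_margin_forwardLaw hφ₀ hφ ha hM hr (M + 1) n
      have hev : ∀ᶠ M' in 𝓝[>] M, M' ≤ M + 1 ∧
          ∀ n ∈ Finset.range m, M' * |a| ^ n - η n < M * |a| ^ n := by
        refine Filter.Eventually.filter_mono nhdsWithin_le_nhds ?_
        refine (eventually_le_nhds (by linarith)).and ?_
        rw [Filter.eventually_all_finset]
        intro n _
        have : Tendsto (fun M' => M' * |a| ^ n - η n) (𝓝 M) (𝓝 (M * |a| ^ n - η n)) :=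
          Continuous.tendsto (by fun_prop) M
        exact this.eventually_lt_const (by linarith [hη n])
      obtain ⟨M', ⟨h1, h2⟩, h3⟩ := (hev.and self_mem_nhdsWithin).exists
      have h3 : M < M' := h3
      refine ⟨M', h3, hball.mono fun i hi h => ?_⟩
      rw [scaledNorm_le_iff ha (hM.trans h3).le] at h
      rw [scaledNorm_lt_iff ha hM]
      intro n hn
      rcases hb i n hn with h4 | h4 <;> rw [h4]
      · simpa using by positivity
      · refine (hmargin n M' (S i) (b i) h3.le h1 (fun j hj => hSm i j (by omega))
          (hSb i n hn) (fun j hj => hS i M' h j (by omega)) (fun j hj => h j (by omega))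
          fun j hj => hi j (by omega)).trans_lt ?_
        exact max_lt (by positivity) (h2 n (Finset.mem_range.2 hn))
  intro n hn
  refine squeeze_zero_norm (a := fun i => scaledNorm a m (b i) * |a| ^ n) (fun i => ?_)
    (by simpa using hv.mul_const (|a| ^ n))
  exact (scaledNorm_le_iff ha (norm_nonneg _)).1 le_rfl n hn

/-! ### Silent sets of minimizing decisions -/

/-- `S` is the silent set of some minimizing decision rule: off ties, silence is chosen exactly when
it is cheaper than transmission. -/
def IsSilentSet (a : ℝ) (ν : Measure ℝ) (c b : ℕ → ℝ) (n k : ℕ) (S : Set ℝ) : Prop :=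
  ∀ e, (e ∈ S → silentCost a ν c b n k e ≤ c k) ∧ (e ∉ S → c k ≤ silentCost a ν c b n k e)

namespace IsSilentSet

variable {a : ℝ} {c b : ℕ → ℝ} {n k : ℕ} {S : Set ℝ} {ν : Measure ℝ}

lemma isBounded (h : IsSilentSet a ν c b n k S) (hc : ∀ k, 0 ≤ c k) : Bornology.IsBounded S := by
  refine (Metric.isBounded_closedBall (x := b k) (r := √(c k))).subset fun e he => ?_
  rw [Metric.mem_closedBall, Real.dist_eq, ← Real.sqrt_sq_eq_abs]
  exact Real.sqrt_le_sqrt ((sq_le_silentCost hc n k e).trans ((h e).1 he))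

lemma isTrimmed {φ : ℝ → ℝ} (hφ : IsSymmetricUnimodal φ) [IsProbabilityMeasure (densityLaw φ)]
    (ha : a ≠ 0) (h : IsSilentSet a (densityLaw φ) c b n k S) (hc : ∀ k, 0 ≤ c k) {M : ℝ}
    (hb : ∀ i < n + 1, |b (k + i)| ≤ M * |a| ^ i) : IsTrimmed M S := by
  intro s t hst ht
  by_contra hs
  exact absurd (((h s).2 hs).trans_lt (silentCost_lt hφ ha hc n k hb hst))
    ((h t).1 ht).not_gt

/-- Where transmitting becomes cheaper in time, staying silent pays off near the bias: it costs
at most the squared distance plus the next price. -/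
lemma ball_subset [IsProbabilityMeasure ν] (h : IsSilentSet a ν c b n k S) (hc : ∀ k, 0 ≤ c k)
    {r : ℝ} (hr : r ^ 2 + c (k + 1) < c k) : Metric.ball (b k) r ⊆ S := by
  intro e he
  by_contra hn
  have h1 := ((h e).2 hn).trans (silentCost_le hc n k e)
  rw [Metric.mem_ball, Real.dist_eq] at he
  have : (e - b k) ^ 2 ≤ r ^ 2 := by
    rw [← sq_abs]
    exact pow_le_pow_left₀ (abs_nonneg _) he.le 2
  linarith

end IsSilentSet

/-- Replacing the biases by the conditional means under a minimizing decision rule does not increase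
the value: the rule stays available, and the mean minimizes the squared error. -/
lemma integral_blockValue_le_of_means {a : ℝ} {ν : Measure ℝ} [IsProbabilityMeasure ν]
    {c b b' : ℕ → ℝ} (hc : ∀ k, 0 ≤ c k) (S : ℕ → Set ℝ) (n s i : ℕ) {π : Measure ℝ}
    [IsFiniteMeasure π]
    (hSm : ∀ j, i ≤ j → j < i + n → MeasurableSet (S j))
    (hS : ∀ j, i ≤ j → j < i + n → IsSilentSet a ν c b (i + n - (j + 1)) (s + j) (S j))
    (hb' : ∀ j, i ≤ j → j < i + n → b' (s + j) = ⨍ e in S j, e ∂forwardLaw a π ν S j) :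
    ∫ e, blockValue a ν c b' n (s + i) e ∂forwardLaw a π ν S i ≤
      ∫ e, blockValue a ν c b n (s + i) e ∂forwardLaw a π ν S i := by
  induction n generalizing i with
  | zero => exact le_rfl
  | succ n ih =>
    have hIH := ih (i + 1) (fun j h1 h2 => hSm j (by omega) (by omega))
      (fun j h1 h2 => by have := hS j (by omega) (by omega); convert this using 1; omega)
      (fun j h1 h2 => hb' j (by omega) (by omega))
    set p := forwardLaw a π ν S i with hp
    have hT : MeasurableSet (S i) := hSm i le_rfl (by omega)
    have hSi := hS i le_rfl (by omega)
    rw [show i + (n + 1) - (i + 1) = n by omega] at hSi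
    have hbd : ∃ C, ∀ x ∈ S i, ‖x‖ ≤ C := (hSi.isBounded hc).exists_norm_le
    obtain ⟨C, hC⟩ := hbd
    -- integrals over the next law, as integrals over the present one
    have hnext : ∀ β : ℕ → ℝ, ∫ e, blockValue a ν c β n (s + (i + 1)) e ∂forwardLaw a π ν S (i + 1)
        = ∫ e in S i, ∫ v, blockValue a ν c β n (s + i + 1) (a * e + v) ∂ν ∂p := by
      intro β
      have hcont := continuous_blockValue (a := a) (ν := ν) (b := β) hc n (s + i + 1)
      rw [← add_assoc, forwardLaw, nextLaw, integral_map (by fun_prop) hcont.aestronglyMeasurable,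
        integral_prod]
      exact Integrable.of_bound (by fun_prop) (c (s + i + 1))
        (ae_of_all _ fun _ => norm_blockValue_le hc _ _ _)
    have hint_sq : ∀ x : ℝ, IntegrableOn (fun e => (e - x) ^ 2) (S i) p := fun x => by
      refine Integrable.of_bound (by fun_prop) ((C + |x|) ^ 2)
        ((ae_restrict_mem hT).mono fun e he => ?_)
      rw [Real.norm_eq_abs, abs_pow]
      refine pow_le_pow_left₀ (abs_nonneg _) ((abs_sub _ _).trans ?_) 2
      have := hC e he
      rw [Real.norm_eq_abs] at this
      linarith
    have hint_nx : ∀ β : ℕ → ℝ, IntegrableOn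
        (fun e => ∫ v, blockValue a ν c β n (s + i + 1) (a * e + v) ∂ν) (S i) p := fun β => by
      have h1 := (continuous_silentCost (a := a) (ν := ν) (b := β) hc n (s + i)).sub
        (by fun_prop : Continuous fun e : ℝ => (e - β (s + i)) ^ 2)
      refine Integrable.of_bound (C := c (s + i + 1))
        (Continuous.aestronglyMeasurable (h1.congr fun e => by simp [silentCost])) ?_
      refine ae_of_all _ fun e => ?_
      rw [Real.norm_of_nonneg (integral_nonneg fun _ => blockValue_nonneg hc _ _ _)]
      have := silentCost_le (a := a) (ν := ν) (b := β) hc n (s + i) e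
      rw [silentCost] at this
      linarith
    have hsplit : ∀ β : ℕ → ℝ, ∫ e, blockValue a ν c β (n + 1) (s + i) e ∂p =
        (∫ e in S i, blockValue a ν c β (n + 1) (s + i) e ∂p) +
          ∫ e in (S i)ᶜ, blockValue a ν c β (n + 1) (s + i) e ∂p := fun β =>
      (integral_add_compl hT (integrable_blockValue_self hc _ _)).symm
    -- the mean minimizes the squared error
    have hmean : ∫ e in S i, (e - b' (s + i)) ^ 2 ∂p ≤ ∫ e in S i, (e - b (s + i)) ^ 2 ∂p := by
      rw [hb' i le_rfl (by omega), ← hp, setAverage_eq, smul_eq_mul]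
      have hid : IntegrableOn (fun e : ℝ => e) (S i) p :=
        Integrable.of_bound (by fun_prop) C ((ae_restrict_mem hT).mono fun e he => hC e he)
      have hsq : IntegrableOn (fun e : ℝ => e ^ 2) (S i) p := by simpa using hint_sq 0
      have hexp : ∀ x : ℝ, ∫ e in S i, (e - x) ^ 2 ∂p =
          (∫ e in S i, e ^ 2 ∂p) - 2 * x * (∫ e in S i, e ∂p) + x ^ 2 * p.real (S i) := by
        intro x
        have : ∀ e : ℝ, (e - x) ^ 2 = e ^ 2 - 2 * x * e + x ^ 2 := fun e => by ring
        simp only [this]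
        have hi1 : IntegrableOn (fun e => e ^ 2 - 2 * x * e) (S i) p :=
          Integrable.sub hsq (Integrable.const_mul hid _)
        rw [integral_add hi1 (integrable_const _),
          integral_sub hsq (Integrable.const_mul hid _), integral_const_mul,
          setIntegral_const, smul_eq_mul]
        ring
      rw [hexp, hexp]
      rcases (measureReal_nonneg (μ := p) (s := S i)).eq_or_lt with h0 | h0
      · have h00 : p (S i) = 0 := by
          rw [eq_comm, measureReal_eq_zero_iff] at h0; exact h0
        have : ∫ e in S i, e ∂p = 0 := by
          rw [Measure.restrict_eq_zero.2 h00]; simp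
        simp [this, ← h0]
      · set m := ∫ e in S i, e ∂p
        set w := p.real (S i)
        have : (w⁻¹ * m) * w = m := by field_simp
        set x := w⁻¹ * m
        rw [← this]
        nlinarith [mul_nonneg h0.le (sq_nonneg (x - b (s + i)))]
    calc ∫ e, blockValue a ν c b' (n + 1) (s + i) e ∂p
        ≤ ((∫ e in S i, (e - b' (s + i)) ^ 2 ∂p) +
            ∫ e in S i, ∫ v, blockValue a ν c b' n (s + i + 1) (a * e + v) ∂ν ∂p) +
            ∫ _e in (S i)ᶜ, c (s + i) ∂p := by
          rw [hsplit, ← integral_add (hint_sq _) (hint_nx _)]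
          refine add_le_add ?_ ?_
          · exact integral_mono (integrable_blockValue_self hc _ _) ((hint_sq _).add (hint_nx _))
              fun e => min_le_left _ _
          · exact integral_mono (integrable_blockValue_self hc _ _) (integrable_const _)
              fun e => min_le_right _ _
      _ ≤ ((∫ e in S i, (e - b (s + i)) ^ 2 ∂p) +
            ∫ e in S i, ∫ v, blockValue a ν c b n (s + i + 1) (a * e + v) ∂ν ∂p) +
            ∫ _e in (S i)ᶜ, c (s + i) ∂p := by
          rw [hnext, hnext] at hIH
          gcongr
      _ = ∫ e, blockValue a ν c b (n + 1) (s + i) e ∂p := by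
          rw [hsplit, ← integral_add (hint_sq _) (hint_nx _)]
          congr 1
          · refine setIntegral_congr_fun hT fun e he => ?_
            exact (min_eq_left ((hSi e).1 he)).symm
          · refine setIntegral_congr_fun hT.compl fun e he => ?_
            exact (min_eq_right ((hSi e).2 he)).symm

/-! ### The value functions for zero bias -/

/-- The value function with `n` remaining stages for zero bias. -/
noncomputable def idealValue (a lam : ℝ) (ν : Measure ℝ) : ℕ → ℝ → ℝ
  | 0, _ => 0
  | n + 1, e => min (e ^ 2 + ∫ v, idealValue a lam ν n (a * e + v) ∂ν)
      (lam + ∫ v, idealValue a lam ν n v ∂ν)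

/-- The price of a transmission at time `k` for zero bias: the cost `lam` plus the optimal cost of
the remaining stages. It is set to `0` from the horizon `N` on. -/
noncomputable def idealPrice (a lam : ℝ) (ν : Measure ℝ) (N k : ℕ) : ℝ :=
  if k < N then lam + ∫ v, idealValue a lam ν (N - (k + 1)) v ∂ν else 0

section Ideal

variable {a lam : ℝ} {ν : Measure ℝ}

lemma idealValue_nonneg (hlam : 0 < lam) (n : ℕ) (e : ℝ) : 0 ≤ idealValue a lam ν n e := by
  induction n generalizing e with
  | zero => exact le_rfl
  | succ n ih =>
    exact le_min (add_nonneg (sq_nonneg _) (integral_nonneg fun v => ih _))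
      (add_nonneg hlam.le (integral_nonneg fun v => ih _))

lemma idealPrice_nonneg (hlam : 0 < lam) (N k : ℕ) : 0 ≤ idealPrice a lam ν N k := by
  unfold idealPrice
  split_ifs
  · exact add_nonneg hlam.le (integral_nonneg fun v => idealValue_nonneg hlam _ _)
  · exact le_rfl

lemma idealValue_eq_blockValue (N n k : ℕ) (h : k + n = N) (e : ℝ) :
    idealValue a lam ν n e = blockValue a ν (idealPrice a lam ν N) (fun _ => 0) n k e := by
  induction n generalizing k e with
  | zero => rfl
  | succ n ih =>
    have h1 : N - (k + 1) = n := by omega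
    have h2 : k < N := by omega
    simp only [idealValue, blockValue, idealPrice, h1, h2, if_true, sub_zero,
      ← ih (k + 1) (by omega)]

lemma continuous_idealValue [IsProbabilityMeasure ν] (hlam : 0 < lam) (n : ℕ) :
    Continuous (idealValue a lam ν n) := by
  have := continuous_blockValue (a := a) (ν := ν) (b := fun _ => 0)
    (idealPrice_nonneg (a := a) (ν := ν) hlam n) n 0
  exact this.congr fun e => (idealValue_eq_blockValue n n 0 (by omega) e).symm

lemma integrable_idealValue [IsProbabilityMeasure ν] (hlam : 0 < lam) {ρ : Measure ℝ}
    [IsFiniteMeasure ρ] (n : ℕ) (x : ℝ) :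
    Integrable (fun v => idealValue a lam ν n (x + v)) ρ :=
  Integrable.of_bound
    ((continuous_idealValue hlam n).comp (by fun_prop)).aestronglyMeasurable
    (idealPrice a lam ν n 0) (ae_of_all _ fun v => by
      rw [idealValue_eq_blockValue n n 0 (by omega)]
      exact norm_blockValue_le (idealPrice_nonneg hlam n) _ _ _)

lemma integral_lt_integral_of_lt_off_point [IsProbabilityMeasure ν] [NullSingletonClass ν]
    {f g : ℝ → ℝ} (hf : Integrable f ν) (hg : Integrable g ν) (x : ℝ) (h : ∀ v ≠ x, f v < g v) :
    ∫ v, f v ∂ν < ∫ v, g v ∂ν := by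
  have hne : ∀ᵐ v ∂ν, v ≠ x := by simp [ae_iff]
  rw [← sub_pos, ← integral_sub hg hf, integral_pos_iff_support_of_nonneg_ae
    (hne.mono fun v hv => sub_nonneg.2 (h v hv).le) (hg.sub hf)]
  refine pos_iff_ne_zero.2 fun h0 => ?_
  have h1 : ∀ᵐ v ∂ν, False := by
    filter_upwards [hne, measure_eq_zero_iff_ae_notMem.1 h0] with v h2 h3
    simp only [Function.mem_support, ne_eq, not_not, sub_eq_zero] at h3
    exact absurd (h v h2) (by rw [h3]; exact lt_irrefl _)
  exact IsProbabilityMeasure.ne_zero ν (by simpa using h1)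

/-- One more stage strictly increases the cost. -/
lemma idealValue_lt_succ [IsProbabilityMeasure ν] [NullSingletonClass ν] (hlam : 0 < lam)
    (n : ℕ) {e : ℝ} (he : e ≠ 0) : idealValue a lam ν n e < idealValue a lam ν (n + 1) e := by
  induction n generalizing e with
  | zero => simp [idealValue, hlam]; positivity
  | succ n ih =>
    have hlt : ∀ x, ∫ v, idealValue a lam ν n (x + v) ∂ν <
        ∫ v, idealValue a lam ν (n + 1) (x + v) ∂ν := fun x =>
      integral_lt_integral_of_lt_off_point (integrable_idealValue hlam n x)
        (integrable_idealValue hlam (n + 1) x) (-x) fun v hv => ih fun h => hv (by linarith)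
    have h0 := hlt 0
    simp only [zero_add] at h0
    rw [idealValue, idealValue.eq_def a lam ν (n + 1 + 1)]
    exact min_lt_min (by linarith [hlt (a * e)]) (by linarith)

/-- Postponing a transmission saves the expected cost of one stage. -/
lemma idealPrice_succ_lt [IsProbabilityMeasure ν] [NullSingletonClass ν] (hlam : 0 < lam)
    {N k : ℕ} (hk : k < N) : idealPrice a lam ν N (k + 1) < idealPrice a lam ν N k := by
  rw [idealPrice, idealPrice, if_pos hk]
  split_ifs with h1
  · have h2 : N - (k + 1) = N - (k + 1 + 1) + 1 := by omega
    have := integral_lt_integral_of_lt_off_point (ν := ν)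
      (by simpa using integrable_idealValue (a := a) (ν := ν) hlam (N - (k + 1 + 1)) 0)
      (by simpa using integrable_idealValue (a := a) (ν := ν) hlam (N - (k + 1 + 1) + 1) 0) 0
      fun v hv => idealValue_lt_succ (a := a) (ν := ν) hlam (N - (k + 1 + 1)) hv
    rw [h2]
    linarith
  · exact add_pos_of_pos_of_nonneg hlam (integral_nonneg fun v => idealValue_nonneg hlam _ _)

/-- Silent sets for prices near those of zero bias contain balls of a fixed radius about the biases,
by `IsSilentSet.ball_subset`; `2 * r` is the radius used in `exists_margin_forwardLaw`. -/
lemma exists_radius [IsProbabilityMeasure ν] [NullSingletonClass ν] (hlam : 0 < lam) (N : ℕ) :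
    ∃ r > 0, ∀ k < N, (2 * r) ^ 2 + idealPrice a lam ν N (k + 1) < idealPrice a lam ν N k := by
  have hev : ∀ᶠ r : ℝ in 𝓝[>] 0, ∀ k ∈ Finset.range N,
      (2 * r) ^ 2 + idealPrice a lam ν N (k + 1) < idealPrice a lam ν N k := by
    refine Filter.Eventually.filter_mono nhdsWithin_le_nhds ?_
    rw [Filter.eventually_all_finset]
    intro k hk
    have : Tendsto (fun r : ℝ => (2 * r) ^ 2 + idealPrice a lam ν N (k + 1)) (𝓝 0)
        (𝓝 ((2 * 0) ^ 2 + idealPrice a lam ν N (k + 1))) := Continuous.tendsto (by fun_prop) 0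
    refine this.eventually_lt_const ?_
    simpa using idealPrice_succ_lt hlam (Finset.mem_range.1 hk)
  obtain ⟨r, h1, h2⟩ := (hev.and self_mem_nhdsWithin).exists
  exact ⟨r, h2, fun k hk => h1 k (Finset.mem_range.2 hk)⟩

end Ideal

instance nullSingletonClass_densityLaw (φ : ℝ → ℝ) : NullSingletonClass (densityLaw φ) := by
  unfold densityLaw; infer_instance

/-- Among all biases, zero bias minimizes the expected cost of a silent run. Repeated passes carry
arbitrary biases to `0` and never increase the cost. -/
theorem integral_idealValue_le {φ₀ φ : ℝ → ℝ} (hφ₀ : IsSymmetricUnimodal φ₀)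
    (hφ : IsSymmetricUnimodal φ) [IsProbabilityMeasure (densityLaw φ₀)]
    [IsProbabilityMeasure (densityLaw φ)] {a lam : ℝ} (ha : a ≠ 0) (hlam : 0 < lam)
    {N s : ℕ} (hs : s ≤ N) (b : ℕ → ℝ) :
    ∫ e, idealValue a lam (densityLaw φ) (N - s) e ∂densityLaw φ₀ ≤
      ∫ e, blockValue a (densityLaw φ) (idealPrice a lam (densityLaw φ) N) b (N - s) s e
        ∂densityLaw φ₀ := by
  set ν := densityLaw φ
  set π := densityLaw φ₀
  set c := idealPrice a lam ν N
  have hc : ∀ k, 0 ≤ c k := idealPrice_nonneg hlam N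
  let S : (ℕ → ℝ) → ℕ → Set ℝ := fun b j =>
    {e | silentCost a ν c b (N - s - (j + 1)) (s + j) e ≤ c (s + j)}
  have hS : ∀ b j, IsSilentSet a ν c b (N - s - (j + 1)) (s + j) (S b j) := fun b j e =>
    ⟨fun h => h, fun h => (not_le.1 h).le⟩
  have hSm : ∀ b j, MeasurableSet (S b j) := fun b j =>
    measurableSet_le (continuous_silentCost hc _ _).measurable measurable_const
  let next : (ℕ → ℝ) → ℕ → ℝ := fun b k =>
    ⨍ e in S b (k - s), e ∂forwardLaw a π ν (S b) (k - s)
  have hnext : ∀ b j, next b (s + j) = ⨍ e in S b j, e ∂forwardLaw a π ν (S b) j := by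
    intro b j
    simp only [next, Nat.add_sub_cancel_left]
  let B : ℕ → ℕ → ℝ := fun i => next^[i] b
  have hB : ∀ i, B (i + 1) = next (B i) := fun i => Function.iterate_succ_apply' next i b
  have hmono : Antitone fun i => ∫ e, blockValue a ν c (B i) (N - s) s e ∂π := by
    refine antitone_nat_of_succ_le fun i => ?_
    have := integral_blockValue_le_of_means (a := a) (ν := ν) (b := B i) (b' := B (i + 1)) hc
      (S (B i)) (N - s) s 0 (π := π) (fun j _ _ => hSm _ _)
      (fun j _ _ => by rw [zero_add]; exact hS _ _) (fun j _ _ => by rw [hB, hnext])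
    simpa [forwardLaw] using this
  obtain ⟨r, hr, hrc⟩ := exists_radius (a := a) (ν := ν) hlam N
  have hlim := tendsto_block hφ₀ hφ ha (N - s) (b := fun i j => B i (s + j))
    (S := fun i j => S (B i) j) (fun i n _ => hSm _ _) (fun i n _ => (hS _ _).isBounded hc)
    (fun i M h n hn => (hS (B i) n).isTrimmed hφ ha hc fun j hj => by
      have := h (n + j) (by omega)
      rwa [pow_add, ← mul_assoc, ← add_assoc] at this)
    (fun i n _ => Or.inr (by rw [hB, hnext])) hr
    (Eventually.of_forall fun i n hn => (hS _ _).ball_subset hc (hrc _ (by omega)))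
  have hval : Tendsto (fun i => ∫ e, blockValue a ν c (B i) (N - s) s e ∂π) atTop
      (𝓝 (∫ e, idealValue a lam ν (N - s) e ∂π)) := by
    refine tendsto_integral_of_dominated_convergence (fun _ => c s)
      (fun i => (continuous_blockValue hc _ _).aestronglyMeasurable) (integrable_const _)
      (fun i => ae_of_all _ fun e => norm_blockValue_le hc _ _ _) (ae_of_all _ fun e => ?_)
    rw [idealValue_eq_blockValue N (N - s) s (by omega)]
    refine tendsto_blockValue (fun _ => hc) _ _ (fun _ _ _ => tendsto_const_nhds)
      (fun j h1 h2 => ?_) tendsto_const_nhds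
    have := hlim (j - s) (by omega)
    rwa [show s + (j - s) = j by omega] at this
  exact hmono.le_of_tendsto hval 0

/-! ### The driving noise -/

section Noise

variable {Ω : Type*} [mΩ : MeasurableSpace Ω] {μ : Measure Ω}
  {ξ : ℕ → Ω → ℝ}

/-- The information contained in the first `k + 1` noise variables. -/
noncomputable def noiseFiltration (hξ : ∀ k, Measurable (ξ k)) :
    Filtration ℕ mΩ :=
  Filtration.natural ξ fun k => (hξ k).stronglyMeasurable

lemma measurable_noiseFiltration (hξ : ∀ k, Measurable (ξ k)) {j k : ℕ} (hjk : j ≤ k) :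
    Measurable[noiseFiltration hξ k] (ξ j) :=
  ((Filtration.stronglyAdapted_natural fun k => (hξ k).stronglyMeasurable) j).measurable.mono
    ((noiseFiltration hξ).mono hjk) le_rfl

lemma indepFun_next (hξ : ∀ k, Measurable (ξ k)) (hind : iIndepFun ξ μ) {E : Type*}
    [MeasurableSpace E] {X : Ω → E} {k : ℕ} (hX : Measurable[noiseFiltration hξ k] X) :
    IndepFun X (ξ (k + 1)) μ := by
  have h := hind.indep_comap_natural_of_lt (fun k => (hξ k).stronglyMeasurable) (Nat.lt_succ_self k)
  exact indep_of_indep_of_le_left h.symm hX.comap_le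

lemma lintegral_indepFun [IsProbabilityMeasure μ] {E : Type*} [MeasurableSpace E] {X : Ω → E}
    {Y : Ω → ℝ} (hX : Measurable X) (hY : Measurable Y) (h : IndepFun X Y μ) {F : E × ℝ → ENNReal}
    (hF : Measurable F) :
    ∫⁻ ω, F (X ω, Y ω) ∂μ = ∫⁻ ω, ∫⁻ v, F (X ω, v) ∂(μ.map Y) ∂μ := by
  have : IsProbabilityMeasure (μ.map Y) := Measure.isProbabilityMeasure_map hY.aemeasurable
  rw [← lintegral_map (f := F) (g := fun ω => (X ω, Y ω)) hF (hX.prodMk hY),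
    (indepFun_iff_map_prod_eq_prod_map_map hX.aemeasurable hY.aemeasurable).1 h,
    lintegral_prod _ hF.aemeasurable, lintegral_map hF.lintegral_prod_right' hX]

/-! ### The closed loop along one silent run -/

lemma closedLoop_succ (a : ℝ) (f : MarkovTrigger) (x : ℕ → ℝ) (k : ℕ) :
    closedLoop a f x (k + 1) =
      if f k (closedLoop a f x k).2 (closedLoop a f x k).1 then (x (k + 1), k + 1)
      else (a * (closedLoop a f x k).1 + x (k + 1), (closedLoop a f x k).2) := rfl

lemma closedLoop_snd_le (a : ℝ) (f : MarkovTrigger) (x : ℕ → ℝ) (k : ℕ) :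
    (closedLoop a f x k).2 ≤ k := by
  induction k with
  | zero => exact le_rfl
  | succ k ih =>
    rw [closedLoop]
    split_ifs
    · exact le_rfl
    · exact ih.trans (Nat.le_succ k)

lemma closedLoop_fst_eq_sum (a : ℝ) (f : MarkovTrigger) (x : ℕ → ℝ) (k s : ℕ)
    (h : (closedLoop a f x k).2 = s) :
    (closedLoop a f x k).1 = ∑ l ∈ Finset.Icc s k, a ^ (k - l) * x l := by
  induction k generalizing s with
  | zero =>
    have : s = 0 := by rw [← h]; rfl
    simp [this, closedLoop]
  | succ k ih =>
    have hle := closedLoop_snd_le a f x k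
    rw [closedLoop] at h ⊢
    split_ifs at h ⊢ with hf
    · simp only at h ⊢
      simp [← h]
    · simp only at h ⊢
      rw [ih s h, Finset.sum_Icc_succ_top (by omega), Finset.mul_sum]
      simp only [tsub_self, pow_zero, one_mul, add_left_inj]
      refine Finset.sum_congr rfl fun l hl => ?_
      rw [Finset.mem_Icc] at hl
      rw [Nat.succ_sub hl.2, pow_succ]
      ring

lemma measurable_closedLoop (hξ : ∀ k, Measurable (ξ k)) (a : ℝ) {f : MarkovTrigger}
    (hf : ∀ k s, Measurable (f k s)) (k : ℕ) :
    Measurable[noiseFiltration hξ k] fun ω => closedLoop a f (fun j => ξ j ω) k := by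
  induction k with
  | zero => exact (measurable_noiseFiltration hξ le_rfl).prodMk measurable_const
  | succ k ih =>
    have ih' := ih.mono ((noiseFiltration hξ).mono (Nat.le_succ k)) le_rfl
    have hF : Measurable fun q : ℝ × ℕ => f k q.2 q.1 :=
      measurable_from_prod_countable_left fun s => hf k s
    refine Measurable.ite ((hF.comp ih') (measurableSet_singleton true))
      ((measurable_noiseFiltration hξ le_rfl).prodMk measurable_const) ?_
    exact (((measurable_fst.comp ih').const_mul a).add
      (measurable_noiseFiltration hξ le_rfl)).prodMk (measurable_snd.comp ih')

lemma nextLaw_apply (a : ℝ) (ν : Measure ℝ) (S : Set ℝ) (p : Measure ℝ) [SFinite ν] {B : Set ℝ}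
    (hB : MeasurableSet B) :
    nextLaw a ν S p B = ∫⁻ e in S, ν ((fun v => a * e + v) ⁻¹' B) ∂p := by
  rw [nextLaw, Measure.map_apply (by fun_prop) hB, Measure.prod_apply
    ((by fun_prop : Measurable fun q : ℝ × ℝ => a * q.1 + q.2) hB)]
  rfl

/-- On the event that the run which starts at time `s` is still silent before time `s + n`, the
error at this time has the law of a silent run, up to the probability that the run starts. -/
lemma map_closedLoop_restrict [IsProbabilityMeasure μ] (hξ : ∀ k, Measurable (ξ k))
    (hind : iIndepFun ξ μ) {ν : Measure ℝ}
    (hν : ∀ k, μ.map (ξ (k + 1)) = ν) (a : ℝ) {f : MarkovTrigger}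
    (hf : ∀ k s, Measurable (f k s)) (s n : ℕ) :
    (μ.restrict {ω | (closedLoop a f (fun j => ξ j ω) (s + n)).2 = s}).map
        (fun ω => (closedLoop a f (fun j => ξ j ω) (s + n)).1) =
      μ {ω | (closedLoop a f (fun j => ξ j ω) s).2 = s} •
        forwardLaw a (μ.map (ξ s)) ν (fun j => {e | f (s + j) s e = false}) n := by
  have hcl : ∀ k, Measurable fun ω => closedLoop a f (fun j => ξ j ω) k := fun k =>
    (measurable_closedLoop hξ a hf k).mono ((noiseFiltration hξ).le k) le_rfl
  have hset : ∀ k, MeasurableSet {ω | (closedLoop a f (fun j => ξ j ω) k).2 = s} := fun k =>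
    (measurable_snd.comp (hcl k)) (measurableSet_singleton s)
  have hfst : ∀ k, Measurable fun ω => (closedLoop a f (fun j => ξ j ω) k).1 := fun k =>
    measurable_fst.comp (hcl k)
  have hνp : IsProbabilityMeasure ν := hν 0 ▸ Measure.isProbabilityMeasure_map (hξ 1).aemeasurable
  induction n with
  | zero =>
    ext B hB
    rw [Measure.map_apply (hfst _) hB, forwardLaw, Measure.smul_apply,
      Measure.restrict_apply ((hfst _) hB), Measure.map_apply (hξ s) hB,
      smul_eq_mul, add_zero]
    cases s with
    | zero => simp [closedLoop]
    | succ s =>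
      have hA : {ω | (closedLoop a f (fun j => ξ j ω) (s + 1)).2 = s + 1} =
          (fun ω => f s (closedLoop a f (fun j => ξ j ω) s).2
            (closedLoop a f (fun j => ξ j ω) s).1) ⁻¹' {true} := by
        ext ω
        have := closedLoop_snd_le a f (fun j => ξ j ω) s
        simp only [Set.mem_ofPred_eq, closedLoop_succ, Set.mem_preimage, Set.mem_singleton_iff]
        split_ifs with h
        · simp [h]
        · simp only [h, Bool.false_eq_true, iff_false]
          exact fun h' => by omega
      have hF : Measurable fun q : ℝ × ℕ => f s q.2 q.1 :=
        measurable_from_prod_countable_left fun s' => hf s s'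
      have hi := indepFun_next hξ hind (hF.comp (measurable_closedLoop hξ a hf s))
      have := hi.measure_inter_preimage_eq_mul _ _ (measurableSet_singleton true) hB
      rw [hA]
      refine Eq.trans (congrArg μ ?_) this
      ext ω
      simp only [Set.mem_inter_iff, Set.mem_preimage, Set.mem_singleton_iff, closedLoop,
        Function.comp]
      constructor
      · rintro ⟨h1, h2⟩
        rw [if_pos h2] at h1
        exact ⟨h2, h1⟩
      · rintro ⟨h1, h2⟩
        rw [if_pos h1]
        exact ⟨h2, h1⟩
  | succ n ih =>
    have hS : MeasurableSet {e | f (s + n) s e = false} := hf _ _ (measurableSet_singleton false)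
    ext B hB
    have hmeasB : Measurable fun e => ν ((fun v => a * e + v) ⁻¹' B) :=
      measurable_measure_prodMk_left
        ((by fun_prop : Measurable fun q : ℝ × ℝ => a * q.1 + q.2) hB)
    rw [forwardLaw, Measure.smul_apply, nextLaw_apply _ _ _ _ hB, ← lintegral_smul_measure,
      ← Measure.restrict_smul, ← ih, ← lintegral_indicator hS,
      lintegral_map (hmeasB.indicator hS) (hfst _),
      ← lintegral_indicator (hset _),
      Measure.map_apply (hfst _) hB,
      Measure.restrict_apply ((hfst _) hB)]
    set A : Set ((ℝ × ℕ) × ℝ) :=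
      {q | (q.1.2 = s ∧ f (s + n) s q.1.1 = false) ∧ a * q.1.1 + q.2 ∈ B}
    have hA : MeasurableSet A := by
      refine MeasurableSet.inter (MeasurableSet.inter ?_ ?_) ?_
      · exact (by fun_prop : Measurable fun q : (ℝ × ℕ) × ℝ => q.1.2) (measurableSet_singleton s)
      · exact ((hf (s + n) s).comp (by fun_prop : Measurable fun q : (ℝ × ℕ) × ℝ => q.1.1))
          (measurableSet_singleton false)
      · exact (by fun_prop : Measurable fun q : (ℝ × ℕ) × ℝ => a * q.1.1 + q.2) hB
    have hi := lintegral_indepFun (hcl (s + n)) (hξ (s + n + 1))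
      (indepFun_next hξ hind (measurable_closedLoop hξ a hf (s + n)))
      (F := A.indicator 1) (measurable_one.indicator hA)
    rw [hν] at hi
    have hpre : MeasurableSet
        {ω | (closedLoop a f (fun j => ξ j ω) (s + n), ξ (s + n + 1) ω) ∈ A} :=
      ((hcl (s + n)).prodMk (hξ (s + n + 1))) hA
    have hl : ∫⁻ ω, A.indicator 1 (closedLoop a f (fun j => ξ j ω) (s + n), ξ (s + n + 1) ω) ∂μ =
        μ {ω | (closedLoop a f (fun j => ξ j ω) (s + n), ξ (s + n + 1) ω) ∈ A} := by
      rw [← lintegral_indicator_one hpre]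
      rfl
    rw [hl] at hi
    have hsets : (fun ω => (closedLoop a f (fun j => ξ j ω) (s + (n + 1))).1) ⁻¹' B ∩
        {ω | (closedLoop a f (fun j => ξ j ω) (s + (n + 1))).2 = s} =
        {ω | (closedLoop a f (fun j => ξ j ω) (s + n), ξ (s + n + 1) ω) ∈ A} := by
      ext ω
      have hle := closedLoop_snd_le a f (fun j => ξ j ω) (s + n)
      simp only [← add_assoc, closedLoop_succ, Set.mem_inter_iff, Set.mem_preimage,
        Set.mem_ofPred_eq, A]
      split_ifs with h
      · constructor
        · rintro ⟨h1, h2⟩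
          simp only at h2
          omega
        · rintro ⟨⟨h1, h2⟩, h3⟩
          rw [h1] at h; rw [h] at h2; cases h2
      · constructor
        · rintro ⟨h1, h2⟩
          simp only at h1 h2
          rw [h2] at h
          exact ⟨⟨h2, by simpa using h⟩, h1⟩
        · rintro ⟨⟨h1, h2⟩, h3⟩
          exact ⟨h3, h1⟩
    refine (congrArg μ hsets).trans (hi.trans (lintegral_congr fun ω => ?_))
    set q := closedLoop a f (fun j => ξ j ω) (s + n)
    by_cases h : q.2 = s ∧ f (s + n) s q.1 = false
    · rw [Set.indicator_of_mem (show ω ∈ _ from h.1), Set.indicator_of_mem (show q.1 ∈ _ from h.2),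
        ← lintegral_indicator_one ((by fun_prop : Measurable fun v => a * q.1 + v) hB)]
      refine lintegral_congr fun v => ?_
      by_cases hv : a * q.1 + v ∈ B
      · rw [Set.indicator_of_mem (show (q, v) ∈ A from ⟨h, hv⟩), Set.indicator_of_mem
          (show v ∈ (fun v => a * q.1 + v) ⁻¹' B from hv)]; rfl
      · rw [Set.indicator_of_notMem (show (q, v) ∉ A from fun h' => hv h'.2),
          Set.indicator_of_notMem (show v ∉ (fun v => a * q.1 + v) ⁻¹' B from hv)]
    · have : ∀ v, A.indicator (1 : (ℝ × ℕ) × ℝ → ENNReal) (q, v) = 0 := fun v =>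
        Set.indicator_of_notMem (fun h' => h h'.1) _
      simp only [this, lintegral_zero]
      by_cases h1 : q.2 = s
      · rw [Set.indicator_of_mem (show ω ∈ _ from h1),
          Set.indicator_of_notMem (show q.1 ∉ _ from fun h2 => h ⟨h1, h2⟩)]
      · rw [Set.indicator_of_notMem (show ω ∉ _ from h1)]

/-- A conditional bias is the conditional mean of the error on the silent set, unless the
conditioning event is null. -/
lemma conditionalBias_eq [IsProbabilityMeasure μ] (hξ : ∀ k, Measurable (ξ k))
    (hind : iIndepFun ξ μ) {ν : Measure ℝ}
    (hν : ∀ k, μ.map (ξ (k + 1)) = ν) (a : ℝ) {f : MarkovTrigger}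
    (hf : ∀ k s, Measurable (f k s)) (s n : ℕ) :
    conditionalBias μ a f ξ (s + n) s = 0 ∨
      conditionalBias μ a f ξ (s + n) s = ⨍ e in {e | f (s + n) s e = false}, e
        ∂forwardLaw a (μ.map (ξ s)) ν (fun j => {e | f (s + j) s e = false}) n := by
  have hcl : Measurable fun ω => closedLoop a f (fun j => ξ j ω) (s + n) :=
    (measurable_closedLoop hξ a hf _).mono ((noiseFiltration hξ).le _) le_rfl
  have hfst : Measurable fun ω => (closedLoop a f (fun j => ξ j ω) (s + n)).1 :=
    measurable_fst.comp hcl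
  have hS : MeasurableSet {e | f (s + n) s e = false} := hf _ _ (measurableSet_singleton false)
  have hset : MeasurableSet {ω | (closedLoop a f (fun j => ξ j ω) (s + n)).2 = s} :=
    (measurable_snd.comp hcl) (measurableSet_singleton s)
  have hmap := map_closedLoop_restrict hξ hind hν a hf s n
  set p := forwardLaw a (μ.map (ξ s)) ν (fun j => {e | f (s + j) s e = false}) n
  set S := {e | f (s + n) s e = false}
  set w := μ {ω | (closedLoop a f (fun j => ξ j ω) s).2 = s}
  have hE : silentEvent a f ξ (s + n) s =
      (fun ω => (closedLoop a f (fun j => ξ j ω) (s + n)).1) ⁻¹' S ∩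
        {ω | (closedLoop a f (fun j => ξ j ω) (s + n)).2 = s} := by
    ext ω; exact and_comm
  have hpre := hfst hS
  have hEm : MeasurableSet (silentEvent a f ξ (s + n) s) := hE ▸ hpre.inter hset
  have hμE : μ (silentEvent a f ξ (s + n) s) = w * p S := by
    rw [hE]
    refine (Measure.restrict_apply hpre).symm.trans ?_
    have := congrArg (fun ρ : Measure ℝ => ρ S) hmap
    simp only [Measure.smul_apply, smul_eq_mul] at this
    rw [← this, Measure.map_apply hfst hS]
  have hval : conditionalBias μ a f ξ (s + n) s =
      (w * p S).toReal⁻¹ * (w.toReal * ∫ e in S, e ∂p) := by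
    rw [conditionalBias, ProbabilityTheory.cond, hμE, integral_smul_measure,
      ENNReal.toReal_inv, smul_eq_mul]
    congr 1
    rw [← smul_eq_mul, ← integral_smul_measure, ← Measure.restrict_smul, ← hmap,
      ← integral_indicator hS, integral_map hfst.aemeasurable
        (measurable_id'.indicator hS).aestronglyMeasurable,
      ← integral_indicator hset, ← integral_indicator hEm]
    refine integral_congr_ae (ae_of_all _ fun ω => ?_)
    rw [hE, Set.inter_comm, ← Set.indicator_indicator]
    by_cases h1 : ω ∈ {ω | (closedLoop a f (fun j => ξ j ω) (s + n)).2 = s}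
    · rw [Set.indicator_of_mem h1, Set.indicator_of_mem h1]
      by_cases h2 : (closedLoop a f (fun j => ξ j ω) (s + n)).1 ∈ S
      · rw [Set.indicator_of_mem (show ω ∈ (fun ω => (closedLoop a f (fun j => ξ j ω) (s + n)).1)
          ⁻¹' S from h2), Set.indicator_of_mem h2,
          closedLoop_fst_eq_sum a f _ _ s h1]
      · rw [Set.indicator_of_notMem (show ω ∉ (fun ω => (closedLoop a f (fun j => ξ j ω)
          (s + n)).1) ⁻¹' S from h2),
          Set.indicator_of_notMem h2]
    · rw [Set.indicator_of_notMem h1, Set.indicator_of_notMem h1]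
  by_cases hw : w = 0
  · left
    rw [hval, hw]; simp
  · right
    have hw' : w.toReal ≠ 0 := (ENNReal.toReal_pos hw (measure_ne_top _ _)).ne'
    rw [hval, setAverage_eq, smul_eq_mul, ENNReal.toReal_mul, mul_inv, Measure.real]
    field_simp

end Noise

/-! ### One pass of the procedure, block by block -/

/-- The biases of the block with last update time `s - 1`, as a sequence in time, extended by `0`. -/
noncomputable def biasSeq {N : ℕ} (α : Bias N) (s k : ℕ) : ℝ :=
  if h : k < N ∧ s < k + 1 then α ⟨k, h.1⟩ ⟨s, h.2⟩ else 0

lemma biasSeq_apply {N : ℕ} (α : Bias N) (k : Fin N) (s : Fin ((k : ℕ) + 1)) :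
    biasSeq α s k = α k s := by
  rw [biasSeq, dif_pos ⟨k.2, s.2⟩]

section DP

variable {N : ℕ} {a lam : ℝ} {ν : Measure ℝ}

lemma IsValueFunction.nonneg {α : Bias N} {J : ℕ → ℕ → ℝ → ℝ}
    (hJ : IsValueFunction N a lam ν α J) (hlam : 0 < lam) (n k s : ℕ) (hk : k + n = N)
    (hs : s ≤ k) (e : ℝ) : 0 ≤ J k s e := by
  induction n generalizing k s e with
  | zero =>
    rw [show k = N by omega, hJ.1]
  | succ n ih =>
    have h := hJ.2 ⟨k, by omega⟩ ⟨s, Nat.lt_succ_of_le hs⟩ e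
    simp only at h
    rw [h, bellmanRHS, bellmanRHS]
    refine le_min (add_nonneg (by positivity) (integral_nonneg fun v => ?_))
      (add_nonneg (by simpa using hlam.le) (integral_nonneg fun v => ?_))
    · exact ih (k + 1) _ (by omega) (by simp; omega) _
    · exact ih (k + 1) _ (by omega) (by simp) _

/-- The price of a transmission at time `k`, given the value functions `J`. -/
noncomputable def priceOf (N : ℕ) (lam : ℝ) (ν : Measure ℝ) (J : ℕ → ℕ → ℝ → ℝ) (k : ℕ) : ℝ :=
  if k < N then lam + ∫ v, J (k + 1) (k + 1) v ∂ν else 0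

lemma IsValueFunction.priceOf_nonneg {α : Bias N} {J : ℕ → ℕ → ℝ → ℝ}
    (hJ : IsValueFunction N a lam ν α J) (hlam : 0 < lam) (k : ℕ) :
    0 ≤ priceOf N lam ν J k := by
  unfold priceOf
  split_ifs with h
  · exact add_nonneg hlam.le (integral_nonneg fun v =>
      hJ.nonneg hlam (N - (k + 1)) (k + 1) (k + 1) (by omega) le_rfl v)
  · exact le_rfl

lemma bellmanRHS_true {J : ℕ → ℕ → ℝ → ℝ} {k : ℕ} (hk : k < N) (b : ℝ) (s : ℕ) (e : ℝ) :
    bellmanRHS a lam ν (J (k + 1)) b k s e true = priceOf N lam ν J k := by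
  simp [bellmanRHS, priceOf, hk]

lemma IsValueFunction.eq_blockValue {α : Bias N} {J : ℕ → ℕ → ℝ → ℝ}
    (hJ : IsValueFunction N a lam ν α J) (n k s : ℕ) (hk : k + n = N) (hs : s ≤ k) (e : ℝ) :
    J k s e = blockValue a ν (priceOf N lam ν J) (biasSeq α s) n k e := by
  induction n generalizing k s e with
  | zero =>
    rw [show k = N by omega, hJ.1]; rfl
  | succ n ih =>
    have hkN : k < N := by omega
    have h := hJ.2 ⟨k, hkN⟩ ⟨s, Nat.lt_succ_of_le hs⟩ e
    simp only at h
    rw [h, bellmanRHS_true hkN, blockValue, biasSeq, dif_pos ⟨hkN, by omega⟩, bellmanRHS]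
    simp only [Bool.false_eq_true, if_false, sq_abs]
    simp only [ih (k + 1) s (by omega) (by omega)]

lemma IsValueFunction.bellmanRHS_false {α : Bias N} {J : ℕ → ℕ → ℝ → ℝ}
    (hJ : IsValueFunction N a lam ν α J) (k : Fin N) (s : Fin ((k : ℕ) + 1)) (e : ℝ) :
    bellmanRHS a lam ν (J (k + 1)) (α k s) k s e false =
      silentCost a ν (priceOf N lam ν J) (biasSeq α s) (N - (k + 1)) k e := by
  rw [silentCost, biasSeq_apply, bellmanRHS]
  simp only [Bool.false_eq_true, if_false, sq_abs]
  have := s.2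
  simp only [hJ.eq_blockValue (N - (k + 1)) (k + 1) s (by omega) (by omega)]

/-- Value functions by backward recursion: `n` is the number of remaining stages. -/
noncomputable def backwardValue (a lam : ℝ) (ν : Measure ℝ) (α : Bias N) : ℕ → ℕ → ℝ → ℝ
  | 0, _, _ => 0
  | n + 1, s, e =>
    min (bellmanRHS a lam ν (backwardValue a lam ν α n) (biasSeq α s (N - (n + 1)))
        (N - (n + 1)) s e false)
      (bellmanRHS a lam ν (backwardValue a lam ν α n) (biasSeq α s (N - (n + 1)))
        (N - (n + 1)) s e true)

lemma isValueFunction_backwardValue (α : Bias N) :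
    IsValueFunction N a lam ν α fun k => backwardValue a lam ν α (N - k) := by
  refine ⟨fun s e => by simp [backwardValue], fun k s e => ?_⟩
  have h1 : N - (k : ℕ) = N - (k + 1) + 1 := by omega
  have h2 : N - (N - ((k : ℕ) + 1) + 1) = k := by omega
  simp only [h1, backwardValue, h2, biasSeq_apply]

lemma exists_isDPTrigger [IsProbabilityMeasure ν] (hlam : 0 < lam) (α : Bias N) :
    ∃ f, IsDPTrigger N a lam ν α f := by
  have hJ := isValueFunction_backwardValue (a := a) (lam := lam) (ν := ν) α
  set J : ℕ → ℕ → ℝ → ℝ := fun k => backwardValue a lam ν α (N - k)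
  set c := priceOf N lam ν J
  have hc : ∀ k, 0 ≤ c k := hJ.priceOf_nonneg hlam
  refine ⟨fun k s e => decide (c k < silentCost a ν c (biasSeq α s) (N - (k + 1)) k e),
    fun k s => ?_, J, hJ, fun k s e d => ?_⟩
  · exact measurable_to_bool (by
      simpa [Set.preimage] using measurableSet_lt measurable_const
        (continuous_silentCost (a := a) (ν := ν) (b := biasSeq α s) hc (N - (k + 1)) k).measurable)
  · have h1 := hJ.bellmanRHS_false k s e
    have h2 := bellmanRHS_true (a := a) (lam := lam) (ν := ν) (J := J) k.2 (α k s) s e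
    by_cases h : c k < silentCost a ν c (biasSeq α s) (N - (k + 1)) k e
    · simp only [h, decide_true]
      cases d
      · rw [h1, h2]; exact h.le
      · exact le_rfl
    · simp only [h, decide_false]
      cases d
      · exact le_rfl
      · rw [h1, h2]; exact not_lt.1 h

/-- The silent sets of an event-trigger from dynamic programming, together with the prices. -/
lemma IsDPTrigger.exists_prices (hlam : 0 < lam) {α : Bias N} {f : MarkovTrigger}
    (h : IsDPTrigger N a lam ν α f) :
    ∃ c : ℕ → ℝ, (∀ k, 0 ≤ c k) ∧ (∀ k, N ≤ k → c k = 0) ∧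
      (∀ k < N, c k = lam +
        ∫ v, blockValue a ν c (biasSeq α (k + 1)) (N - (k + 1)) (k + 1) v ∂ν) ∧
      ∀ k < N, ∀ s ≤ k, IsSilentSet a ν c (biasSeq α s) (N - (k + 1)) k {e | f k s e = false} := by
  obtain ⟨-, J, hJ, hopt⟩ := h
  refine ⟨priceOf N lam ν J, hJ.priceOf_nonneg hlam, fun k hk => if_neg (by omega),
    fun k hk => ?_, fun k hk s hs e => ?_⟩
  · rw [priceOf, if_pos hk]
    simp only [hJ.eq_blockValue (N - (k + 1)) (k + 1) (k + 1) (by omega) le_rfl]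
  · have h1 := hJ.bellmanRHS_false ⟨k, hk⟩ ⟨s, Nat.lt_succ_of_le hs⟩ e
    have h2 := bellmanRHS_true (a := a) (lam := lam) (ν := ν) (J := J) hk
      (α ⟨k, hk⟩ ⟨s, Nat.lt_succ_of_le hs⟩) s e
    have h3 := hopt ⟨k, hk⟩ ⟨s, Nat.lt_succ_of_le hs⟩ e
    simp only at h1 h2 h3
    constructor
    · intro he
      rw [Set.mem_ofPred_eq] at he
      rw [← h1, ← h2]
      have := h3 true
      rwa [he] at this
    · intro he
      rw [Set.mem_ofPred_eq, Bool.not_eq_false] at he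
      rw [← h1, ← h2]
      have := h3 false
      rwa [he] at this

end DP

/-! ### Global asymptotic stability -/

/-- What a pass does: the new biases of every block are `0` or conditional means over the silent
sets for the old biases. -/
lemma IterStep.exists_prices {Ω : Type*} [MeasurableSpace Ω] {μ : Measure Ω}
    [IsProbabilityMeasure μ] {N : ℕ} {a lam : ℝ} (hlam : 0 < lam) {ξ : ℕ → Ω → ℝ}
    (hξ : ∀ k, Measurable (ξ k)) (hind : iIndepFun ξ μ) {ν : Measure ℝ}
    (hν : ∀ k, μ.map (ξ (k + 1)) = ν) {α α' : Bias N}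
    (h : IterStep μ N a lam ν ξ α α') :
    ∃ (c : ℕ → ℝ) (S : ℕ → ℕ → Set ℝ), (∀ k, 0 ≤ c k) ∧ (∀ k, N ≤ k → c k = 0) ∧
      (∀ k < N, c k = lam +
        ∫ v, blockValue a ν c (biasSeq α (k + 1)) (N - (k + 1)) (k + 1) v ∂ν) ∧
      (∀ s k, MeasurableSet (S s k)) ∧
      (∀ s k, s ≤ k → k < N →
        IsSilentSet a ν c (biasSeq α s) (N - (k + 1)) k (S s k)) ∧
      ∀ s n, s + n < N → biasSeq α' s (s + n) = 0 ∨
        biasSeq α' s (s + n) = ⨍ e in S s (s + n), e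
          ∂forwardLaw a (μ.map (ξ s)) ν (fun j => S s (s + j)) n := by
  obtain ⟨f, hf, hα'⟩ := h
  obtain ⟨c, h1, h2, h3, h4⟩ := hf.exists_prices hlam
  refine ⟨c, fun s k => {e | f k s e = false}, h1, h2, h3,
    fun s k => hf.1 k s (measurableSet_singleton false), fun s k hs hk => h4 k hk s hs,
    fun s n hn => ?_⟩
  have : biasSeq α' s (s + n) = conditionalBias μ a f ξ (s + n) s := by
    rw [biasSeq, dif_pos ⟨hn, by omega⟩]
    exact hα' ⟨s + n, hn⟩ ⟨s, Nat.lt_succ_of_le (Nat.le_add_right s n)⟩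
  rw [this]
  exact conditionalBias_eq hξ hind hν a hf.1 s n

lemma lyapunov_lt_iff {N : ℕ} {a : ℝ} (ha : a ≠ 0) {α : Bias N} {M : ℝ} (hM : 0 < M) :
    lyapunov a α < M ↔ ∀ s n, s + n < N → |biasSeq α s (s + n)| < M * |a| ^ (s + n) := by
  have ha' : 0 < |a| := abs_pos.2 ha
  rw [lyapunov, pi_norm_lt_iff hM]
  simp only [pi_norm_lt_iff hM, Real.norm_eq_abs, abs_div, abs_pow]
  constructor
  · intro h s n hn
    have := h ⟨s + n, hn⟩ ⟨s, Nat.lt_succ_of_le (Nat.le_add_right s n)⟩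
    rw [div_lt_iff₀ (by positivity)] at this
    rwa [biasSeq, dif_pos ⟨hn, by omega⟩]
  · intro h k s
    rw [div_lt_iff₀ (by positivity), ← biasSeq_apply α k s]
    have hs := s.2
    have := h s (k - s) (by omega)
    rwa [show (s : ℕ) + (k - s) = k by omega] at this

lemma abs_biasSeq_le_lyapunov {N : ℕ} {a : ℝ} (ha : a ≠ 0) (α : Bias N) (s n : ℕ)
    (hn : s + n < N) : |biasSeq α s (s + n)| ≤ lyapunov a α * |a| ^ (s + n) := by
  have ha' : 0 < |a| := abs_pos.2 ha
  have h1 : 0 ≤ lyapunov a α := norm_nonneg _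
  refine le_of_forall_pos_le_add fun ε hε => ?_
  have := (lyapunov_lt_iff ha (M := lyapunov a α + ε / |a| ^ (s + n)) (by positivity)).1
    (lt_add_of_pos_right _ (by positivity)) s n hn
  rw [add_mul, div_mul_cancel₀ _ (by positivity)] at this
  exact this.le

/-- The sup norm and the function `lyapunov` are equivalent norms. -/
lemma exists_norm_equiv {N : ℕ} {a : ℝ} (ha : a ≠ 0) :
    ∃ A B : ℝ, 0 < A ∧ 0 < B ∧ (∀ α : Bias N, ‖α‖ ≤ lyapunov a α * A) ∧
      ∀ α : Bias N, lyapunov a α ≤ ‖α‖ * B := by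
  have ha' : 0 < |a| := abs_pos.2 ha
  have hsum : ∀ g : ℕ → ℝ, (∀ k, 0 < g k) → ∀ k : Fin N,
      g k ≤ ∑ k ∈ Finset.range N, g k + 1 := fun g hg k =>
    (Finset.single_le_sum (f := g) (fun k _ => (hg k).le) (Finset.mem_range.2 k.2)).trans
      (le_add_of_nonneg_right zero_le_one)
  refine ⟨∑ k ∈ Finset.range N, |a| ^ k + 1, ∑ k ∈ Finset.range N, (|a| ^ k)⁻¹ + 1,
    by positivity, by positivity, fun α => ?_, fun α => ?_⟩
  · have hl : 0 ≤ lyapunov a α := norm_nonneg _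
    refine (pi_norm_le_iff_of_nonneg (by positivity)).2 fun k =>
      (pi_norm_le_iff_of_nonneg (by positivity)).2 fun s => ?_
    have hs := s.2
    have := abs_biasSeq_le_lyapunov ha α s (k - s) (by omega)
    rw [show (s : ℕ) + (k - s) = k by omega, biasSeq_apply] at this
    exact this.trans (mul_le_mul_of_nonneg_left
      (hsum (fun k => |a| ^ k) (fun k => by positivity) k) hl)
  · refine (pi_norm_le_iff_of_nonneg (by positivity)).2 fun k =>
      (pi_norm_le_iff_of_nonneg (by positivity)).2 fun s => ?_
    rw [Real.norm_eq_abs, abs_div, abs_pow, div_eq_mul_inv]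
    exact mul_le_mul ((norm_le_pi_norm (α k) s).trans (norm_le_pi_norm α k))
      (hsum (fun k => (|a| ^ k)⁻¹) (fun k => by positivity) k) (by positivity) (norm_nonneg _)

section Stability

variable {Ω : Type*} [MeasurableSpace Ω] {μ : Measure Ω} {N : ℕ}
  {a lam : ℝ} {ξ : ℕ → Ω → ℝ} {φ₀ φ : ℝ → ℝ}

/-- The density of the first noise variable of block `s`. -/
lemma exists_density_block (hφ₀ : IsSymmetricUnimodal φ₀) (hφ : IsSymmetricUnimodal φ)
    (h0 : μ.map (ξ 0) = densityLaw φ₀) (hν : ∀ k, μ.map (ξ (k + 1)) = densityLaw φ) (s : ℕ) :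
    ∃ ψ, IsSymmetricUnimodal ψ ∧ μ.map (ξ s) = densityLaw ψ := by
  cases s with
  | zero => exact ⟨φ₀, hφ₀, h0⟩
  | succ s => exact ⟨φ, hφ, hν s⟩

/-- The decrease of `lyapunov` in one pass, relative to any positive bound `M`. -/
lemma lyapunov_lt_of_le [IsProbabilityMeasure μ] (ha : a ≠ 0) (hlam : 0 < lam)
    (hξ : ∀ k, Measurable (ξ k)) (hind : iIndepFun ξ μ) (hφ₀ : IsSymmetricUnimodal φ₀)
    (hφ : IsSymmetricUnimodal φ) (h0 : μ.map (ξ 0) = densityLaw φ₀)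
    (hν : ∀ k, μ.map (ξ (k + 1)) = densityLaw φ) {α α' : Bias N} 
    (h : IterStep μ N a lam (densityLaw φ) ξ α α') {M : ℝ} (hM : 0 < M)
    (hα : lyapunov a α ≤ M) : lyapunov a α' < M := by
  have ha' : 0 < |a| := abs_pos.2 ha
  have hp : IsProbabilityMeasure (densityLaw φ) :=
    hν 0 ▸ Measure.isProbabilityMeasure_map (hξ 1).aemeasurable
  obtain ⟨c, S, hc, -, -, hSm, hS, hα'⟩ := h.exists_prices hlam hξ hind hν
  rw [lyapunov_lt_iff ha hM]
  intro s n hn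
  rcases hα' s n hn with h1 | h1 <;> rw [h1]
  · simpa using by positivity
  · obtain ⟨ψ, hψ, hlaw⟩ := exists_density_block hφ₀ hφ h0 hν s
    have hp' : IsProbabilityMeasure (densityLaw ψ) :=
      hlaw ▸ Measure.isProbabilityMeasure_map (hξ s).aemeasurable
    rw [hlaw, pow_add, ← mul_assoc]
    refine abs_setAverage_forwardLaw_lt hψ hφ ha (S := fun j => S s (s + j))
      (by positivity) n (fun i _ => hSm _ _) ((hS _ _ (by omega) hn).isBounded hc) fun i hi => ?_
    refine (hS s (s + i) (by omega) (by omega)).isTrimmed hφ ha hc fun j hj => ?_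
    have := (abs_biasSeq_le_lyapunov ha α s (i + j) (by omega)).trans
      (mul_le_mul_of_nonneg_right hα (by positivity))
    rwa [pow_add, pow_add, ← mul_assoc, ← mul_assoc, ← add_assoc] at this

lemma eq_zero_of_lyapunov_eq_zero (ha : a ≠ 0) {α : Bias N} (h : lyapunov a α = 0) : α = 0 := by
  have h1 := norm_eq_zero.1 h
  funext k s
  have h2 := congrFun (congrFun h1 k) s
  simpa [ha] using h2

/-- Every run converges to `0`. The blocks are treated in the order of decreasing `s`: once all
later blocks are close to `0`, so are the prices to those for zero bias; these decrease strictly in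
time, which bounds the silent sets of the present block from below. -/
theorem tendsto_biasSeq [IsProbabilityMeasure μ] (ha : a ≠ 0) (hlam : 0 < lam)
    (hξ : ∀ k, Measurable (ξ k)) (hind : iIndepFun ξ μ) (hφ₀ : IsSymmetricUnimodal φ₀)
    (hφ : IsSymmetricUnimodal φ) (h0 : μ.map (ξ 0) = densityLaw φ₀)
    (hν : ∀ k, μ.map (ξ (k + 1)) = densityLaw φ) {u : ℕ → Bias N}
    (hu : ∀ i, IterStep μ N a lam (densityLaw φ) ξ (u i) (u (i + 1)))
    (s k : ℕ) : Tendsto (fun i => biasSeq (u i) s k) atTop (𝓝 0) := by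
  have hp : IsProbabilityMeasure (densityLaw φ) :=
    hν 0 ▸ Measure.isProbabilityMeasure_map (hξ 1).aemeasurable
  choose c S hc hcN hcrec hSm hS hstep using fun i => (hu i).exists_prices hlam hξ hind hν
  obtain ⟨r, hr, hrc⟩ := exists_radius (a := a) (ν := densityLaw φ) hlam N
  have key : ∀ d s, N ≤ s + d → ∀ k, Tendsto (fun i => biasSeq (u i) s k) atTop (𝓝 0) := by
    intro d
    induction d with
    | zero =>
      intro s hs k
      refine tendsto_const_nhds.congr fun i => ?_
      rw [biasSeq, dif_neg (by omega)]
    | succ d ih =>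
      intro s hs
      have hprice : ∀ m k, s ≤ k → N ≤ k + m →
          Tendsto (fun i => c i k) atTop (𝓝 (idealPrice a lam (densityLaw φ) N k)) := by
        intro m
        induction m with
        | zero =>
          intro k hk hm
          rw [idealPrice, if_neg (by omega)]
          exact tendsto_const_nhds.congr fun i => (hcN i k (by omega)).symm
        | succ m ihm =>
          intro k hk hm
          rcases le_or_gt N k with hN | hN
          · exact ihm k hk (by omega)
          · rw [idealPrice, if_pos hN]
            simp only [hcrec _ k hN]
            refine Tendsto.const_add lam ?_
            refine tendsto_integral_filter_of_dominated_convergence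
              (fun _ => idealPrice a lam (densityLaw φ) N (k + 1) + 1)
              (Eventually.of_forall fun i =>
                (continuous_blockValue (hc i) _ _).aestronglyMeasurable) ?_
              (integrable_const _) (ae_of_all _ fun v => ?_)
            · filter_upwards [(ihm (k + 1) (by omega) (by omega)).eventually_le_const
                (lt_add_one _)] with i hi
              exact ae_of_all _ fun v => (norm_blockValue_le (hc i) _ _ _).trans hi
            · rw [idealValue_eq_blockValue N (N - (k + 1)) (k + 1) (by omega)]
              exact tendsto_blockValue hc _ _ (fun j h1 h2 => ihm j (by omega) (by omega))
                (fun j h1 h2 => ih (k + 1) (by omega) j) tendsto_const_nhds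
      have hball : ∀ᶠ i in atTop, ∀ k ∈ Finset.Ico s N, (2 * r) ^ 2 + c i (k + 1) < c i k := by
        rw [Filter.eventually_all_finset]
        intro k hk
        rw [Finset.mem_Ico] at hk
        have h1 := hprice N (k + 1) (by omega) (by omega)
        have h2 := hprice N k (by omega) (by omega)
        exact (h1.const_add ((2 * r) ^ 2)).eventually_lt h2 (hrc k hk.2)
      obtain ⟨ψ, hψ, hlaw⟩ := exists_density_block hφ₀ hφ h0 hν s
      have hp' : IsProbabilityMeasure (densityLaw ψ) :=
        hlaw ▸ Measure.isProbabilityMeasure_map (hξ s).aemeasurable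
      have hlim := tendsto_block hψ hφ ha (N - s) (b := fun i n => biasSeq (u i) s (s + n))
        (S := fun i n => S i s (s + n)) (fun i n _ => hSm _ _ _)
        (fun i n hn => (hS i s (s + n) (by omega) (by omega)).isBounded (hc i))
        (fun i M h n hn => (hS i s (s + n) (by omega) (by omega)).isTrimmed hφ ha (hc i)
          fun j hj => by
            have := h (n + j) (by omega)
            rwa [pow_add, ← mul_assoc, ← add_assoc] at this)
        (fun i n hn => by rw [← hlaw]; exact hstep i s n (by omega)) hr
        (hball.mono fun i hi n hn => (hS i s (s + n) (by omega) (by omega)).ball_subset (hc i)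
          (hi (s + n) (Finset.mem_Ico.2 (by omega))))
      intro k
      rcases le_or_gt s k with hk | hk
      · rcases le_or_gt N k with hN | hN
        · refine tendsto_const_nhds.congr fun i => ?_
          rw [biasSeq, dif_neg (by omega)]
        · have := hlim (k - s) (by omega)
          rwa [show s + (k - s) = k by omega] at this
      · refine tendsto_const_nhds.congr fun i => ?_
        rw [biasSeq, dif_neg (by omega)]
  exact key N s (by omega) k

theorem isGloballyAsymptoticallyStable [IsProbabilityMeasure μ] (ha : a ≠ 0) (hlam : 0 < lam)
    (hξ : ∀ k, Measurable (ξ k)) (hind : iIndepFun ξ μ) (hφ₀ : IsSymmetricUnimodal φ₀)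
    (hφ : IsSymmetricUnimodal φ) (h0 : μ.map (ξ 0) = densityLaw φ₀)
    (hν : ∀ k, μ.map (ξ (k + 1)) = densityLaw φ) :
    IsGloballyAsymptoticallyStable (IterStep μ N a lam (densityLaw φ) ξ) 0 := by
  have ha' : 0 < |a| := abs_pos.2 ha
  have hp : IsProbabilityMeasure (densityLaw φ) :=
    hν 0 ▸ Measure.isProbabilityMeasure_map (hξ 1).aemeasurable
  have htotal : ∀ α : Bias N, ∃ α', IterStep μ N a lam (densityLaw φ) ξ α α' := fun α => by
    obtain ⟨f, hf⟩ := exists_isDPTrigger (a := a) (ν := densityLaw φ) hlam α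
    exact ⟨_, f, hf, fun _ _ => rfl⟩
  have hmono : ∀ α α' : Bias N, IterStep μ N a lam (densityLaw φ) ξ α α' →
      lyapunov a α' ≤ lyapunov a α := fun α α' h => by
    refine le_of_forall_pos_le_add fun ε hε => ?_
    have : 0 ≤ lyapunov a α := norm_nonneg _
    exact (lyapunov_lt_of_le ha hlam hξ hind hφ₀ hφ h0 hν h (by linarith) (by linarith)).le
  have hlyap0 : lyapunov a (0 : Bias N) = 0 := by
    rw [lyapunov, norm_eq_zero]
    funext k s
    simp
  have hfix : ∀ α : Bias N, IterStep μ N a lam (densityLaw φ) ξ 0 α → α = 0 := fun α h =>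
    eq_zero_of_lyapunov_eq_zero ha (le_antisymm ((hmono _ _ h).trans hlyap0.le) (norm_nonneg _))
  refine ⟨htotal, fun α => ⟨hfix α, ?_⟩, fun ε hε => ?_, fun u hu => ?_⟩
  · rintro rfl
    obtain ⟨α', h⟩ := htotal 0
    have := hfix α' h
    rwa [this] at h
  · obtain ⟨A, B, hA, hB, h1, h2⟩ := exists_norm_equiv (N := N) ha
    refine ⟨ε / (B * A), by positivity, fun u hu hu0 i => ?_⟩
    rw [dist_zero_right] at hu0 ⊢
    have h3 : lyapunov a (u i) ≤ lyapunov a (u 0) :=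
      (antitone_nat_of_succ_le (f := fun i => lyapunov a (u i)) fun i => hmono _ _ (hu i))
        (Nat.zero_le i)
    calc ‖u i‖ ≤ lyapunov a (u i) * A := h1 _
      _ ≤ (‖u 0‖ * B) * A := by gcongr; exact h3.trans (h2 _)
      _ = ‖u 0‖ * (B * A) := by ring
      _ < ε := by rwa [lt_div_iff₀ (by positivity)] at hu0
  · refine tendsto_pi_nhds.2 fun k => tendsto_pi_nhds.2 fun s => ?_
    have := tendsto_biasSeq ha hlam hξ hind hφ₀ hφ h0 hν hu s k
    change Tendsto (fun i => u i k s) atTop (𝓝 0)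
    simpa only [biasSeq_apply] using this

end Stability

/-! ### The optimal thresholds -/

lemma silentCost_ideal {a lam : ℝ} {ν : Measure ℝ} (n : ℕ) (e : ℝ) :
    silentCost a ν (idealPrice a lam ν (n + 1)) (fun _ => 0) n 0 e =
      e ^ 2 + ∫ v, idealValue a lam ν n (a * e + v) ∂ν := by
  simp only [silentCost, sub_zero, idealValue_eq_blockValue (n + 1) n (0 + 1) (by omega)]

/-- For zero bias the cost of silence is even and increases with `|e|`, so silence is optimal exactly
on a compact symmetric interval, up to ties. -/
lemma exists_threshold {φ : ℝ → ℝ} (hφ : IsSymmetricUnimodal φ)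
    [IsProbabilityMeasure (densityLaw φ)] {a lam : ℝ} (ha : a ≠ 0) (hlam : 0 < lam) (n : ℕ) :
    ∃ r : ℝ, 0 ≤ r ∧ ∀ e : ℝ,
      (|e| ≤ r → e ^ 2 + ∫ v, idealValue a lam (densityLaw φ) n (a * e + v) ∂densityLaw φ ≤
        lam + ∫ v, idealValue a lam (densityLaw φ) n v ∂densityLaw φ) ∧
      (r < |e| → lam + ∫ v, idealValue a lam (densityLaw φ) n v ∂densityLaw φ ≤
        e ^ 2 + ∫ v, idealValue a lam (densityLaw φ) n (a * e + v) ∂densityLaw φ) := by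
  have hc := idealPrice_nonneg (a := a) (ν := densityLaw φ) hlam (n + 1)
  have hbowl := isBowl_silentCost (b := fun _ => 0) hφ ha hc (M := 0) n 0 (fun i _ => by simp)
  have hcont := continuous_silentCost (a := a) (ν := densityLaw φ) (b := fun _ => 0) hc n 0
  have hsq := sq_le_silentCost (a := a) (ν := densityLaw φ) (b := fun _ => 0) hc n 0
  simp only [← silentCost_ideal]
  set G := silentCost a (densityLaw φ) (idealPrice a lam (densityLaw φ) (n + 1)) (fun _ => 0) n 0
  set c := lam + ∫ v, idealValue a lam (densityLaw φ) n v ∂densityLaw φ with hcdef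
  have hG0 : G 0 ≤ c := by
    have : G 0 = ∫ v, idealValue a lam (densityLaw φ) n v ∂densityLaw φ := by
      simp [G, silentCost_ideal]
    rw [this, hcdef]
    linarith
  set A : Set ℝ := {e | 0 ≤ e ∧ G e ≤ c}
  have hcomp : IsCompact A := by
    refine Metric.isCompact_of_isClosed_isBounded ?_ ?_
    · exact (isClosed_le continuous_const continuous_id).inter
        (isClosed_le hcont continuous_const)
    · refine (Metric.isBounded_closedBall (x := (0 : ℝ)) (r := √c)).subset fun e he => ?_
      rw [Metric.mem_closedBall, Real.dist_eq, ← Real.sqrt_sq_eq_abs]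
      exact Real.sqrt_le_sqrt ((hsq e).trans he.2)
  have hmem := hcomp.sSup_mem ⟨0, le_rfl, hG0⟩
  refine ⟨sSup A, hmem.1, fun e => ⟨fun he => ?_, fun he => ?_⟩⟩
  · refine (hbowl e (sSup A) ?_).trans hmem.2
    have := pow_le_pow_left₀ (abs_nonneg e) he 2
    rw [sq_abs] at this
    simpa using this
  · by_contra hlt
    have h1 : G |e| ≤ G e := hbowl |e| e (by simp)
    exact absurd (le_csSup hcomp.bddAbove ⟨abs_nonneg e, h1.trans (not_le.1 hlt).le⟩) he.not_ge

/-- For zero bias the value functions do not depend on the last update time. -/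
lemma isDPTrigger_threshold {N : ℕ} {a lam : ℝ} {ν : Measure ℝ} {r : ℕ → ℝ}
    (hr : ∀ k < N, ∀ e : ℝ,
      (|e| ≤ r k → e ^ 2 + ∫ v, idealValue a lam ν (N - (k + 1)) (a * e + v) ∂ν ≤
        lam + ∫ v, idealValue a lam ν (N - (k + 1)) v ∂ν) ∧
      (r k < |e| → lam + ∫ v, idealValue a lam ν (N - (k + 1)) v ∂ν ≤
        e ^ 2 + ∫ v, idealValue a lam ν (N - (k + 1)) (a * e + v) ∂ν)) :
    IsDPTrigger N a lam ν (0 : Bias N) (fun k _ e => decide (r k < |e|)) := by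
  have hf : ∀ (k : Fin N) (s : Fin ((k : ℕ) + 1)) (e : ℝ),
      bellmanRHS a lam ν ((fun k _ => idealValue a lam ν (N - k)) ((k : ℕ) + 1))
        ((0 : Bias N) k s) k s e false =
      e ^ 2 + ∫ v, idealValue a lam ν (N - (k + 1)) (a * e + v) ∂ν := by
    intro k s e; simp [bellmanRHS]
  have ht : ∀ (k : Fin N) (s : Fin ((k : ℕ) + 1)) (e : ℝ),
      bellmanRHS a lam ν ((fun k _ => idealValue a lam ν (N - k)) ((k : ℕ) + 1))
        ((0 : Bias N) k s) k s e true =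
      lam + ∫ v, idealValue a lam ν (N - (k + 1)) v ∂ν := by
    intro k s e; simp [bellmanRHS]
  refine ⟨fun k s => measurable_to_bool ?_, fun k _ => idealValue a lam ν (N - k),
    ⟨fun s e => by simp [idealValue], fun k s e => ?_⟩, fun k s e d => ?_⟩
  · simpa [Set.preimage] using measurableSet_lt measurable_const measurable_abs
  · rw [hf, ht]
    simp only [show N - (k : ℕ) = N - (k + 1) + 1 by omega, idealValue]
  · by_cases h : r k < |e|
    · simp only [h, decide_true]
      cases d
      · rw [hf, ht]; exact (hr k k.2 e).2 h
      · exact le_rfl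
    · simp only [h, decide_false]
      cases d
      · exact le_rfl
      · rw [hf, ht]; exact (hr k k.2 e).1 (not_lt.1 h)

/-! ### Trajectories, channel outputs and linear predictions -/

/-- The linear prediction of `x j` from the channel outputs before time `j` along the trajectory `x`
under the trigger `f`. -/
noncomputable def prediction (a xbar : ℝ) (f : Trigger) (x : ℕ → ℝ) (j : ℕ) : ℝ :=
  linearPrediction a xbar j fun l => output f x l

lemma prediction_succ (a xbar : ℝ) (f : Trigger) (x : ℕ → ℝ) (j : ℕ) :
    prediction a xbar f x (j + 1) =
      a * if decision f x j then x j else prediction a xbar f x j := by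
  have : prediction a xbar f x (j + 1) =
    a * Sum.elim id (fun _ => prediction a xbar f x j) (output f x j) := rfl
  rw [this, output]
  split_ifs <;> rfl

lemma estimate_linearPredictor (a xbar : ℝ) (f : Trigger) (x : ℕ → ℝ) (j : ℕ) :
    estimate f (linearPredictor a xbar) x j =
      if decision f x j then x j else prediction a xbar f x j := by
  have : estimate f (linearPredictor a xbar) x j =
    Sum.elim id (fun _ => prediction a xbar f x j) (output f x j) := rfl
  rw [this, output]
  split_ifs <;> rfl

/-- The cost of stage `k` along the trajectory `x`. -/
noncomputable def stageCost (lam : ℝ) (f : Trigger) (g : Estimator) (x : ℕ → ℝ) (k : ℕ) : ℝ :=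
  |x k - estimate f g x k| ^ 2 + if decision f x k then lam else 0

/-- The biases that remain from time `j` on if nothing is transmitted any more: the estimates for
erased outputs from time `j` on, relative to the linear prediction. -/
noncomputable def silentBias (a xbar : ℝ) (f : Trigger) (g : Estimator) (x : ℕ → ℝ) (j i : ℕ) : ℝ :=
  g i (fun l => if (l : ℕ) < j then output f x l else Sum.inr ()) -
    a ^ (i - j) * prediction a xbar f x j

/-- One step of the lower bound: the value of the silent run in progress is at most the stage cost
plus the expected value of the run in progress one step later. If `x j` is transmitted, a new run
starts, and its value is at least the value for zero bias. -/
lemma blockValue_le_stageCost_add {φ : ℝ → ℝ} (hφ : IsSymmetricUnimodal φ)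
    [IsProbabilityMeasure (densityLaw φ)] {a lam : ℝ} (ha : a ≠ 0) (hlam : 0 < lam) (xbar : ℝ)
    {N j : ℕ} (hj : j < N) (f : Trigger) (g : Estimator) (x : ℕ → ℝ) :
    blockValue a (densityLaw φ) (idealPrice a lam (densityLaw φ) N)
        (silentBias a xbar f g x j) (N - j) j (x j - prediction a xbar f x j) ≤
      stageCost lam f g x j +
        ∫ v, blockValue a (densityLaw φ) (idealPrice a lam (densityLaw φ) N)
          (silentBias a xbar f g x (j + 1)) (N - (j + 1)) (j + 1)
          (a * x j - prediction a xbar f x (j + 1) + v) ∂densityLaw φ := by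
  rw [show N - j = N - (j + 1) + 1 by omega, blockValue, stageCost, prediction_succ]
  by_cases hd : decision f x j = true
  · simp only [hd, if_true, sub_self, zero_add]
    refine (min_le_right _ _).trans ?_
    rw [idealPrice, if_pos hj]
    have := integral_idealValue_le (a := a) (lam := lam) hφ hφ ha hlam (N := N) (s := j + 1)
      (by omega) (silentBias a xbar f g x (j + 1))
    have h2 : 0 ≤ |x j - estimate f g x j| ^ 2 := by positivity
    linarith
  · simp only [hd, if_false, add_zero, sq_abs, Bool.false_eq_true]
    refine (min_le_left _ _).trans (le_of_eq ?_)
    have hout : output f x j = Sum.inr () := if_neg hd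
    have hout' : ∀ l, (if l < j then output f x l else Sum.inr ()) =
        if l < j + 1 then output f x l else Sum.inr () := by
      intro l
      rcases lt_trichotomy l j with h | h | h
      · rw [if_pos h, if_pos (by omega)]
      · rw [if_neg (by omega), if_pos (by omega), h, hout]
      · rw [if_neg (by omega), if_neg (by omega)]
    congr 1
    · congr 1
      have : estimate f g x j =
          g j (fun l : Fin (j + 1) => if (l : ℕ) < j then output f x l else Sum.inr ()) := by
        rw [estimate]
        congr 1
        funext l
        rw [hout', if_pos l.2]
      rw [silentBias, this, Nat.sub_self, pow_zero]
      ring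
    · refine integral_congr_ae (ae_of_all _ fun v => ?_)
      simp only
      rw [← mul_sub]
      refine blockValue_congr _ _ (fun i hi => ?_) _
      rw [silentBias, silentBias, prediction_succ, if_neg hd]
      simp only [hout']
      rw [show i - j = i - (j + 1) + 1 by omega, pow_succ]
      ring

/-! ### Measurability of the closed loop -/

lemma continuous_blockValue_uncurry {a : ℝ} {ν : Measure ℝ} [IsProbabilityMeasure ν] {c : ℕ → ℝ}
    (hc : ∀ k, 0 ≤ c k) (n k : ℕ) :
    Continuous fun q : (ℕ → ℝ) × ℝ => blockValue a ν c q.1 n k q.2 := by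
  refine continuous_iff_continuousAt.2 fun q => ?_
  exact tendsto_blockValue (C := fun _ => c) (B := fun q : (ℕ → ℝ) × ℝ => q.1) (fun _ => hc) n k
    (fun _ _ _ => tendsto_const_nhds)
    (fun j _ _ => ((continuous_apply j).comp continuous_fst).tendsto q)
    (continuous_snd.tendsto q)

lemma measurable_linearPrediction (a xbar : ℝ) (n : ℕ) : Measurable (linearPrediction a xbar n) := by
  induction n with
  | zero => exact measurable_const
  | succ n ih =>
    have h1 : Measurable (Sum.elim (id : ℝ → ℝ) (fun _ : Unit => (0 : ℝ))) :=
      measurable_id.sumElim measurable_const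
    have h2 : Measurable (Sum.elim (fun _ : ℝ => (0 : ℝ)) (fun _ : Unit => (1 : ℝ))) :=
      measurable_const.sumElim measurable_const
    have h3 : Measurable fun z : Fin (n + 1) → Output => z (Fin.last n) := measurable_pi_apply _
    have h4 : Measurable fun z : Fin (n + 1) → Output => (Fin.init z : Fin n → Output) :=
      measurable_pi_lambda _ fun i => measurable_pi_apply _
    have : linearPrediction a xbar (n + 1) = fun z =>
        a * (Sum.elim id (fun _ => 0) (z (Fin.last n)) +
          linearPrediction a xbar n (Fin.init z) *
            Sum.elim (fun _ => 0) (fun _ => 1) (z (Fin.last n))) := by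
      funext z
      rw [linearPrediction]
      rcases z (Fin.last n) with y | y <;> simp
    rw [this]
    exact ((h1.comp h3).add ((ih.comp h4).mul (h2.comp h3))).const_mul a

section Adapted

variable {Ω : Type*} {m : MeasurableSpace Ω} {X : Ω → ℕ → ℝ} {f : Trigger} {j : ℕ}

lemma measurable_decision (hf : ∀ k, Measurable (f k)) (hX : ∀ i ≤ j, Measurable fun ω => X ω i)
    {i : ℕ} (hi : i ≤ j) : Measurable fun ω => decision f (X ω) i :=
  (hf i).comp (measurable_pi_lambda _ fun l => hX l (by omega))

lemma measurable_output (hf : ∀ k, Measurable (f k)) (hX : ∀ i ≤ j, Measurable fun ω => X ω i)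
    {i : ℕ} (hi : i ≤ j) : Measurable fun ω => output f (X ω) i :=
  Measurable.ite (measurable_decision hf hX hi (measurableSet_singleton true))
    (measurable_inl.comp (hX i hi)) measurable_const

lemma measurable_prediction_succ (hf : ∀ k, Measurable (f k))
    (hX : ∀ i ≤ j, Measurable fun ω => X ω i) (a xbar : ℝ) :
    Measurable fun ω => prediction a xbar f (X ω) (j + 1) :=
  (measurable_linearPrediction a xbar (j + 1)).comp
    (measurable_pi_lambda _ fun l => measurable_output hf hX (by omega))

lemma measurable_silentBias_succ (hf : ∀ k, Measurable (f k)) {g : Estimator}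
    (hg : ∀ k, Measurable (g k)) (hX : ∀ i ≤ j, Measurable fun ω => X ω i) (a xbar : ℝ) :
    Measurable fun ω => silentBias a xbar f g (X ω) (j + 1) := by
  refine measurable_pi_lambda _ fun i => ?_
  refine Measurable.sub ((hg i).comp (measurable_pi_lambda _ fun l => ?_))
    ((measurable_prediction_succ hf hX a xbar).const_mul _)
  by_cases h : (l : ℕ) < j + 1
  · simp only [h, if_true]
    exact measurable_output hf hX (by omega)
  · simp only [h, if_false]
    exact measurable_const

end Adapted

/-! ### The cost along the closed loop -/

section Cost

variable {Ω : Type*} [mΩ : MeasurableSpace Ω] {μ : Measure Ω} {a lam xbar : ℝ} {x₀ : Ω → ℝ}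
  {w : ℕ → Ω → ℝ} {N : ℕ}

/-- The state trajectory as a function of the realization. -/
noncomputable def trajectory (a : ℝ) (x₀ : Ω → ℝ) (w : ℕ → Ω → ℝ) (ω : Ω) : ℕ → ℝ :=
  state a (x₀ ω) fun j => w j ω

lemma cost_eq (μ : Measure Ω) (N : ℕ) (a lam : ℝ) (x₀ : Ω → ℝ) (w : ℕ → Ω → ℝ) (f : Trigger)
    (g : Estimator) : cost μ N a lam x₀ w f g =
      ∫⁻ ω, ENNReal.ofReal (∑ k ∈ Finset.range N, stageCost lam f g (trajectory a x₀ w ω) k) ∂μ :=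
  rfl

lemma stageCost_nonneg (hlam : 0 < lam) (f : Trigger) (g : Estimator) (x : ℕ → ℝ) (k : ℕ) :
    0 ≤ stageCost lam f g x k := by
  unfold stageCost
  split_ifs <;> positivity

lemma measurable_drivingNoise (hx₀ : Measurable x₀) (hw : ∀ k, Measurable (w k)) (k : ℕ) :
    Measurable (drivingNoise x₀ xbar w k) := by
  cases k with
  | zero => exact hx₀.sub_const xbar
  | succ k => exact hw k

lemma measurable_trajectory (hξ : ∀ k, Measurable (drivingNoise x₀ xbar w k)) {i j : ℕ}
    (hij : i ≤ j) : Measurable[noiseFiltration hξ j] fun ω => trajectory a x₀ w ω i := by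
  induction i with
  | zero =>
    have : (fun ω => trajectory a x₀ w ω 0) = fun ω => drivingNoise x₀ xbar w 0 ω + xbar := by
      funext ω; simp [trajectory, state, drivingNoise]
    rw [this]
    exact (measurable_noiseFiltration hξ (Nat.zero_le j)).add_const xbar
  | succ i ih =>
    exact ((ih (by omega)).const_mul a).add (measurable_noiseFiltration hξ hij)

/-- Integrating out the next noise variable in the value of the run in progress. -/
lemma lintegral_value_next [IsProbabilityMeasure μ] {ν : Measure ℝ} [IsProbabilityMeasure ν]
    (hξ : ∀ k, Measurable (drivingNoise x₀ xbar w k))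
    (hind : iIndepFun (drivingNoise x₀ xbar w) μ)
    (hν : ∀ k, μ.map (drivingNoise x₀ xbar w (k + 1)) = ν) {c : ℕ → ℝ} (hc : ∀ k, 0 ≤ c k)
    {f : Trigger} (hf : ∀ k, Measurable (f k)) (n k j : ℕ) {b : Ω → ℕ → ℝ}
    (hb : Measurable[noiseFiltration hξ j] b) :
    ∫⁻ ω, ENNReal.ofReal (blockValue a ν c (b ω) n k (trajectory a x₀ w ω (j + 1) -
        prediction a xbar f (trajectory a x₀ w ω) (j + 1))) ∂μ =
      ∫⁻ ω, ENNReal.ofReal (∫ v, blockValue a ν c (b ω) n k (a * trajectory a x₀ w ω j -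
        prediction a xbar f (trajectory a x₀ w ω) (j + 1) + v) ∂ν) ∂μ := by
  have hX : ∀ i ≤ j, Measurable[noiseFiltration hξ j] fun ω => trajectory a x₀ w ω i :=
    fun i hi => measurable_trajectory hξ hi
  have hq : Measurable[noiseFiltration hξ j] fun ω => (b ω, a * trajectory a x₀ w ω j -
      prediction a xbar f (trajectory a x₀ w ω) (j + 1)) :=
    hb.prodMk (((hX j le_rfl).const_mul a).sub (measurable_prediction_succ hf hX a xbar))
  have hF : Measurable fun p : ((ℕ → ℝ) × ℝ) × ℝ =>
      ENNReal.ofReal (blockValue a ν c p.1.1 n k (p.1.2 + p.2)) :=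
    ((continuous_blockValue_uncurry hc n k).measurable.comp
      (by fun_prop : Measurable fun p : ((ℕ → ℝ) × ℝ) × ℝ => (p.1.1, p.1.2 + p.2))).ennreal_ofReal
  have := lintegral_indepFun (hq.mono ((noiseFiltration hξ).le j) le_rfl) (hξ (j + 1))
    (indepFun_next hξ hind hq) hF
  rw [hν] at this
  refine Eq.trans (lintegral_congr fun ω => ?_) (this.trans (lintegral_congr fun ω => ?_))
  · have : trajectory a x₀ w ω (j + 1) =
        a * trajectory a x₀ w ω j + drivingNoise x₀ xbar w (j + 1) ω := rfl
    rw [this]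
    congr 2
    ring
  · rw [ofReal_integral_eq_lintegral_ofReal _ (ae_of_all _ fun v => blockValue_nonneg hc _ _ _)]
    simpa using integrable_blockValue (ρ := ν) hc n k 1 _

lemma measurable_integral_value {ν : Measure ℝ} [IsProbabilityMeasure ν]
    {c : ℕ → ℝ} (hc : ∀ k, 0 ≤ c k) (n k : ℕ) {b : Ω → ℕ → ℝ} {q : Ω → ℝ} (hb : Measurable b)
    (hq : Measurable q) :
    Measurable fun ω => ENNReal.ofReal (∫ v, blockValue a ν c (b ω) n k (q ω + v) ∂ν) := by
  refine Measurable.ennreal_ofReal ?_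
  have hF : StronglyMeasurable fun p : ((ℕ → ℝ) × ℝ) × ℝ =>
      blockValue a ν c p.1.1 n k (p.1.2 + p.2) :=
    ((continuous_blockValue_uncurry hc n k).measurable.comp
      (by fun_prop : Measurable fun p : ((ℕ → ℝ) × ℝ) × ℝ =>
        (p.1.1, p.1.2 + p.2))).stronglyMeasurable
  exact (hF.integral_prod_right' (ν := ν)).measurable.comp (hb.prodMk hq)

/-- No trigger and estimator have a smaller expected cost than the value function for zero bias
predicts. -/
theorem ofReal_integral_idealValue_le_cost [IsProbabilityMeasure μ] (ha : a ≠ 0) (hlam : 0 < lam)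
    (hξ : ∀ k, Measurable (drivingNoise x₀ xbar w k))
    (hind : iIndepFun (drivingNoise x₀ xbar w) μ) {φ₀ φ : ℝ → ℝ}
    (hφ₀ : IsSymmetricUnimodal φ₀) (hφ : IsSymmetricUnimodal φ)
    (h0 : μ.map (drivingNoise x₀ xbar w 0) = densityLaw φ₀)
    (hν : ∀ k, μ.map (drivingNoise x₀ xbar w (k + 1)) = densityLaw φ)
    {f : Trigger} {g : Estimator} (hf : ∀ k, Measurable (f k)) (hg : ∀ k, Measurable (g k)) :
    ENNReal.ofReal (∫ e, idealValue a lam (densityLaw φ) N e ∂densityLaw φ₀) ≤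
      cost μ N a lam x₀ w f g := by
  have hp : IsProbabilityMeasure (densityLaw φ) :=
    hν 0 ▸ Measure.isProbabilityMeasure_map (hξ 1).aemeasurable
  have hp0 : IsProbabilityMeasure (densityLaw φ₀) :=
    h0 ▸ Measure.isProbabilityMeasure_map (hξ 0).aemeasurable
  set ν := densityLaw φ
  set c := idealPrice a lam ν N
  have hc : ∀ k, 0 ≤ c k := idealPrice_nonneg hlam N
  set X := trajectory a x₀ w
  -- the value of the run in progress at time `j`
  let L : ℕ → Ω → ENNReal := fun j ω => ENNReal.ofReal
    (blockValue a ν c (silentBias a xbar f g (X ω) j) (N - j) j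
      (X ω j - prediction a xbar f (X ω) j))
  have hX : ∀ j, ∀ i ≤ j, Measurable[noiseFiltration hξ j] fun ω => X ω i :=
    fun j i hi => measurable_trajectory hξ hi
  have hstep : ∀ j < N, ∫⁻ ω, L j ω ∂μ ≤
      ∫⁻ ω, ENNReal.ofReal (stageCost lam f g (X ω) j) ∂μ + ∫⁻ ω, L (j + 1) ω ∂μ := by
    intro j hj
    have hbm := measurable_silentBias_succ hf hg (hX j) a xbar
    have hqm : Measurable[noiseFiltration hξ j] fun ω =>
        a * X ω j - prediction a xbar f (X ω) (j + 1) :=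
      ((hX j j le_rfl).const_mul a).sub (measurable_prediction_succ hf (hX j) a xbar)
    have hnext := lintegral_value_next (a := a) hξ hind hν hc hf (N - (j + 1)) (j + 1) j hbm
    refine le_trans ?_ (add_le_add_right hnext.ge _)
    rw [← lintegral_add_right _ (measurable_integral_value hc _ _
      (hbm.mono ((noiseFiltration hξ).le j) le_rfl) (hqm.mono ((noiseFiltration hξ).le j) le_rfl))]
    refine lintegral_mono fun ω => ?_
    refine (ENNReal.ofReal_le_ofReal
      (blockValue_le_stageCost_add hφ ha hlam xbar hj f g (X ω))).trans ?_
    exact ENNReal.ofReal_add_le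
  have htel : ∀ j ≤ N, ∫⁻ ω, L 0 ω ∂μ ≤
      ∫⁻ ω, ENNReal.ofReal (∑ k ∈ Finset.range j, stageCost lam f g (X ω) k) ∂μ +
        ∫⁻ ω, L j ω ∂μ := by
    intro j hj
    induction j with
    | zero => simp
    | succ j ih =>
      refine (ih (by omega)).trans ((add_le_add_right (hstep j (by omega)) _).trans ?_)
      rw [← add_assoc]
      refine add_le_add_left ((le_lintegral_add _ _).trans (lintegral_mono fun ω => ?_)) _
      rw [Finset.sum_range_succ, ENNReal.ofReal_add
        (Finset.sum_nonneg fun k _ => stageCost_nonneg hlam f g _ k)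
        (stageCost_nonneg hlam f g _ j)]
  have hfinal := htel N le_rfl
  have hN : ∫⁻ ω, L N ω ∂μ = 0 := by simp [L, blockValue]
  rw [hN, add_zero] at hfinal
  rw [cost_eq]
  refine le_trans ?_ hfinal
  -- before the first transmission the biases do not depend on the trajectory
  set b : ℕ → ℝ := fun i => g i (fun _ => Sum.inr ()) - a ^ i * xbar with hbdef
  have hL0 : ∀ ω, L 0 ω = ENNReal.ofReal (blockValue a ν c b N 0 (drivingNoise x₀ xbar w 0 ω)) := by
    intro ω
    simp [L, hbdef, prediction, linearPrediction, drivingNoise, X, trajectory, state]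
    rfl
  have hmeas : Measurable fun e => ENNReal.ofReal (blockValue a ν c b N 0 e) :=
    (continuous_blockValue hc N 0).measurable.ennreal_ofReal
  simp only [hL0]
  rw [← lintegral_map hmeas (hξ 0), h0, ← ofReal_integral_eq_lintegral_ofReal
    (integrable_blockValue_self hc N 0) (ae_of_all _ fun e => blockValue_nonneg hc _ _ _)]
  exact ENNReal.ofReal_le_ofReal
    (integral_idealValue_le hφ₀ hφ ha hlam (N := N) (s := 0) (Nat.zero_le N) b)

/-- The symmetric threshold trigger with optimal thresholds and the linear predictor attain the
value for zero bias. -/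
theorem cost_threshold_le [IsProbabilityMeasure μ] (hlam : 0 < lam)
    (hξ : ∀ k, Measurable (drivingNoise x₀ xbar w k))
    (hind : iIndepFun (drivingNoise x₀ xbar w) μ) {ν π : Measure ℝ}
    (h0 : μ.map (drivingNoise x₀ xbar w 0) = π)
    (hν : ∀ k, μ.map (drivingNoise x₀ xbar w (k + 1)) = ν) {r : ℕ → ℝ}
    (hr : ∀ k < N, ∀ e : ℝ,
      (|e| ≤ r k → e ^ 2 + ∫ v, idealValue a lam ν (N - (k + 1)) (a * e + v) ∂ν ≤
        lam + ∫ v, idealValue a lam ν (N - (k + 1)) v ∂ν) ∧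
      (r k < |e| → lam + ∫ v, idealValue a lam ν (N - (k + 1)) v ∂ν ≤
        e ^ 2 + ∫ v, idealValue a lam ν (N - (k + 1)) (a * e + v) ∂ν))
    {f : Trigger} (hf : ∀ k, Measurable (f k)) (hfr : IsSymmetricThreshold a xbar r f) :
    cost μ N a lam x₀ w f (linearPredictor a xbar) ≤
      ENNReal.ofReal (∫ e, idealValue a lam ν N e ∂π) := by
  have hp : IsProbabilityMeasure ν := hν 0 ▸ Measure.isProbabilityMeasure_map (hξ 1).aemeasurable
  have hp0 : IsProbabilityMeasure π := h0 ▸ Measure.isProbabilityMeasure_map (hξ 0).aemeasurable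
  set X := trajectory a x₀ w
  let L : ℕ → Ω → ENNReal := fun j ω =>
    ENNReal.ofReal (idealValue a lam ν (N - j) (X ω j - prediction a xbar f (X ω) j))
  have hX : ∀ j, ∀ i ≤ j, Measurable[noiseFiltration hξ j] fun ω => X ω i :=
    fun j i hi => measurable_trajectory hξ hi
  have hX' : ∀ i, Measurable fun ω => X ω i := fun i =>
    (hX i i le_rfl).mono ((noiseFiltration hξ).le i) le_rfl
  have hpred : ∀ j, Measurable fun ω => prediction a xbar f (X ω) j := by
    intro j
    cases j with
    | zero => exact measurable_const
    | succ j => exact measurable_prediction_succ hf (fun i _ => hX' i) a xbar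
  have hstage : ∀ j, Measurable fun ω =>
      ENNReal.ofReal (stageCost lam f (linearPredictor a xbar) (X ω) j) := by
    intro j
    simp only [stageCost, estimate_linearPredictor]
    have hd : MeasurableSet {ω | decision f (X ω) j = true} :=
      measurable_decision (j := j) hf (fun i _ => hX' i) le_rfl (measurableSet_singleton true)
    refine Measurable.ennreal_ofReal (Measurable.add (Measurable.pow_const ?_ 2)
      (Measurable.ite hd measurable_const measurable_const))
    exact measurable_abs.comp ((hX' j).sub (Measurable.ite hd (hX' j) (hpred j)))
  have hstep : ∀ j < N, ∫⁻ ω, ENNReal.ofReal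
      (stageCost lam f (linearPredictor a xbar) (X ω) j) ∂μ + ∫⁻ ω, L (j + 1) ω ∂μ ≤
        ∫⁻ ω, L j ω ∂μ := by
    intro j hj
    have hnext := lintegral_value_next (a := a) hξ hind hν
      (idealPrice_nonneg (a := a) (ν := ν) hlam N) hf
      (N - (j + 1)) (j + 1) j (b := fun _ _ => 0) measurable_const
    simp only [← idealValue_eq_blockValue N (N - (j + 1)) (j + 1) (by omega)] at hnext
    change _ + ∫⁻ ω, ENNReal.ofReal _ ∂μ ≤ _
    rw [hnext, ← lintegral_add_left (hstage j)]
    refine lintegral_mono fun ω => ?_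
    rw [← ENNReal.ofReal_add (stageCost_nonneg hlam f _ _ j)
      (integral_nonneg fun v => idealValue_nonneg hlam _ _)]
    refine ENNReal.ofReal_le_ofReal ?_
    have hthr := hfr (X ω) j
    change _ ↔ r j < |X ω j - prediction a xbar f (X ω) j| at hthr
    have hopt := hr j hj (X ω j - prediction a xbar f (X ω) j)
    rw [show N - j = N - (j + 1) + 1 by omega, idealValue, stageCost, estimate_linearPredictor]
    change _ + ∫ v, idealValue a lam ν (N - (j + 1)) (a * X ω j -
      prediction a xbar f (X ω) (j + 1) + v) ∂ν ≤ _
    rw [prediction_succ]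
    by_cases hd : decision f (X ω) j = true
    · rw [min_eq_right (hopt.2 (hthr.1 hd))]
      simp [hd]
    · rw [min_eq_left (hopt.1 (not_lt.1 fun h => hd (hthr.2 h)))]
      simp [hd, mul_sub]
  have htel : ∀ j ≤ N, ∫⁻ ω, ENNReal.ofReal (∑ k ∈ Finset.range j,
      stageCost lam f (linearPredictor a xbar) (X ω) k) ∂μ + ∫⁻ ω, L j ω ∂μ ≤
        ∫⁻ ω, L 0 ω ∂μ := by
    intro j hj
    induction j with
    | zero => simp
    | succ j ih =>
      refine le_trans ?_ (ih (by omega))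
      refine le_trans ?_ (add_le_add_right (hstep j (by omega)) _)
      rw [← add_assoc, ← lintegral_add_right _ (hstage j)]
      refine add_le_add_left (lintegral_mono fun ω => ?_) _
      rw [Finset.sum_range_succ]
      exact ENNReal.ofReal_add_le
  rw [cost_eq]
  refine (le_self_add.trans (htel N le_rfl)).trans (le_of_eq ?_)
  have hL0 : ∀ ω, L 0 ω = ENNReal.ofReal (idealValue a lam ν N (drivingNoise x₀ xbar w 0 ω)) :=
    fun ω => rfl
  have hmeas : Measurable fun e => ENNReal.ofReal (idealValue a lam ν N e) :=
    (continuous_idealValue hlam N).measurable.ennreal_ofReal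
  simp only [hL0]
  rw [← lintegral_map hmeas (hξ 0), h0, ← ofReal_integral_eq_lintegral_ofReal
    (by simpa using integrable_idealValue (a := a) (ν := ν) hlam N 0)
    (ae_of_all _ fun e => idealValue_nonneg hlam _ _)]

end Cost

/-! ### The symmetric threshold trigger -/

/-- The linear prediction under the symmetric threshold trigger, as a function of the trajectory. -/
noncomputable def thresholdPrediction (a xbar : ℝ) (r : ℕ → ℝ) : ℕ → (ℕ → ℝ) → ℝ
  | 0, _ => xbar
  | k + 1, x => a * if r k < |x k - thresholdPrediction a xbar r k x| then x k
      else thresholdPrediction a xbar r k x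

/-- The trigger that transmits when the error of the linear prediction exceeds the threshold. The
states after time `k`, on which the prediction of `x k` does not depend, are filled up with `0`. -/
noncomputable def thresholdTrigger (a xbar : ℝ) (r : ℕ → ℝ) : Trigger := fun k h =>
  decide (r k < |h (Fin.last k) - thresholdPrediction a xbar r k
    fun i => if hi : i < k + 1 then h ⟨i, hi⟩ else 0|)

lemma thresholdPrediction_congr (a xbar : ℝ) (r : ℕ → ℝ) {x y : ℕ → ℝ} (k : ℕ)
    (h : ∀ i < k, x i = y i) :
    thresholdPrediction a xbar r k x = thresholdPrediction a xbar r k y := by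
  induction k with
  | zero => rfl
  | succ k ih =>
    rw [thresholdPrediction, thresholdPrediction, ih fun i hi => h i (by omega), h k (by omega)]

lemma measurable_thresholdPrediction (a xbar : ℝ) (r : ℕ → ℝ) (k : ℕ) :
    Measurable (thresholdPrediction a xbar r k) := by
  induction k with
  | zero => exact measurable_const
  | succ k ih =>
    have hk : Measurable fun x : ℕ → ℝ => x k := measurable_pi_apply k
    exact (Measurable.ite (measurableSet_lt measurable_const
      (measurable_abs.comp (hk.sub ih))) hk ih).const_mul a

lemma measurable_thresholdTrigger (a xbar : ℝ) (r : ℕ → ℝ) (k : ℕ) :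
    Measurable (thresholdTrigger a xbar r k) := by
  have h1 : Measurable fun (h : Fin (k + 1) → ℝ) (i : ℕ) =>
      if hi : i < k + 1 then h ⟨i, hi⟩ else 0 := by
    refine measurable_pi_lambda _ fun i => ?_
    by_cases hi : i < k + 1
    · simp only [hi, dif_pos]
      exact measurable_pi_apply _
    · simp only [hi, dif_neg, not_false_eq_true]
      exact measurable_const
  have h2 : Measurable fun h : Fin (k + 1) → ℝ => h (Fin.last k) := measurable_pi_apply _
  refine measurable_to_bool ?_
  have := measurableSet_lt (measurable_const (a := r k))
    (measurable_abs.comp (h2.sub ((measurable_thresholdPrediction a xbar r k).comp h1)))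
  simpa [Set.preimage, thresholdTrigger] using this

lemma decision_thresholdTrigger (a xbar : ℝ) (r : ℕ → ℝ) (x : ℕ → ℝ) (k : ℕ) :
    decision (thresholdTrigger a xbar r) x k = true ↔
      r k < |x k - thresholdPrediction a xbar r k x| := by
  rw [decision, thresholdTrigger, decide_eq_true_iff]
  rw [thresholdPrediction_congr (y := x) a xbar r k fun i hi => dif_pos (by omega)]
  rfl

lemma prediction_thresholdTrigger (a xbar : ℝ) (r : ℕ → ℝ) (x : ℕ → ℝ) (k : ℕ) :
    prediction a xbar (thresholdTrigger a xbar r) x k = thresholdPrediction a xbar r k x := by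
  induction k with
  | zero => rfl
  | succ k ih =>
    rw [prediction_succ, thresholdPrediction, ih]
    simp only [decision_thresholdTrigger]

lemma isSymmetricThreshold_thresholdTrigger (a xbar : ℝ) (r : ℕ → ℝ) :
    IsSymmetricThreshold a xbar r (thresholdTrigger a xbar r) := by
  intro x k
  rw [decision_thresholdTrigger, ← prediction_thresholdTrigger]
  rfl

end EventTrigger

theorem theorem1 {Ω : Type*} [MeasurableSpace Ω] (μ : Measure Ω) [IsProbabilityMeasure μ]
    (N : ℕ) (a lam xbar : ℝ) (ha : a ≠ 0) (hlam : 0 < lam)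
    (x₀ : Ω → ℝ) (w : ℕ → Ω → ℝ) (hx₀ : Measurable x₀) (hw : ∀ k, Measurable (w k))
    (hindep : iIndepFun (EventTrigger.drivingNoise x₀ xbar w) μ)
    (φ₀ φw : ℝ → ℝ)
    (hlaw₀ : μ.map (fun ω => x₀ ω - xbar) = EventTrigger.densityLaw φ₀)
    (hlaww : ∀ k, μ.map (w k) = EventTrigger.densityLaw φw)
    (hvar₀ : Integrable (fun x => x ^ 2 * φ₀ x)) (hvarw : Integrable (fun x => x ^ 2 * φw x))
    (hφ₀ : EventTrigger.IsSymmetricUnimodal φ₀) (hφw : EventTrigger.IsSymmetricUnimodal φw) :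
    -- `0` is a globally asymptotically stable fixpoint of the iterative procedure
    EventTrigger.IsGloballyAsymptoticallyStable
      (EventTrigger.IterStep μ N a lam (EventTrigger.densityLaw φw)
        (EventTrigger.drivingNoise x₀ xbar w)) (0 : EventTrigger.Bias N) ∧
    -- the sup norm of the rescaled biases decreases strictly outside `0`
    (∀ α α' : EventTrigger.Bias N, α ≠ 0 →
      EventTrigger.IterStep μ N a lam (EventTrigger.densityLaw φw)
        (EventTrigger.drivingNoise x₀ xbar w) α α' →
      EventTrigger.lyapunov a α' < EventTrigger.lyapunov a α) ∧
    -- the linear predictor and a symmetric threshold trigger, which results from dynamic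
    -- programming with bias `0`, are jointly optimal
    ∃ r : ℕ → ℝ, (∀ k, 0 ≤ r k) ∧
      EventTrigger.IsDPTrigger N a lam (EventTrigger.densityLaw φw) (0 : EventTrigger.Bias N)
        (fun k _ e => decide (r k < |e|)) ∧
      ∃ f : EventTrigger.Trigger, (∀ k, Measurable (f k)) ∧
        EventTrigger.IsSymmetricThreshold a xbar r f ∧
        ∀ (f' : EventTrigger.Trigger) (g' : EventTrigger.Estimator),
          (∀ k, Measurable (f' k)) → (∀ k, Measurable (g' k)) →
          EventTrigger.cost μ N a lam x₀ w f (EventTrigger.linearPredictor a xbar) ≤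
            EventTrigger.cost μ N a lam x₀ w f' g' := by
  have hξ : ∀ k, Measurable (EventTrigger.drivingNoise x₀ xbar w k) :=
    EventTrigger.measurable_drivingNoise hx₀ hw
  have hp : IsProbabilityMeasure (EventTrigger.densityLaw φw) :=
    hlaww 0 ▸ Measure.isProbabilityMeasure_map (hw 0).aemeasurable
  refine ⟨EventTrigger.isGloballyAsymptoticallyStable ha hlam hξ hindep hφ₀ hφw hlaw₀ hlaww,
    fun α α' hα h => ?_, ?_⟩
  · refine EventTrigger.lyapunov_lt_of_le ha hlam hξ hindep hφ₀ hφw hlaw₀ hlaww h ?_ le_rfl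
    exact (norm_nonneg _).lt_of_ne' fun h0 => hα (EventTrigger.eq_zero_of_lyapunov_eq_zero ha h0)
  · choose ρ hρ0 hρ using EventTrigger.exists_threshold (lam := lam) hφw ha hlam
    refine ⟨fun k => ρ (N - (k + 1)), fun k => hρ0 _,
      EventTrigger.isDPTrigger_threshold fun k _ => hρ _,
      EventTrigger.thresholdTrigger a xbar fun k => ρ (N - (k + 1)),
      EventTrigger.measurable_thresholdTrigger a xbar _,
      EventTrigger.isSymmetricThreshold_thresholdTrigger a xbar _, fun f' g' hf' hg' => ?_⟩
    exact (EventTrigger.cost_threshold_le hlam hξ hindep hlaw₀ hlaww (fun k _ => hρ _)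
      (EventTrigger.measurable_thresholdTrigger a xbar _)
      (EventTrigger.isSymmetricThreshold_thresholdTrigger a xbar _)).trans
      (EventTrigger.ofReal_integral_idealValue_le_cost ha hlam hξ hindep hφ₀ hφw hlaw₀ hlaww
        hf' hg')
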